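/- Let $n\ge 1$ and let $\mathcal X=\mathcal Y$ be the unit sphere $\mathbb S^n$ or the flat torus $\mathbb T^n=\mathbb R^n/\mathbb Z^n$, with its Riemannian volume $\mathrm dx$. Let $c:\mathcal X\times\mathcal Y\to\mathbb R\cup\{+\infty\}$ be continuous, locally semi-concave where it is finite, and twisted: for each $x$, the map $y\mapsto\nabla_xc(x,y)$ is injective on the set of $y$ at which $c(\cdot,y)$ is finite and differentiable at $x$. Let $K\subset\mathcal X\times\mathcal Y$ be a compact set such that $c$ is finite and of class $C^4$ near every point of $K$ and $\det D^2_{xy}c\ne0$ on $K$ (if $c$ is finite and smooth everywhere, $K=\mathcal X\times\mathcal Y$). Let $g\in C^{1,1}(\mathcal X)$ be a probability density with a positive lower bound, and let $\lambda>0$. Notation. For $x\in\mathcal X$ let $\mathcal T(x,p)$ be the point $y$ with $\nabla_xc(x,y)=-p$, and put $T_u(x)=\mathcal T(x,\nabla u(x))$, $A(x,p)=D^2_{xx}c(x,\mathcal T(x,p))$, $\tilde g(x,p)=g(\mathcal T(x,p))/|\det D^2_{xy}c(x,\mathcal T(x,p))|$. Let $u^c(y)=\sup_x(-c(x,y)-u(x))$,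 $v^c(x)=\sup_y(-c(x,y)-v(y))$, and call $u$ $c$-convex if $u=u^{cc}$. Here "$a<D^2u+A(x,\nabla u)<b$" includes that $T_u$ is defined on all of $\mathcal X$ and that its graph lies in $K$. There is a constant $\tau_{max}>0$, depending only on the manifold (in particular on $n$), on $\lambda$, on $c$ (with $K$) and on $g$, such that the following holds. Let $f\in C^{1,1}(\mathcal X)$ be a probability density with a positive lower bound, and let $u\in C^{3,\alpha}(\mathcal X)$, $0<\alpha<1$, with $\int_{\mathcal X} u\,\mathrm dx=0$, be a $c$-convex solution of $$f(x)-\tilde g(x,\nabla u)\det\bigl(D^2u+A(x,\nabla u)\bigr)=0,\qquad \frac2\lambda<D^2u+A(x,\nabla u)<\frac\lambda2\quad\text{on }\mathcal X.$$ Let $r>0$ be such that every $v$ in $$V_\lambda=\Bigl\{v\in C^2(\mathcal X):\ \int_{\mathcal X} v\,\mathrm dx=0,\ \|u-v\|_{C^2(\mathcal X)}\le r\Bigr\}$$ satisfies $\frac1\lambda<D^2v+A(x,\nabla v)<\lambda$ on $\mathcal X$. Let $$\mathcal J(v)=\int_{\mathcal X}v f\,\mathrm dx+\int_{\mathcal Y}v^c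 g\,\mathrm dy,$$ and let $\mathcal J'(v)$ denote its first variation, that is, the continuous function with $\frac{\mathrm d}{\mathrm d\varepsilon}\big|_{\varepsilon=0}\mathcal J(v+\varepsilon\varphi)=\int_{\mathcal X}\mathcal J'(v)\varphi\,\mathrm dx$ for all $\varphi\in C(\mathcal X)$. If $0<\tau<\tau_{max}$ and $(u^k)_{k\ge0}$ is a sequence in $V_\lambda$ with $$\Delta u^{k+1}=\Delta u^k+\tau\,\mathcal J'(u^k)\qquad(k\ge0),$$ then for every $k$ $$\mathcal J(u^k)-\mathcal J(u^{k+1})\ \ge\ \frac1{2\tau_{max}}\,\bigl\|\nabla u^k-\nabla u^{k+1}\bigr\|_{L^2}^2 ,$$ and $\mathcal J(u^{k+1})<\mathcal J(u^k)$ unless $u^k=u$; so $\mathcal J$ is strictly decreasing along the iterates as long as they have not reached the solution. -/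

import Mathlib

open MeasureTheory Set
open scoped NNReal

noncomputable section

namespace SobolevDescent

/-- Euclidean space `ℝⁿ`. -/
abbrev E (n : ℕ) : Type := EuclideanSpace ℝ (Fin n)

/-! ### The two manifolds: the round sphere and the flat torus -/

/-- The data of an `n`-dimensional closed Riemannian manifold that are needed below: its points,
its Riemannian volume, and around every point `x` a parametrization `coord x : ℝⁿ → Pt` with
`coord x 0 = x` which is a local diffeomorphism at `0` and osculates the exponential map
(in an orthonormal frame at `x`) to second order. Only the two values `sphere n` and `torus n`
below are ever used. Since the Christoffel symbols of `coord x` vanish at `0`, the first and second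
derivatives at `0` of `u ∘ coord x` are the gradient and the covariant Hessian of `u` at `x`,
written in an orthonormal frame of the tangent space at `x`. -/
structure Manifold (n : ℕ) where
  Pt : Type
  [top : TopologicalSpace Pt]
  [meas : MeasurableSpace Pt]
  coord : Pt → E n → Pt
  vol : Measure Pt

attribute [instance] Manifold.top Manifold.meas

/-- The flat torus `ℝⁿ / ℤⁿ`, with `coord x ξ = x + ξ mod ℤⁿ` and Lebesgue measure. -/
abbrev torus (n : ℕ) : Manifold n where
  Pt := UnitAddTorus (Fin n)
  coord x ξ := fun i => x i + ((ξ i : ℝ) : UnitAddCircle)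
  vol := volume

/-- The unit sphere of `ℝⁿ⁺¹`. -/
abbrev SpherePt (n : ℕ) : Type := Metric.sphere (0 : E (n + 1)) 1

instance factFinrank (n : ℕ) : Fact (Module.finrank ℝ (E (n + 1)) = n + 1) :=
  ⟨finrank_euclideanSpace_fin⟩

/-- An isometric identification of `ℝⁿ` with the tangent space `x^⊥` of the sphere at `x`. -/
def sphereFrame {n : ℕ} (x : SpherePt n) (ξ : E n) : E (n + 1) :=
  ((OrthonormalBasis.fromOrthogonalSpanSingleton (𝕜 := ℝ) n
    (ne_zero_of_mem_unit_sphere x)).repr.symm ξ : E (n + 1))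

theorem inner_sphereFrame {n : ℕ} (x : SpherePt n) (ξ : E n) :
    inner ℝ (x : E (n + 1)) (sphereFrame x ξ) = 0 :=
  Submodule.mem_orthogonal_singleton_iff_inner_right.1
    ((OrthonormalBasis.fromOrthogonalSpanSingleton (𝕜 := ℝ) n
      (ne_zero_of_mem_unit_sphere x)).repr.symm ξ).2

theorem add_sphereFrame_ne_zero {n : ℕ} (x : SpherePt n) (ξ : E n) :
    (x : E (n + 1)) + sphereFrame x ξ ≠ 0 := by
  intro h
  have h1 : inner ℝ (x : E (n + 1)) ((x : E (n + 1)) + sphereFrame x ξ) = 1 := by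
    rw [inner_add_right, inner_sphereFrame, real_inner_self_eq_norm_sq,
      norm_eq_of_mem_sphere]
    norm_num
  rw [h, inner_zero_right] at h1
  exact zero_ne_one h1

/-- The central projection `ξ ↦ (x + ξ) / |x + ξ|` of the tangent space at `x` to the sphere.
It maps lines through `0` to great circles through `x`, and differs from the exponential map
`ξ ↦ cos |ξ| x + sin |ξ| ξ / |ξ|` by `O(|ξ|³)`. -/
def sphereCoord {n : ℕ} (x : SpherePt n) (ξ : E n) : SpherePt n :=
  ⟨‖(x : E (n + 1)) + sphereFrame x ξ‖⁻¹ • ((x : E (n + 1)) + sphereFrame x ξ), by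
    have h := norm_ne_zero_iff.2 (add_sphereFrame_ne_zero x ξ)
    rw [mem_sphere_zero_iff_norm, norm_smul, norm_inv, norm_norm, inv_mul_cancel₀ h]⟩

/-- The round unit sphere `𝕊ⁿ ⊂ ℝⁿ⁺¹` with its surface measure. -/
abbrev sphere (n : ℕ) : Manifold n where
  Pt := SpherePt n
  coord := sphereCoord
  vol := (volume : Measure (E (n + 1))).toSphere

variable {n : ℕ}

/-! ### Differential calculus -/

/-- Standard basis vectors of `ℝⁿ`. -/
abbrev e (i : Fin n) : E n := EuclideanSpace.single i (1 : ℝ)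

/-- Determinant of the matrix of a bilinear form on `ℝⁿ`. -/
def formDet (B : E n →L[ℝ] E n →L[ℝ] ℝ) : ℝ :=
  (Matrix.of fun i j : Fin n => B (e i) (e j)).det

/-- `u ∈ Cᵏ(M)`. -/
def IsCk (M : Manifold n) (k : ℕ) (u : M.Pt → ℝ) : Prop :=
  ∀ x, ContDiffAt ℝ k (fun ξ => u (M.coord x ξ)) 0

/-- `u ∈ C^{k,α}(M)`: locally, `u` is `Cᵏ` and its `k`-th derivative is `α`-Hölder
(by compactness of `M` this is the global class). -/
def IsCkHolder (M : Manifold n) (k : ℕ) (α : ℝ≥0) (u : M.Pt → ℝ) : Prop :=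
  ∀ x, ∃ ρ > (0 : ℝ), ∃ C : ℝ≥0,
    ContDiffOn ℝ k (fun ξ => u (M.coord x ξ)) (Metric.ball 0 ρ) ∧
    HolderOnWith C α (iteratedFDeriv ℝ k (fun ξ => u (M.coord x ξ))) (Metric.ball 0 ρ)

/-- The gradient `∇u(x)`, in the orthonormal frame at `x`. -/
def grad (M : Manifold n) (u : M.Pt → ℝ) (x : M.Pt) : E n :=
  gradient (fun ξ => u (M.coord x ξ)) 0

/-- The covariant Hessian `D²u(x)`, in the orthonormal frame at `x`. -/
def hess (M : Manifold n) (u : M.Pt → ℝ) (x : M.Pt) : E n →L[ℝ] E n →L[ℝ] ℝ :=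
  fderiv ℝ (fderiv ℝ (fun ξ => u (M.coord x ξ))) 0

/-- The Laplace–Beltrami operator: the trace of the Hessian. -/
def lap (M : Manifold n) (u : M.Pt → ℝ) (x : M.Pt) : ℝ :=
  ∑ i, hess M u x (e i) (e i)

/-- The norm of `C²(M)`: `sup |u| + sup |∇u| + sup ‖D²u‖`. -/
def c2Norm (M : Manifold n) (u : M.Pt → ℝ) : ℝ :=
  (⨆ x, |u x|) + (⨆ x, ‖grad M u x‖) + ⨆ x, ‖hess M u x‖

/-! ### Cost functions

A cost function has values in `ℝ ∪ {+∞}`, coded as an `EReal`-valued function that avoids `⊥`. -/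

/-- `c(·, y)` is finite and differentiable at `x`. -/
def DiffAtX (M : Manifold n) (c : M.Pt → M.Pt → EReal) (x y : M.Pt) : Prop :=
  c x y ≠ ⊤ ∧ DifferentiableAt ℝ (fun ξ => (c (M.coord x ξ) y).toReal) 0

/-- `∇ₓ c(x, y)`. -/
def gradX (M : Manifold n) (c : M.Pt → M.Pt → EReal) (x y : M.Pt) : E n :=
  grad M (fun x' => (c x' y).toReal) x

/-- `D²ₓₓ c(x, y)`. -/
def hessXX (M : Manifold n) (c : M.Pt → M.Pt → EReal) (x y : M.Pt) :
    E n →L[ℝ] E n →L[ℝ] ℝ :=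
  hess M (fun x' => (c x' y).toReal) x

/-- `D²ₓᵧ c(x, y)`, the mixed second derivative: first slot for `x`, second slot for `y`. -/
def hessXY (M : Manifold n) (c : M.Pt → M.Pt → EReal) (x y : M.Pt) :
    E n →L[ℝ] E n →L[ℝ] ℝ :=
  fderiv ℝ (fun ξ => fderiv ℝ (fun η => (c (M.coord x ξ) (M.coord y η)).toReal) 0) 0

/-- The standing assumptions on the cost: `c : M × M → ℝ ∪ {+∞}` is continuous, locally
semi-concave where it is finite, twisted, and on a neighbourhood of the compact set `K ⊆ M × M`
it is finite and of class `C⁴`, with `det D²ₓᵧ c ≠ 0` on `K`. A finite cost that is smooth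
everywhere corresponds to `K = M × M`. -/
structure IsAdmissibleCost (M : Manifold n) (c : M.Pt → M.Pt → EReal)
    (K : Set (M.Pt × M.Pt)) : Prop where
  continuous : Continuous fun z : M.Pt × M.Pt => c z.1 z.2
  ne_bot : ∀ x y, c x y ≠ ⊥
  semiconcave : ∀ x y, c x y ≠ ⊤ → ∃ C : ℝ, ∃ ρ > (0 : ℝ),
    ConcaveOn ℝ (Metric.ball (0 : E n) ρ ×ˢ Metric.ball (0 : E n) ρ) fun z =>
      (c (M.coord x z.1) (M.coord y z.2)).toReal - C * (‖z.1‖ ^ 2 + ‖z.2‖ ^ 2)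
  twist : ∀ x y y', DiffAtX M c x y → DiffAtX M c x y' → gradX M c x y = gradX M c x y' → y = y'
  isCompact : IsCompact K
  ne_top : ∀ x y, (x, y) ∈ K → c x y ≠ ⊤
  contDiffAt : ∀ x y, (x, y) ∈ K →
    ContDiffAt ℝ 4 (fun z : E n × E n => (c (M.coord x z.1) (M.coord y z.2)).toReal) 0
  nondegenerate : ∀ x y, (x, y) ∈ K → formDet (hessXY M c x y) ≠ 0

/-- The `c`-transform `u^c(y) = sup_x (-c(x, y) - u(x))`. -/
def cTransform (M : Manifold n) (c : M.Pt → M.Pt → EReal) (u : M.Pt → ℝ) (y : M.Pt) : EReal :=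
  ⨆ x, (-c x y - (u x : EReal))

/-- `u` is `c`-convex: `u = u^{cc}`. -/
def IsCConvex (M : Manifold n) (c : M.Pt → M.Pt → EReal) (u : M.Pt → ℝ) : Prop :=
  ∀ x, (u x : EReal) = ⨆ y, (-c x y - cTransform M c u y)

/-- `𝒯(x, p) = (∇ₓ c)⁻¹(x, -p)`: the point `y` with `∇ₓ c(x, y) = -p`, which is unique for a
twisted cost (and an arbitrary point if there is none). -/
def cExp (M : Manifold n) (c : M.Pt → M.Pt → EReal) (x : M.Pt) (p : E n) : M.Pt :=
  @Classical.epsilon M.Pt ⟨x⟩ fun y => DiffAtX M c x y ∧ gradX M c x y = -p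

/-- The map `T_u(x) = 𝒯(x, ∇u(x))`. -/
def transportMap (M : Manifold n) (c : M.Pt → M.Pt → EReal) (u : M.Pt → ℝ) (x : M.Pt) : M.Pt :=
  cExp M c x (grad M u x)

/-- `ω = D²u(x) + A(x, ∇u(x))`, where `A(x, p) = D²ₓₓ c(x, 𝒯(x, p))`. -/
def omega (M : Manifold n) (c : M.Pt → M.Pt → EReal) (u : M.Pt → ℝ) (x : M.Pt) :
    E n →L[ℝ] E n →L[ℝ] ℝ :=
  hess M u x + hessXX M c x (transportMap M c u x)

/-- `T_u` is well defined with graph in `K`, and `a < D²u(x) + A(x, ∇u(x)) < b` for all `x`,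
in the sense of quadratic forms. For `a > 0` this makes `u` strictly `c`-convex with respect
to `a`. -/
def EigenvaluesBetween (M : Manifold n) (c : M.Pt → M.Pt → EReal) (K : Set (M.Pt × M.Pt))
    (a b : ℝ) (u : M.Pt → ℝ) : Prop :=
  ∀ x, (x, transportMap M c u x) ∈ K ∧
    gradX M c x (transportMap M c u x) = -grad M u x ∧
    ∀ ξ : E n, ξ ≠ 0 →
      a * ‖ξ‖ ^ 2 < omega M c u x ξ ξ ∧ omega M c u x ξ ξ < b * ‖ξ‖ ^ 2

/-- `g̃(x, p) = g(𝒯(x, p)) / |det D²ₓᵧ c(x, 𝒯(x, p))|`. -/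
def gTilde (M : Manifold n) (c : M.Pt → M.Pt → EReal) (g : M.Pt → ℝ) (x : M.Pt) (p : E n) : ℝ :=
  g (cExp M c x p) / |formDet (hessXY M c x (cExp M c x p))|

/-- The generalized Monge–Ampère equation
`f(x) - g̃(x, ∇u) det (D²u + A(x, ∇u)) = 0` on `M`. -/
def SolvesMongeAmpere (M : Manifold n) (c : M.Pt → M.Pt → EReal) (f g u : M.Pt → ℝ) : Prop :=
  ∀ x, f x - gTilde M c g x (grad M u x) * formDet (omega M c u x) = 0

/-- A density on `M`: a function of class `C^{1,1}` with a positive lower bound and mass one. -/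
structure IsDensity (M : Manifold n) (f : M.Pt → ℝ) : Prop where
  regular : IsCkHolder M 1 1 f
  lower_bound : ∃ m > (0 : ℝ), ∀ x, m ≤ f x
  mass : ∫ x, f x ∂M.vol = 1

/-! ### The dual functional and the descent scheme -/

/-- The dual functional `J(u) = ∫ u f + ∫ u^c g`. -/
def dualJ (M : Manifold n) (c : M.Pt → M.Pt → EReal) (f g u : M.Pt → ℝ) : ℝ :=
  (∫ x, u x * f x ∂M.vol) + ∫ y, (cTransform M c u y).toReal * g y ∂M.vol

/-- The continuous function `j` is the first variation `J'(u)` (the `L²` gradient of `J` at `u`):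
`d/dε J(u + ε v) = ∫ j v` at `ε = 0` for every `v ∈ C(M)`. -/
def IsFirstVariation (M : Manifold n) (J : (M.Pt → ℝ) → ℝ) (u j : M.Pt → ℝ) : Prop :=
  Continuous j ∧ ∀ v : M.Pt → ℝ, Continuous v →
    HasDerivAt (fun ε : ℝ => J (fun x => u x + ε * v x)) (∫ x, j x * v x ∂M.vol) 0

/-- The Sobolev descent scheme `Δu^{k+1} = Δu^k + τ J'(u^k)`. -/
def IsSobolevDescent (M : Manifold n) (J : (M.Pt → ℝ) → ℝ) (τ : ℝ) (w : ℕ → M.Pt → ℝ) : Prop :=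
  ∀ k, ∃ j, IsFirstVariation M J (w k) j ∧ ∀ x, lap M (w (k + 1)) x = lap M (w k) x + τ * j x

/-- The `C²` functions of zero mean at `C²` distance at most `r` from `u`. -/
def nbhd (M : Manifold n) (u : M.Pt → ℝ) (r : ℝ) : Set (M.Pt → ℝ) :=
  {v | IsCk M 2 v ∧ ∫ x, v x ∂M.vol = 0 ∧ c2Norm M (fun x => u x - v x) ≤ r}

end SobolevDescent

end

/-!
The functional `J(v) = ∫ v f + ∫ v^c g` is convex, and its second variation is controlled by the
Dirichlet energy. The scheme is gradient descent for the inner product `∫ ⟪∇φ, ∇ψ⟫`, so the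
classical estimate for descent with a step below the inverse of the Lipschitz constant applies.

*Subgradient.* Let `v` lie in the neighbourhood and suppose that `T_v` is bijective, with inverse
`X`. At a maximizer `x` of `-c(·, y) - v`, semi-concavity of the cost forces differentiability
of `c(·, y)`, and twistedness gives `T_v x = y`. Hence `X y` is the unique maximizer
(`toReal_cTransform_eq`), `J(v + h) ≥ J(v) + ∫ h f - ∫ h(X y) g(y) dy` (`dualJ_add_ge`), and the
linear term on the right is the first variation (`integral_firstVariation_mul`).

*Second variation.* Let `h = v' - v` for two iterates, and let `X_t` be the inverse transport map
of `v + t h`. Differentiating `∇ₓc(x, y) + ∇v(x) + t ∇h(x) = 0` in `t` for fixed `y` shows that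
`x = X_t(y)` moves with the velocity `p` given by `ω p = -∇h`, where `ω` is the Hessian
`D²ₓₓ c + D²v + t D²h`. As `1/λ < ω < λ`, the derivative `ω(p, p)` of `-h(X_t(y))` lies between `0`
and `λ |∇h(X_t(y))|²` (`exists_hasDerivWithinAt_comp_inverse`). The Jacobian of `T` is
`|det ω| / |det D²ₓᵧ c|`, which is bounded since `|det D²ₓᵧ c|` is bounded below on the compact
set `K`; hence `∫ ψ(X_t(y)) dy ≤ C ∫ ψ` for `ψ ≥ 0` (`exists_integral_comp_inverse_le`).
Altogether the first variations at `v` and `v'` in the direction `h` differ by at most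
`L ∫ |∇h|²`, with `L = λ (sup g) C` (`integral_comp_inverse_sub_le`).

*Descent.* By the scheme and Green's formula the first variation at `v` in the direction `h` is
`τ⁻¹ ∫ h Δh = -τ⁻¹ ∫ |∇h|²`. For `τ < 1 / (2 L)` it is at most `-2 L ∫ |∇h|²`, so the
first variation at `v'` is at most `-L ∫ |∇h|²`, and convexity gives
`J(v) - J(v') ≥ L ∫ |∇h|²`. This is the estimate with `τmax = 1 / (2 L)`. If `∇h = 0`, then the
first variation at `v` vanishes. It also vanishes at `u`, and the derivative `ω(p, p)` along the
segment from `u` to `v` is nonnegative; therefore it is zero, so `∇(v - u) = 0` and `v = u`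
(`exists_step_bound_of_hasRegularCharts`).

*Bijectivity.* `T_u` is a local homeomorphism of a compact connected space, hence onto. By the
Monge–Ampère equation it transports `f` to `g`, and as both have mass one it covers no point twice
(`bijective_transportMap_of_solvesMongeAmpere`). Along a segment of potentials the set of `(t, y)`
with exactly one preimage is open and closed, so bijectivity persists
(`bijective_transportMap_segment`).

What is needed about the manifold is collected in `HasRegularCharts`. For the torus it follows from
translation invariance. For the sphere, `coord x` is the central projection: volumes are compared
by means of cones over subsets of the sphere and of its affine tangent planes, and `∫ Δφ = 0`
since `2 Δ` is a sum of squares of infinitesimal rotations.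
-/


open Filter Topology unitInterval

set_option maxSynthPendingDepth 3
set_option linter.unusedSectionVars false

noncomputable section

namespace SobolevDescent

section

variable {n : ℕ}

/-! ### Regular charts -/

/-- The facts about the charts, the volume and the Laplacian of a manifold that the descent
estimate uses. The transition maps between charts are local diffeomorphisms of class `C⁴`. The two
volume inequalities say that charts do not increase volume and that their Jacobian tends to `1` at
the origin, uniformly in the base point. The frame at `x` need not depend continuously on `x`, so
only norms of gradients and Hessians are required to behave well. The last field is the divergence
theorem for `∇φ`. -/
structure HasRegularCharts (M : Manifold n) : Prop where
  coord_zero : ∀ x, M.coord x 0 = x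
  continuous_coord : ∀ x, Continuous (M.coord x)
  nhds_le_map : ∀ x, 𝓝 x ≤ map (M.coord x) (𝓝 0)
  transition : ∀ x ξ, ∃ Φ : E n → E n, ContDiffAt ℝ 4 Φ 0 ∧ Φ 0 = ξ ∧
    Function.Injective (fderiv ℝ Φ 0) ∧
    ∀ᶠ ζ in 𝓝 0, M.coord (M.coord x ξ) ζ = M.coord x (Φ ζ)
  vol_image_le : ∀ x (S : Set (E n)), M.vol (M.coord x '' S) ≤ volume S
  vol_preimage_le : ∀ ε > (0 : ℝ), ∃ δ > (0 : ℝ), ∀ x, ∀ B : Set M.Pt, MeasurableSet B →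
    volume (M.coord x ⁻¹' B ∩ Metric.ball 0 δ) ≤ ENNReal.ofReal (1 + ε) * M.vol B
  continuous_norm_grad : ∀ φ, IsCk M 2 φ → Continuous fun x => ‖grad M φ x‖
  norm_hess_le : ∀ φ, IsCk M 2 φ → ∃ C : ℝ, ∀ x, ‖hess M φ x‖ ≤ C
  integral_lap : ∀ φ, IsCk M 2 φ → ∫ x, lap M φ x ∂M.vol = 0

/-! ### Linear algebra -/

/-- A nondegenerate bilinear form identifies `ℝⁿ` with its dual. -/
theorem isInvertible_of_injective_toDual (L : E n →L[ℝ] E n →L[ℝ] ℝ)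
    (h : ∀ ξ, L ξ = 0 → ξ = 0) : L.IsInvertible := by
  have hfr : Module.finrank ℝ (E n) = Module.finrank ℝ (E n →L[ℝ] ℝ) :=
    (InnerProductSpace.toDual ℝ (E n)).toLinearEquiv.finrank_eq
  have hinj : Function.Injective (L : E n →ₗ[ℝ] E n →L[ℝ] ℝ) :=
    (injective_iff_map_eq_zero _).2 h
  exact ⟨(LinearEquiv.ofInjectiveOfFinrankEq _ hinj hfr).toContinuousLinearEquiv, by ext; rfl⟩

theorem sum_smul_e (b : E n) : ∑ j, b j • e j = b := by
  have := (EuclideanSpace.basisFun (Fin n) ℝ).sum_repr b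
  simpa using this

theorem eq_zero_of_formDet_ne_zero {B : E n →L[ℝ] E n →L[ℝ] ℝ} (hB : formDet B ≠ 0) (b : E n)
    (h : ∀ a, B a b = 0) : b = 0 := by
  have : (fun i => b i) = 0 := by
    refine Matrix.eq_zero_of_mulVec_eq_zero hB (funext fun i => ?_)
    have h1 := h (e i)
    rw [← sum_smul_e b, map_sum] at h1
    simpa [Matrix.mulVec, dotProduct, mul_comm] using h1
  ext i
  exact congrFun this i

/-! ### Critical pairs -/

/-- First-order optimality of `x` in `sup_x (-c(x, y) - v(x))`. -/
def IsCriticalPair (M : Manifold n) (c : M.Pt → M.Pt → EReal) (v : M.Pt → ℝ) (x y : M.Pt) : Prop :=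
  DiffAtX M c x y ∧ gradX M c x y = -grad M v x

/-- The cost in the charts around `x` and `y`. -/
def costRep (M : Manifold n) (c : M.Pt → M.Pt → EReal) (x y : M.Pt) (z : E n × E n) : ℝ :=
  (c (M.coord x z.1) (M.coord y z.2)).toReal

theorem gradient_eq_neg_iff {f g : E n → ℝ} {x : E n} :
    gradient f x = -gradient g x ↔ fderiv ℝ f x + fderiv ℝ g x = 0 := by
  unfold gradient
  rw [← map_neg, (InnerProductSpace.toDual ℝ (E n)).symm.injective.eq_iff, eq_neg_iff_add_eq_zero]

variable {M : Manifold n} {c : M.Pt → M.Pt → EReal}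

theorem IsCk.add {k : ℕ} {u v : M.Pt → ℝ} (hu : IsCk M k u) (hv : IsCk M k v) :
    IsCk M k fun x => u x + v x := fun x => (hu x).add (hv x)

theorem IsCk.sub {k : ℕ} {u v : M.Pt → ℝ} (hu : IsCk M k u) (hv : IsCk M k v) :
    IsCk M k fun x => u x - v x := fun x => (hu x).sub (hv x)

theorem IsCk.const_mul {k : ℕ} {u : M.Pt → ℝ} (hu : IsCk M k u) (t : ℝ) :
    IsCk M k fun x => t * u x := fun x => contDiffAt_const.mul (hu x)

theorem IsCk.mul {k : ℕ} {u v : M.Pt → ℝ} (hu : IsCk M k u) (hv : IsCk M k v) :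
    IsCk M k fun x => u x * v x := fun x => (hu x).mul (hv x)

theorem IsCk.eventually {v : M.Pt → ℝ} (hv : IsCk M 2 v) (x : M.Pt) :
    ∀ᶠ ξ in 𝓝 (0 : E n), ContDiffAt ℝ 2 (fun ξ => v (M.coord x ξ)) ξ :=
  (hv x).eventually (by simp)

/-- Criticality of a pair near `(x, y)`, which refers to the charts centred at that pair, can be read
off in the fixed charts at `x` and `y`, uniformly in `t`. -/
theorem eventually_isCriticalPair_iff (hM : HasRegularCharts M)
    (hcont : Continuous fun z : M.Pt × M.Pt => c z.1 z.2) {x y : M.Pt} (hne : c x y ≠ ⊤)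
    (hF : ContDiffAt ℝ 4 (costRep M c x y) 0) {v : M.Pt → ℝ} {h : M.Pt → ℝ} (hv : IsCk M 2 v)
    (hh : IsCk M 2 h) :
    ∀ᶠ z in 𝓝 (0 : E n × E n), ∀ t : ℝ,
      IsCriticalPair M c (fun x => v x + t * h x) (M.coord x z.1) (M.coord y z.2) ↔
        (fderiv ℝ (costRep M c x y) z).comp (ContinuousLinearMap.inl ℝ (E n) (E n)) +
          fderiv ℝ (fun ξ => v (M.coord x ξ)) z.1 +
          t • fderiv ℝ (fun ξ => h (M.coord x ξ)) z.1 = 0 := by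
  have hfin : ∀ᶠ z in 𝓝 (0 : E n × E n), c (M.coord x z.1) (M.coord y z.2) ≠ ⊤ := by
    have hc' : Continuous fun z : E n × E n => c (M.coord x z.1) (M.coord y z.2) :=
      hcont.comp (((hM.continuous_coord x).comp continuous_fst).prodMk
        ((hM.continuous_coord y).comp continuous_snd))
    refine hc'.continuousAt.eventually_ne ?_
    simpa [hM.coord_zero] using hne
  have hfst : Tendsto (Prod.fst : E n × E n → E n) (𝓝 0) (𝓝 0) := continuous_fst.tendsto _
  filter_upwards [hfin, hF.eventually (by simp), hfst.eventually (hv.eventually x),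
    hfst.eventually (hh.eventually x)]
  rintro ⟨ξ, η⟩ hfin hF hv hh t
  dsimp only at hfin hv hh
  obtain ⟨Φ, hΦ, rfl, hinj, hcoord⟩ := hM.transition x ξ
  have hΦ' : HasFDerivAt Φ (fderiv ℝ Φ 0) 0 := (hΦ.differentiableAt (by norm_num)).hasFDerivAt
  have hsurj : Function.Surjective (fderiv ℝ Φ 0) :=
    (LinearMap.injective_iff_surjective (f := (fderiv ℝ Φ 0 : E n →ₗ[ℝ] E n))).1 hinj
  have d1 : HasFDerivAt (fun ζ => (c (M.coord (M.coord x (Φ 0)) ζ) (M.coord y η)).toReal)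
      (((fderiv ℝ (costRep M c x y) (Φ 0, η)).comp (ContinuousLinearMap.inl ℝ (E n) (E n))).comp
        (fderiv ℝ Φ 0)) 0 := by
    have h1 : HasFDerivAt (fun ξ => costRep M c x y (ξ, η))
        ((fderiv ℝ (costRep M c x y) (Φ 0, η)).comp (ContinuousLinearMap.inl ℝ (E n) (E n)))
        (Φ 0) :=
      HasFDerivAt.comp (g := costRep M c x y) (f := fun ξ => (ξ, η)) (Φ 0)
        (hF.differentiableAt (by norm_num)).hasFDerivAt (hasFDerivAt_prodMk_left _ _)
    refine (h1.comp 0 hΦ').congr_of_eventuallyEq ?_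
    filter_upwards [hcoord] with ζ hζ
    simp [costRep, hζ]
  have key : ∀ w : M.Pt → ℝ, ContDiffAt ℝ 2 (fun ξ => w (M.coord x ξ)) (Φ 0) →
      HasFDerivAt (fun ζ => w (M.coord (M.coord x (Φ 0)) ζ))
        ((fderiv ℝ (fun ξ => w (M.coord x ξ)) (Φ 0)).comp (fderiv ℝ Φ 0)) 0 := by
    intro w hw
    have h1 := (hw.differentiableAt (by norm_num)).hasFDerivAt
    refine (h1.comp 0 hΦ').congr_of_eventuallyEq ?_
    filter_upwards [hcoord] with ζ hζ
    simp [hζ]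
  have d2 := (key v hv).add ((key h hh).const_mul t)
  have d3 : DiffAtX M c (M.coord x (Φ 0)) (M.coord y η) := ⟨hfin, d1.differentiableAt⟩
  rw [IsCriticalPair, and_iff_right d3]
  unfold gradX grad
  rw [gradient_eq_neg_iff, d1.fderiv]
  erw [d2.fderiv]
  constructor
  · intro h0
    ext a
    obtain ⟨b, rfl⟩ := hsurj a
    have := DFunLike.congr_fun h0 b
    simpa [add_assoc] using this
  · intro h0
    ext b
    have := DFunLike.congr_fun h0 (fderiv ℝ Φ 0 b)
    simpa [add_assoc] using this

end

section

variable {n : ℕ}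
variable {M : Manifold n} {c : M.Pt → M.Pt → EReal}

/-! ### Second derivatives and the implicit function theorem -/

theorem fderiv_fderiv_inl {F : E n × E n → ℝ} (hF : ContDiffAt ℝ 4 F 0) (ξ a : E n) :
    fderiv ℝ (fderiv ℝ (fun ξ => F (ξ, 0))) 0 ξ a =
      fderiv ℝ (fderiv ℝ F) 0 (ξ, 0) (a, 0) := by
  have hinl : Continuous fun ξ : E n => ((ξ, 0) : E n × E n) := by fun_prop
  have h0 : ((0 : E n), (0 : E n)) = 0 := rfl
  have h1 : fderiv ℝ (fun ξ => F (ξ, 0)) =ᶠ[𝓝 0] fun ξ =>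
      (fderiv ℝ F (ξ, 0)).comp (ContinuousLinearMap.inl ℝ (E n) (E n)) := by
    have := (hinl.tendsto 0).eventually (hF.eventually (by simp))
    filter_upwards [this] with ξ hξ
    exact (HasFDerivAt.comp (g := F) (f := fun ξ => (ξ, (0 : E n))) ξ
      (hξ.differentiableAt (by norm_num)).hasFDerivAt (hasFDerivAt_prodMk_left _ _)).fderiv
  have h2 : HasFDerivAt (fderiv ℝ F) (fderiv ℝ (fderiv ℝ F) 0) ((0 : E n), (0 : E n)) :=
    ((hF.fderiv_right (m := 1) (by norm_num)).differentiableAt (by norm_num)).hasFDerivAt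
  have h3 : HasFDerivAt (fun ξ : E n => fderiv ℝ F (ξ, 0)) _ 0 :=
    HasFDerivAt.comp (g := fderiv ℝ F) (f := fun ξ => (ξ, (0 : E n))) 0 h2
      (hasFDerivAt_prodMk_left _ _)
  have h4 := h3.clm_comp (hasFDerivAt_const (ContinuousLinearMap.inl ℝ (E n) (E n)) (0 : E n))
  rw [h1.fderiv_eq, h4.fderiv]
  simp

theorem fderiv_fderiv_inr {F : E n × E n → ℝ} (hF : ContDiffAt ℝ 4 F 0) (a b : E n) :
    fderiv ℝ (fun ξ => fderiv ℝ (fun η => F (ξ, η)) 0) 0 a b =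
      fderiv ℝ (fderiv ℝ F) 0 (a, 0) (0, b) := by
  have hinl : Continuous fun ξ : E n => ((ξ, 0) : E n × E n) := by fun_prop
  have h1 : (fun ξ => fderiv ℝ (fun η => F (ξ, η)) 0) =ᶠ[𝓝 0] fun ξ =>
      (fderiv ℝ F (ξ, 0)).comp (ContinuousLinearMap.inr ℝ (E n) (E n)) := by
    have := (hinl.tendsto 0).eventually (hF.eventually (by simp))
    filter_upwards [this] with ξ hξ
    exact (HasFDerivAt.comp (g := F) (f := fun η => (ξ, η)) (0 : E n)
      (hξ.differentiableAt (by norm_num)).hasFDerivAt (hasFDerivAt_prodMk_right _ _)).fderiv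
  have h2 : HasFDerivAt (fderiv ℝ F) (fderiv ℝ (fderiv ℝ F) 0) ((0 : E n), (0 : E n)) :=
    ((hF.fderiv_right (m := 1) (by norm_num)).differentiableAt (by norm_num)).hasFDerivAt
  have h3 : HasFDerivAt (fun ξ : E n => fderiv ℝ F (ξ, 0)) _ 0 :=
    HasFDerivAt.comp (g := fderiv ℝ F) (f := fun ξ => (ξ, (0 : E n))) 0 h2
      (hasFDerivAt_prodMk_left _ _)
  have h4 := h3.clm_comp (hasFDerivAt_const (ContinuousLinearMap.inr ℝ (E n) (E n)) (0 : E n))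
  rw [h1.fderiv_eq, h4.fderiv]
  simp

theorem hessXX_apply (hM : HasRegularCharts M) {x y : M.Pt}
    (hF : ContDiffAt ℝ 4 (costRep M c x y) 0) (ξ a : E n) :
    hessXX M c x y ξ a = fderiv ℝ (fderiv ℝ (costRep M c x y)) 0 (ξ, 0) (a, 0) := by
  rw [← fderiv_fderiv_inl hF]
  simp only [hessXX, hess, costRep, hM.coord_zero]

theorem hessXY_apply {x y : M.Pt}
    (hF : ContDiffAt ℝ 4 (costRep M c x y) 0) (a b : E n) :
    hessXY M c x y a b = fderiv ℝ (fderiv ℝ (costRep M c x y)) 0 (a, 0) (0, b) := by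
  rw [← fderiv_fderiv_inr hF]
  rfl

theorem hess_add_mul {v h : M.Pt → ℝ} (hv : IsCk M 2 v) (hh : IsCk M 2 h) (t : ℝ) (x : M.Pt) :
    hess M (fun x => v x + t * h x) x = hess M v x + t • hess M h x := by
  have h1 : fderiv ℝ (fun ξ => v (M.coord x ξ) + t * h (M.coord x ξ)) =ᶠ[𝓝 0]
      fun ξ => fderiv ℝ (fun ξ => v (M.coord x ξ)) ξ +
        t • fderiv ℝ (fun ξ => h (M.coord x ξ)) ξ := by
    filter_upwards [hv.eventually x, hh.eventually x] with ξ h1 h2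
    exact ((h1.differentiableAt (by norm_num)).hasFDerivAt.add
      ((h2.differentiableAt (by norm_num)).hasFDerivAt.const_mul t)).fderiv
  have d : ∀ w : M.Pt → ℝ, IsCk M 2 w →
      HasFDerivAt (fderiv ℝ (fun ξ => w (M.coord x ξ))) (hess M w x) 0 := fun w hw =>
    (((hw x).fderiv_right (m := 1) (by norm_num)).differentiableAt (by norm_num)).hasFDerivAt
  unfold hess
  rw [h1.fderiv_eq]
  exact ((d v hv).add ((d h hh).const_smul t)).fderiv

theorem grad_add_mul {v h : M.Pt → ℝ} (hv : IsCk M 2 v) (hh : IsCk M 2 h) (t : ℝ) (x : M.Pt) :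
    grad M (fun x => v x + t * h x) x = grad M v x + t • grad M h x := by
  have d1 := (((hv x).differentiableAt (by norm_num)).hasFDerivAt.add
      (((hh x).differentiableAt (by norm_num)).hasFDerivAt.const_mul t)).fderiv
  unfold grad gradient
  rw [← map_smul, ← map_add]
  congr 1

/-- Near a critical pair the equation `∇ₓc(x, y) + ∇v(x) + t ∇h(x) = 0` can be solved for `x`, because
`D²ₓₓ c + D²v + t D²h` is positive, and for `y`, because `D²ₓᵧ c` is nondegenerate. In the charts the
solutions are `Ξ(t, η)` and `Θ(t, ξ)`; the last two conclusions are the differentiated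
equations. -/
theorem exists_local_solution (hM : HasRegularCharts M)
    (hcont : Continuous fun z : M.Pt × M.Pt => c z.1 z.2) {x y : M.Pt} (hne : c x y ≠ ⊤)
    (hF : ContDiffAt ℝ 4 (costRep M c x y) 0) (hdet : formDet (hessXY M c x y) ≠ 0)
    {v : M.Pt → ℝ} {h : M.Pt → ℝ} (hv : IsCk M 2 v) (hh : IsCk M 2 h) (t₀ : ℝ)
    (hcrit : IsCriticalPair M c (fun x => v x + t₀ * h x) x y)
    (hpos : ∀ ξ : E n, ξ ≠ 0 →
      0 < (hess M (fun x => v x + t₀ * h x) x + hessXX M c x y) ξ ξ) :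
    ∃ (Ξ Θ : ℝ × E n → E n) (Ξ' Θ' : ℝ × E n →L[ℝ] E n),
      HasStrictFDerivAt Ξ Ξ' (t₀, 0) ∧ HasStrictFDerivAt Θ Θ' (t₀, 0) ∧
      Ξ (t₀, 0) = 0 ∧ Θ (t₀, 0) = 0 ∧
      (∀ᶠ p in 𝓝 ((t₀, 0, 0) : ℝ × E n × E n),
        (IsCriticalPair M c (fun x => v x + p.1 * h x) (M.coord x p.2.1) (M.coord y p.2.2) ↔
          Ξ (p.1, p.2.2) = p.2.1) ∧
        (IsCriticalPair M c (fun x => v x + p.1 * h x) (M.coord x p.2.1) (M.coord y p.2.2) ↔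
          Θ (p.1, p.2.1) = p.2.2)) ∧
      (∀ a, (hess M (fun x => v x + t₀ * h x) x + hessXX M c x y) (Ξ' (1, 0)) a =
        -fderiv ℝ (fun ξ => h (M.coord x ξ)) 0 a) ∧
      (∀ ξ a, (hess M (fun x => v x + t₀ * h x) x + hessXX M c x y) ξ a +
        hessXY M c x y a (Θ' (0, ξ)) = 0) := by
  set F := costRep M c x y with hFdef
  set A := hess M (fun x => v x + t₀ * h x) x + hessXX M c x y with hA
  set V := fun ξ => v (M.coord x ξ)
  set Hc := fun ξ => h (M.coord x ξ)
  -- `G (t, ξ, η) = 0` is the equation for critical pairs in the charts.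
  let G : ℝ × E n × E n → (E n →L[ℝ] ℝ) := fun p =>
    (fderiv ℝ F p.2).comp (ContinuousLinearMap.inl ℝ (E n) (E n)) + fderiv ℝ V p.2.1 +
      p.1 • fderiv ℝ Hc p.2.1
  have s1 : HasStrictFDerivAt (fderiv ℝ F) (fderiv ℝ (fderiv ℝ F) 0) ((t₀, 0, 0) : ℝ × E n × E n).2 :=
    (hF.fderiv_right (m := 1) (by norm_num)).hasStrictFDerivAt (by norm_num)
  have s2 : HasStrictFDerivAt (fderiv ℝ V) (hess M v x) ((t₀, 0, 0) : ℝ × E n × E n).2.1 :=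
    ((hv x).fderiv_right (m := 1) (by norm_num)).hasStrictFDerivAt (by norm_num)
  have s3 : HasStrictFDerivAt (fderiv ℝ Hc) (hess M h x) ((t₀, 0, 0) : ℝ × E n × E n).2.1 :=
    ((hh x).fderiv_right (m := 1) (by norm_num)).hasStrictFDerivAt (by norm_num)
  have p1 : HasStrictFDerivAt (𝕜 := ℝ) (fun p : ℝ × E n × E n => p.1) _ (t₀, 0, 0) := hasStrictFDerivAt_fst
  have p2 : HasStrictFDerivAt (𝕜 := ℝ) (fun p : ℝ × E n × E n => p.2) _ (t₀, 0, 0) := hasStrictFDerivAt_snd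
  have p21 : HasStrictFDerivAt (𝕜 := ℝ) (fun p : ℝ × E n × E n => p.2.1) _ (t₀, 0, 0) := p2.fst
  obtain ⟨G', hG', hG'val⟩ : ∃ G' : ℝ × E n × E n →L[ℝ] (E n →L[ℝ] ℝ),
      HasStrictFDerivAt G G' (t₀, 0, 0) ∧ ∀ s ξ η a, G' (s, ξ, η) a =
        A ξ a + hessXY M c x y a η + s * fderiv ℝ Hc 0 a := by
    refine ⟨_, (((HasStrictFDerivAt.comp (g := fderiv ℝ F) _ s1 p2).clm_comp
      (hasStrictFDerivAt_const (ContinuousLinearMap.inl ℝ (E n) (E n)) _)).add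
      (HasStrictFDerivAt.comp (g := fderiv ℝ V) _ s2 p21)).add
      (p1.smul (HasStrictFDerivAt.comp (g := fderiv ℝ Hc) _ s3 p21)), ?_⟩
    intro s ξ η a
    have hsymm : fderiv ℝ (fderiv ℝ F) 0 (0, η) (a, 0) = fderiv ℝ (fderiv ℝ F) 0 (a, 0) (0, η) :=
      (hF.isSymmSndFDerivAt (by simp; norm_num)).eq _ _
    have hsplit : fderiv ℝ (fderiv ℝ F) 0 (ξ, η) (a, 0) =
        fderiv ℝ (fderiv ℝ F) 0 (ξ, 0) (a, 0) + fderiv ℝ (fderiv ℝ F) 0 (0, η) (a, 0) := by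
      rw [← _root_.add_apply, ← map_add, Prod.mk_add_mk, add_zero, zero_add]
    rw [hA, hess_add_mul hv hh, hessXY_apply hF]
    simp only [_root_.add_apply, hessXX_apply hM hF]
    rw [← hFdef, ← hsymm]
    simp
    rw [hsplit]
    ring
  have hG0 : G (t₀, 0, 0) = 0 := by
    have h1 := (eventually_isCriticalPair_iff hM hcont hne hF hv hh).self_of_nhds t₀
    simp only [Prod.fst_zero, Prod.snd_zero, hM.coord_zero] at h1
    exact h1.1 hcrit
  have hev : ∀ᶠ p in 𝓝 ((t₀, 0, 0) : ℝ × E n × E n),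
      (IsCriticalPair M c (fun x => v x + p.1 * h x) (M.coord x p.2.1) (M.coord y p.2.2) ↔
        G p = 0) := by
    have h1 : Tendsto (fun p : ℝ × E n × E n => p.2) (𝓝 (t₀, 0, 0)) (𝓝 0) :=
      (continuous_snd.tendsto _)
    filter_upwards [h1.eventually (eventually_isCriticalPair_iff hM hcont hne hF hv hh)] with p hp
    exact hp p.1
  -- Reorderings of the variables that put the unknown last: `ξ` for `πξ` and `η` for `πη`.
  let πξ : (ℝ × E n) × E n →L[ℝ] ℝ × E n × E n :=
    (ContinuousLinearMap.fst ℝ ℝ (E n) ∘L ContinuousLinearMap.fst ℝ (ℝ × E n) (E n)).prod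
      ((ContinuousLinearMap.snd ℝ (ℝ × E n) (E n)).prod
        (ContinuousLinearMap.snd ℝ ℝ (E n) ∘L ContinuousLinearMap.fst ℝ (ℝ × E n) (E n)))
  let πη : (ℝ × E n) × E n →L[ℝ] ℝ × E n × E n :=
    (ContinuousLinearMap.fst ℝ ℝ (E n) ∘L ContinuousLinearMap.fst ℝ (ℝ × E n) (E n)).prod
      ((ContinuousLinearMap.snd ℝ ℝ (E n) ∘L ContinuousLinearMap.fst ℝ (ℝ × E n) (E n)).prod
        (ContinuousLinearMap.snd ℝ (ℝ × E n) (E n)))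
  have dπξ : HasStrictFDerivAt (fun p => G (πξ p)) (G' ∘L πξ) (((t₀, 0), 0) : (ℝ × E n) × E n) :=
    HasStrictFDerivAt.comp (g := G) (f := πξ) _ hG' πξ.hasStrictFDerivAt
  have dπη : HasStrictFDerivAt (fun p => G (πη p)) (G' ∘L πη) (((t₀, 0), 0) : (ℝ × E n) × E n) :=
    HasStrictFDerivAt.comp (g := G) (f := πη) _ hG' πη.hasStrictFDerivAt
  have iπξ : ((G' ∘L πξ) ∘L .inr ℝ (ℝ × E n) (E n)).IsInvertible := by
    refine isInvertible_of_injective_toDual _ fun ξ hξ => ?_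
    by_contra hne
    have h1 : G' (0, ξ, 0) ξ = 0 := DFunLike.congr_fun hξ ξ
    rw [hG'val] at h1
    simp at h1
    exact (hpos ξ hne).ne' (by simpa using h1)
  have iπη : ((G' ∘L πη) ∘L .inr ℝ (ℝ × E n) (E n)).IsInvertible := by
    refine isInvertible_of_injective_toDual _ fun η hη => ?_
    refine eq_zero_of_formDet_ne_zero hdet η fun a => ?_
    have h1 : G' (0, 0, η) a = 0 := DFunLike.congr_fun hη a
    rw [hG'val] at h1
    simpa using h1
  have hΞ := dπξ.hasStrictFDerivAt_implicitFunctionOfProdDomain iπξ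
  have hΘ := dπη.hasStrictFDerivAt_implicitFunctionOfProdDomain iπη
  have eΞ := dπξ.eventually_apply_eq_iff_implicitFunctionOfProdDomain iπξ
  have eΘ := dπη.eventually_apply_eq_iff_implicitFunctionOfProdDomain iπη
  have zΞ := eΞ.self_of_nhds.1 rfl
  have zΘ := eΘ.self_of_nhds.1 rfl
  set Ξ := dπξ.implicitFunctionOfProdDomain iπξ
  set Θ := dπη.implicitFunctionOfProdDomain iπη
  set Ξ' := -((G' ∘L πξ) ∘L .inr ℝ (ℝ × E n) (E n)).inverse ∘L ((G' ∘L πξ) ∘L .inl ℝ (ℝ × E n) (E n))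
  set Θ' := -((G' ∘L πη) ∘L .inr ℝ (ℝ × E n) (E n)).inverse ∘L ((G' ∘L πη) ∘L .inl ℝ (ℝ × E n) (E n))
  have vΞ : ∀ p, G' (p.1, Ξ' p, p.2) = 0 := by
    intro p
    have h1 : ((G' ∘L πξ) ∘L .inr ℝ (ℝ × E n) (E n)) (Ξ' p) =
        -((G' ∘L πξ) ∘L .inl ℝ (ℝ × E n) (E n)) p := by
      simp only [Ξ', ContinuousLinearMap.comp_apply, _root_.neg_apply, map_neg]
      rw [neg_inj]
      exact iπξ.self_apply_inverse _
    have h2 : G' (0, Ξ' p, 0) = -G' (p.1, 0, p.2) := h1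
    have h3 : ((p.1, Ξ' p, p.2) : ℝ × E n × E n) = (0, Ξ' p, 0) + (p.1, 0, p.2) := by simp
    rw [h3, map_add, h2, neg_add_cancel]
  have vΘ : ∀ p, G' (p.1, p.2, Θ' p) = 0 := by
    intro p
    have h1 : ((G' ∘L πη) ∘L .inr ℝ (ℝ × E n) (E n)) (Θ' p) =
        -((G' ∘L πη) ∘L .inl ℝ (ℝ × E n) (E n)) p := by
      simp only [Θ', ContinuousLinearMap.comp_apply, _root_.neg_apply, map_neg]
      rw [neg_inj]
      exact iπη.self_apply_inverse _
    have h2 : G' (0, 0, Θ' p) = -G' (p.1, p.2, 0) := h1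
    have h3 : ((p.1, p.2, Θ' p) : ℝ × E n × E n) = (0, 0, Θ' p) + (p.1, p.2, 0) := by simp
    rw [h3, map_add, h2, neg_add_cancel]
  refine ⟨Ξ, Θ, Ξ', Θ', hΞ, hΘ, zΞ, zΘ, ?_, ?_, ?_⟩
  · have c1 : Tendsto (fun p : ℝ × E n × E n => ((p.1, p.2.2), p.2.1)) (𝓝 (t₀, 0, 0))
        (𝓝 ((t₀, 0), 0)) :=
      Continuous.tendsto' (by fun_prop) _ _ rfl
    have c2 : Tendsto (fun p : ℝ × E n × E n => ((p.1, p.2.1), p.2.2)) (𝓝 (t₀, 0, 0))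
        (𝓝 ((t₀, 0), 0)) :=
      Continuous.tendsto' (by fun_prop) _ _ rfl
    filter_upwards [hev, c1.eventually eΞ, c2.eventually eΘ] with p h1 h2 h3
    rw [h1]
    constructor
    · rw [← h2, ← hG0]; rfl
    · rw [← h3, ← hG0]; rfl
  · intro a
    have := DFunLike.congr_fun (vΞ (1, 0)) a
    rw [hG'val] at this
    simp at this ⊢
    linarith
  · intro ξ a
    have := DFunLike.congr_fun (vΘ (0, ξ)) a
    rw [hG'val] at this
    simpa using this

end

section

variable {n : ℕ}
variable {M : Manifold n} {c : M.Pt → M.Pt → EReal} {K : Set (M.Pt × M.Pt)}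

/-! ### A covering argument -/

/-- For a continuous family of locally invertible maps of a compact space, the parameters and values
with exactly one preimage form an open and closed set. -/
theorem existsUnique_of_local {P X Y : Type*} [TopologicalSpace P] [TopologicalSpace X]
    [TopologicalSpace Y] [CompactSpace P] [PreconnectedSpace P] [T2Space P] [CompactSpace X]
    [T2Space X] [PreconnectedSpace Y] [T2Space Y] {T : P → X → Y}
    (hT : Continuous fun q : P × X => T q.1 q.2)
    (hex : ∀ t x, ∀ N ∈ 𝓝 x, ∀ᶠ q in 𝓝 (t, T t x), ∃ x' ∈ N, T q.1 x' = q.2)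
    (huniq : ∀ t x, ∃ U ∈ 𝓝 x, ∀ᶠ q in 𝓝 (t, T t x), ∀ x₁ ∈ U, ∀ x₂ ∈ U,
      T q.1 x₁ = q.2 → T q.1 x₂ = q.2 → x₁ = x₂)
    {t₀ : P} {y₀ : Y} (h₀ : ∃! x, T t₀ x = y₀) (t : P) (y : Y) : ∃! x, T t x = y := by
  let S : Set (P × Y) := {q | ∃! x, T q.1 x = q.2}
  -- the image of a closed set of points under `(t, x) ↦ (t, T t x)` is closed
  have himg : ∀ C : Set X, IsClosed C → IsClosed {q : P × Y | ∃ x ∈ C, T q.1 x = q.2} := by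
    intro C hC
    have h1 : IsCompact ((fun q : P × X => (q.1, T q.1 q.2)) '' (univ ×ˢ C)) :=
      (isCompact_univ.prod hC.isCompact).image (continuous_fst.prodMk hT)
    convert h1.isClosed using 1
    ext ⟨t, y⟩
    simp only [mem_ofPred_eq, mem_image, mem_prod, mem_univ, true_and, Prod.exists, Prod.mk.injEq]
    constructor
    · rintro ⟨x, hx, rfl⟩
      exact ⟨t, x, hx, rfl, rfl⟩
    · rintro ⟨t', x, hx, rfl, rfl⟩
      exact ⟨x, hx, rfl⟩
  have hopen : IsOpen S := by
    rw [isOpen_iff_mem_nhds]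
    rintro ⟨t, y⟩ ⟨x, hx, hx'⟩
    dsimp only at hx hx'
    subst hx
    obtain ⟨U, hU, hU'⟩ := huniq t x
    have hfar : ∀ᶠ q in 𝓝 (t, T t x), q ∉ {q : P × Y | ∃ x' ∈ (interior U)ᶜ, T q.1 x' = q.2} := by
      refine (himg _ isOpen_interior.isClosed_compl).isOpen_compl.mem_nhds ?_
      rintro ⟨x', hx'U, hx'T⟩
      exact hx'U (hx' x' hx'T ▸ mem_interior_iff_mem_nhds.2 hU)
    filter_upwards [hfar, hU', hex t x U hU] with q h1 h2 ⟨x₁, hx₁, hT₁⟩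
    refine ⟨x₁, hT₁, fun x₂ hT₂ => h2 x₂ ?_ x₁ hx₁ hT₂ hT₁⟩
    by_contra hx₂
    exact h1 ⟨x₂, fun h => hx₂ (interior_subset h), hT₂⟩
  have hclosed : IsClosed S := by
    rw [← isOpen_compl_iff, isOpen_iff_mem_nhds]
    rintro ⟨t, y⟩ hy
    by_cases hne : ∃ x, T t x = y
    · obtain ⟨x, rfl⟩ := hne
      obtain ⟨x', hx', hxx'⟩ : ∃ x', T t x' = T t x ∧ x' ≠ x := by
        by_contra! hcon
        exact hy ⟨x, rfl, hcon⟩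
      obtain ⟨U, U', hU, hU', hx'U, hxU', hdisj⟩ := t2_separation hxx'
      have h1 := hex t x' U (hU.mem_nhds hx'U)
      rw [hx'] at h1
      filter_upwards [h1, hex t x U' (hU'.mem_nhds hxU')] with q ⟨x₁, hx₁, hT₁⟩ ⟨x₂, hx₂, hT₂⟩
      rintro ⟨z, _, hz⟩
      exact disjoint_left.1 hdisj hx₁ (by rwa [hz x₁ hT₁, ← hz x₂ hT₂])
    · have h1 := (himg univ isClosed_univ).isOpen_compl.mem_nhds
        (x := (t, y)) (by simpa using hne)
      filter_upwards [h1] with q hq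
      rintro ⟨z, hz, _⟩
      exact hq ⟨z, mem_univ _, hz⟩
  have huniv : S = univ := IsClopen.eq_univ ⟨hclosed, hopen⟩ ⟨(t₀, y₀), h₀⟩
  exact huniv.ge (mem_univ (t, y))

theorem continuous_inverse_of_existsUnique {P X Y : Type*} [TopologicalSpace P]
    [TopologicalSpace X] [TopologicalSpace Y] [CompactSpace P] [T2Space P] [CompactSpace X]
    [T2Space Y] {T : P → X → Y} (hT : Continuous fun q : P × X => T q.1 q.2) {S : P → Y → X}
    (hTS : ∀ t y, T t (S t y) = y) (hST : ∀ t x, S t (T t x) = x) :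
    Continuous fun q : P × Y => S q.1 q.2 := by
  let Ψ : P × X ≃ P × Y :=
    { toFun := fun q => (q.1, T q.1 q.2)
      invFun := fun q => (q.1, S q.1 q.2)
      left_inv := fun q => by simp [hST]
      right_inv := fun q => by simp [hTS] }
  have hΨ : Continuous Ψ := continuous_fst.prodMk hT
  exact continuous_snd.comp (Continuous.homeoOfEquivCompactToT2 hΨ).symm.continuous

/-! ### The transport map along a segment of potentials -/

theorem diffAtX_of_mem (hM : HasRegularCharts M) (hc : IsAdmissibleCost M c K) {x y : M.Pt}
    (h : (x, y) ∈ K) : DiffAtX M c x y := by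
  refine ⟨hc.ne_top x y h, ?_⟩
  have h1 : DifferentiableAt ℝ (costRep M c x y) ((0 : E n), (0 : E n)) :=
    (hc.contDiffAt x y h).differentiableAt (by norm_num)
  have h2 := DifferentiableAt.comp (g := costRep M c x y) (f := fun ξ : E n => (ξ, (0 : E n)))
    (0 : E n) h1 (by fun_prop)
  simpa [costRep, Function.comp_def, hM.coord_zero] using h2

/-- By twistedness, first-order optimality characterizes the transport map. -/
theorem isCriticalPair_iff (hM : HasRegularCharts M) (hc : IsAdmissibleCost M c K) {a b : ℝ}
    {v : M.Pt → ℝ} (hv : EigenvaluesBetween M c K a b v) {x y : M.Pt} :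
    IsCriticalPair M c v x y ↔ transportMap M c v x = y := by
  have h1 := diffAtX_of_mem hM hc (hv x).1
  constructor
  · rintro ⟨h2, h3⟩
    exact hc.twist x _ _ h1 h2 ((hv x).2.1.trans h3.symm)
  · rintro rfl
    exact ⟨h1, (hv x).2.1⟩

theorem omega_pos {a b : ℝ} (ha : 0 ≤ a) {v : M.Pt → ℝ} (hv : EigenvaluesBetween M c K a b v)
    (x : M.Pt) (ξ : E n) (hξ : ξ ≠ 0) : 0 < omega M c v x ξ ξ :=
  (mul_nonneg ha (sq_nonneg _)).trans_lt ((hv x).2.2 ξ hξ).1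

/-- The local structure of the transport maps along a segment of potentials. -/
theorem exists_local_transportMap (hM : HasRegularCharts M) (hc : IsAdmissibleCost M c K)
    {a b : ℝ} (ha : 0 ≤ a) {v h : M.Pt → ℝ} (hv : IsCk M 2 v) (hh : IsCk M 2 h)
    (hseg : ∀ t : I, EigenvaluesBetween M c K a b fun x => v x + t * h x) (t₀ : I) (x : M.Pt) :
    ∃ (Ξ Θ : ℝ × E n → E n) (Ξ' Θ' : ℝ × E n →L[ℝ] E n),
      HasStrictFDerivAt Ξ Ξ' ((t₀ : ℝ), 0) ∧ HasStrictFDerivAt Θ Θ' ((t₀ : ℝ), 0) ∧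
      Ξ (t₀, 0) = 0 ∧ Θ (t₀, 0) = 0 ∧
      (∀ᶠ p in 𝓝 ((t₀, 0, 0) : I × E n × E n),
        (transportMap M c (fun x => v x + p.1 * h x) (M.coord x p.2.1) =
          M.coord (transportMap M c (fun x => v x + t₀ * h x) x) p.2.2 ↔
            Ξ (p.1, p.2.2) = p.2.1) ∧
        (transportMap M c (fun x => v x + p.1 * h x) (M.coord x p.2.1) =
          M.coord (transportMap M c (fun x => v x + t₀ * h x) x) p.2.2 ↔
            Θ (p.1, p.2.1) = p.2.2)) ∧
      (∀ a, omega M c (fun x => v x + t₀ * h x) x (Ξ' (1, 0)) a =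
        -fderiv ℝ (fun ξ => h (M.coord x ξ)) 0 a) ∧
      (∀ ξ a, omega M c (fun x => v x + t₀ * h x) x ξ a +
        hessXY M c x (transportMap M c (fun x => v x + t₀ * h x) x) a (Θ' (0, ξ)) = 0) := by
  have hK := (hseg t₀ x).1
  obtain ⟨Ξ, Θ, Ξ', Θ', h1, h2, h3, h4, h5, h6, h7⟩ := exists_local_solution hM hc.continuous
    (hc.ne_top _ _ hK) (hc.contDiffAt _ _ hK) (hc.nondegenerate _ _ hK) hv hh t₀
    ((isCriticalPair_iff hM hc (hseg t₀)).2 rfl) (omega_pos ha (hseg t₀) x)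
  refine ⟨Ξ, Θ, Ξ', Θ', h1, h2, h3, h4, ?_, h6, h7⟩
  have hcont : Tendsto (fun p : I × E n × E n => ((p.1 : ℝ), p.2)) (𝓝 (t₀, 0, 0))
      (𝓝 ((t₀ : ℝ), 0, 0)) := Continuous.tendsto' (by fun_prop) _ _ rfl
  filter_upwards [hcont.eventually h5] with p hp
  rwa [isCriticalPair_iff hM hc (hseg p.1)] at hp

/-- Charts reach a full neighbourhood, also in the presence of a parameter. -/
theorem nhds_prod_le_map (hM : HasRegularCharts M) {P : Type*} [TopologicalSpace P] (t : P)
    (x : M.Pt) : 𝓝 (t, x) ≤ map (fun q : P × E n => (q.1, M.coord x q.2)) (𝓝 (t, 0)) := by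
  have h1 : (fun q : P × E n => (q.1, M.coord x q.2)) = Prod.map id (M.coord x) := rfl
  rw [nhds_prod_eq, nhds_prod_eq, h1, ← Filter.prod_map_map_eq', map_id]
  exact Filter.prod_mono le_rfl (hM.nhds_le_map x)

theorem tendsto_coord (hM : HasRegularCharts M) (x : M.Pt) :
    Tendsto (M.coord x) (𝓝 0) (𝓝 x) := by
  simpa [hM.coord_zero] using (hM.continuous_coord x).tendsto 0

theorem continuous_of_nhds_le {X Y Z : Type*} [TopologicalSpace X] [TopologicalSpace Y]
    [TopologicalSpace Z] {κ : X → Z → X} {z : Z} (h0 : ∀ x, κ x z = x)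
    (hn : ∀ x, 𝓝 x ≤ map (κ x) (𝓝 z)) {F : X → Y} (h : ∀ x, ContinuousAt (fun ξ => F (κ x ξ)) z) :
    Continuous F := by
  refine continuous_iff_continuousAt.2 fun x => ?_
  have h1 := h x
  rw [ContinuousAt, h0] at h1
  exact (Filter.map_mono (hn x)).trans (by rwa [Filter.map_map])

theorem continuous_of_coord (hM : HasRegularCharts M) {Y : Type*} [TopologicalSpace Y]
    {F : M.Pt → Y} (h : ∀ x, ContinuousAt (fun ξ => F (M.coord x ξ)) 0) : Continuous F :=
  continuous_of_nhds_le (κ := M.coord) hM.coord_zero hM.nhds_le_map h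

theorem IsCk.continuous (hM : HasRegularCharts M) {k : ℕ} {v : M.Pt → ℝ} (hv : IsCk M k v) :
    Continuous v := continuous_of_coord hM fun x => (hv x).continuousAt

section Segment

variable {a b : ℝ} {v h : M.Pt → ℝ}

theorem continuous_transportMap_segment (hM : HasRegularCharts M) (hc : IsAdmissibleCost M c K)
    (ha : 0 ≤ a) (hv : IsCk M 2 v) (hh : IsCk M 2 h)
    (hseg : ∀ t : I, EigenvaluesBetween M c K a b fun x => v x + t * h x) :
    Continuous fun q : I × M.Pt => transportMap M c (fun x => v x + q.1 * h x) q.2 := by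
  refine continuous_iff_continuousAt.2 fun ⟨t₀, x⟩ => ?_
  obtain ⟨Ξ, Θ, Ξ', Θ', h1, h2, h3, h4, h5, h6, h7⟩ :=
    exists_local_transportMap hM hc ha hv hh hseg t₀ x
  refine (Filter.map_mono (nhds_prod_le_map hM t₀ x)).trans ?_
  rw [Filter.map_map]
  have c1 : Tendsto (fun q : I × E n => Θ (q.1, q.2)) (𝓝 (t₀, 0)) (𝓝 0) := by
    have : Tendsto (fun q : I × E n => ((q.1 : ℝ), q.2)) (𝓝 (t₀, 0)) (𝓝 ((t₀ : ℝ), 0)) :=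
      Continuous.tendsto' (by fun_prop) _ _ rfl
    have h8 := h2.continuousAt.tendsto.comp this
    rwa [h4] at h8
  have c2 : Tendsto (fun q : I × E n => (q.1, q.2, Θ (q.1, q.2))) (𝓝 (t₀, 0))
      (𝓝 (t₀, 0, 0)) :=
    (continuous_fst.tendsto _).prodMk_nhds ((continuous_snd.tendsto _).prodMk_nhds c1)
  refine ((tendsto_coord hM _).comp c1).congr' ?_
  filter_upwards [c2.eventually h5] with q hq
  exact (hq.2.2 rfl).symm

theorem transportMap_segment_locally_surjective (hM : HasRegularCharts M)
    (hc : IsAdmissibleCost M c K)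
    (ha : 0 ≤ a) (hv : IsCk M 2 v) (hh : IsCk M 2 h)
    (hseg : ∀ t : I, EigenvaluesBetween M c K a b fun x => v x + t * h x) (t₀ : I) (x : M.Pt)
    {N : Set M.Pt} (hN : N ∈ 𝓝 x) :
    ∀ᶠ q in 𝓝 (t₀, transportMap M c (fun x => v x + t₀ * h x) x),
      ∃ x' ∈ N, transportMap M c (fun x => v x + q.1 * h x) x' = q.2 := by
  obtain ⟨Ξ, Θ, Ξ', Θ', h1, h2, h3, h4, h5, h6, h7⟩ :=
    exists_local_transportMap hM hc ha hv hh hseg t₀ x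
  refine nhds_prod_le_map hM t₀ _ ?_
  rw [mem_map]
  have c1 : Tendsto (fun q : I × E n => Ξ (q.1, q.2)) (𝓝 (t₀, 0)) (𝓝 0) := by
    have : Tendsto (fun q : I × E n => ((q.1 : ℝ), q.2)) (𝓝 (t₀, 0)) (𝓝 ((t₀ : ℝ), 0)) :=
      Continuous.tendsto' (by fun_prop) _ _ rfl
    have h8 := h1.continuousAt.tendsto.comp this
    rwa [h3] at h8
  have c2 : Tendsto (fun q : I × E n => (q.1, Ξ (q.1, q.2), q.2)) (𝓝 (t₀, 0))
      (𝓝 (t₀, 0, 0)) :=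
    (continuous_fst.tendsto _).prodMk_nhds (c1.prodMk_nhds (continuous_snd.tendsto _))
  filter_upwards [c2.eventually h5, ((tendsto_coord hM x).comp c1).eventually hN] with q hq hq'
  exact ⟨_, hq', hq.1.2 rfl⟩

theorem transportMap_segment_locally_injective (hM : HasRegularCharts M)
    (hc : IsAdmissibleCost M c K)
    (ha : 0 ≤ a) (hv : IsCk M 2 v) (hh : IsCk M 2 h)
    (hseg : ∀ t : I, EigenvaluesBetween M c K a b fun x => v x + t * h x) (t₀ : I) (x : M.Pt) :
    ∃ U ∈ 𝓝 x, ∀ᶠ q in 𝓝 (t₀, transportMap M c (fun x => v x + t₀ * h x) x),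
      ∀ x₁ ∈ U, ∀ x₂ ∈ U, transportMap M c (fun x => v x + q.1 * h x) x₁ = q.2 →
        transportMap M c (fun x => v x + q.1 * h x) x₂ = q.2 → x₁ = x₂ := by
  obtain ⟨Ξ, Θ, Ξ', Θ', h1, h2, h3, h4, h5, h6, h7⟩ :=
    exists_local_transportMap hM hc ha hv hh hseg t₀ x
  have c1 : Tendsto (fun q : (I × E n) × E n => (q.1.1, q.2, q.1.2)) (𝓝 ((t₀, 0), 0))
      (𝓝 (t₀, 0, 0)) := Continuous.tendsto' (by fun_prop) _ _ rfl
  have h8 := c1.eventually h5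
  rw [nhds_prod_eq, eventually_prod_iff] at h8
  obtain ⟨pa, hpa, pb, hpb, hp⟩ := h8
  refine ⟨M.coord x '' {ξ | pb ξ}, hM.nhds_le_map x (image_mem_map hpb),
    nhds_prod_le_map hM t₀ _ ?_⟩
  rw [mem_map]
  filter_upwards [hpa] with q hq
  rintro _ ⟨ξ₁, hξ₁, rfl⟩ _ ⟨ξ₂, hξ₂, rfl⟩ hT₁ hT₂
  exact congrArg (M.coord x) (((hp hq hξ₁).1.1 hT₁).symm.trans ((hp hq hξ₂).1.1 hT₂))

variable [CompactSpace M.Pt] [ConnectedSpace M.Pt] [T2Space M.Pt]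

/-- Bijectivity of the transport map propagates along segments of potentials, by
`existsUnique_of_local`. -/
theorem bijective_transportMap_segment (hM : HasRegularCharts M) (hc : IsAdmissibleCost M c K)
    (ha : 0 ≤ a) (hv : IsCk M 2 v) (hh : IsCk M 2 h)
    (hseg : ∀ t : I, EigenvaluesBetween M c K a b fun x => v x + t * h x)
    (hbij : Function.Bijective (transportMap M c v)) (t : I) :
    Function.Bijective (transportMap M c fun x => v x + t * h x) := by
  rw [Function.bijective_iff_existsUnique]
  obtain ⟨y₀⟩ : Nonempty M.Pt := inferInstance
  refine existsUnique_of_local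
    (T := fun t : I => transportMap M c (fun x => v x + t * h x))
    (continuous_transportMap_segment hM hc ha hv hh hseg)
    (fun t x N hN => transportMap_segment_locally_surjective hM hc ha hv hh hseg t x hN)
    (transportMap_segment_locally_injective hM hc ha hv hh hseg) (t₀ := 0) (y₀ := y₀) ?_ t
  simpa using Function.bijective_iff_existsUnique _ |>.1 hbij y₀

/-- The image of the transport map is open and closed. -/
theorem surjective_transportMap (hM : HasRegularCharts M) (hc : IsAdmissibleCost M c K)
    (ha : 0 ≤ a) (hv : IsCk M 2 v) (hev : EigenvaluesBetween M c K a b v) :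
    Function.Surjective (transportMap M c v) := by
  have h0 : IsCk M 2 (fun _ : M.Pt => (0 : ℝ)) := fun x => contDiffAt_const
  have hseg : ∀ t : I, EigenvaluesBetween M c K a b fun x => v x + t * (0 : ℝ) := by simpa using hev
  have hcont := continuous_transportMap_segment hM hc ha hv h0 hseg
  simp only [mul_zero, add_zero] at hcont
  have hcont' : Continuous (transportMap M c v) := hcont.comp (Continuous.prodMk_right (0 : I))
  rw [← range_eq_univ]
  refine IsClopen.eq_univ ⟨(isCompact_range hcont').isClosed, ?_⟩ (range_nonempty _)
  rw [isOpen_iff_mem_nhds]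
  rintro _ ⟨x, rfl⟩
  have h1 := transportMap_segment_locally_surjective hM hc ha hv h0 hseg 0 x univ_mem
  simp only [mul_zero, add_zero] at h1
  have h2 : Tendsto (fun y : M.Pt => ((0 : I), y)) (𝓝 (transportMap M c v x))
      (𝓝 (0, transportMap M c v x)) := (Continuous.prodMk_right (0 : I)).tendsto _
  filter_upwards [h2.eventually h1] with y ⟨x', _, hx'⟩
  exact ⟨x', hx'⟩

end Segment

end

section

variable {n : ℕ}
variable {M : Manifold n} {c : M.Pt → M.Pt → EReal} {K : Set (M.Pt × M.Pt)}

/-! ### Determinants -/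

theorem apply_eq_sum_e (b : E n →L[ℝ] ℝ) (a : E n) : b a = ∑ j, a j * b (e j) := by
  conv_lhs => rw [← sum_smul_e a, map_sum]
  simp

theorem det_eq_det_of (L : E n →L[ℝ] E n) :
    L.det = (Matrix.of fun i j : Fin n => L (e j) i).det := by
  rw [ContinuousLinearMap.det,
    ← LinearMap.det_toMatrix (EuclideanSpace.basisFun (Fin n) ℝ).toBasis]
  congr 1

theorem formDet_comp (B : E n →L[ℝ] E n →L[ℝ] ℝ) {B' : E n →L[ℝ] E n →L[ℝ] ℝ} (P Q : E n →L[ℝ] E n)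
    (h : ∀ a b, B' a b = B (P a) (Q b)) : formDet B' = P.det * formDet B * Q.det := by
  rw [det_eq_det_of P, det_eq_det_of Q, formDet, formDet, ← Matrix.det_transpose (Matrix.of fun i j =>
    P (e j) i), ← Matrix.det_mul, ← Matrix.det_mul]
  congr 1
  ext i j
  simp only [Matrix.of_apply, Matrix.mul_apply, Matrix.transpose_apply]
  rw [h, apply_eq_sum_e (B (P (e i)))]
  refine Finset.sum_congr rfl fun k _ => ?_
  rw [mul_comm, ← ContinuousLinearMap.flip_apply, apply_eq_sum_e]
  simp

/-- The determinant of a solution `L` of `A(ξ, a) + B(a, L ξ) = 0`. With `A = ω` and `B = D²ₓᵧ c` this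
gives the Jacobian of the transport map. -/
theorem abs_det_mul_abs_formDet {A B : E n →L[ℝ] E n →L[ℝ] ℝ} {L : E n →L[ℝ] E n}
    (h : ∀ ξ a, A ξ a + B a (L ξ) = 0) : |L.det| * |formDet B| = |formDet A| := by
  have h1 : formDet A = (-(Matrix.of fun i j : Fin n => B (e i) (e j)) *
      (Matrix.of fun i j : Fin n => L (e j) i)).transpose.det := by
    rw [formDet]
    congr 1
    ext i j
    simp only [Matrix.of_apply, Matrix.mul_apply, Matrix.transpose_apply, Matrix.neg_apply]
    rw [eq_neg_of_add_eq_zero_left (h (e i) (e j)), apply_eq_sum_e (B (e j)), ← Finset.sum_neg_distrib]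
    exact Finset.sum_congr rfl fun k _ => by ring
  rw [h1, Matrix.det_transpose, Matrix.det_mul, Matrix.det_neg, det_eq_det_of, formDet, abs_mul,
    abs_mul, abs_pow, abs_neg, abs_one, one_pow, one_mul, mul_comm]

/-- Polarization bounds the entries of the matrix by `l`. -/
theorem abs_formDet_le {A : E n →L[ℝ] E n →L[ℝ] ℝ} (hsymm : ∀ a b, A a b = A b a) {l : ℝ}
    (hl : ∀ ξ : E n, ξ ≠ 0 → 0 < A ξ ξ ∧ A ξ ξ < l * ‖ξ‖ ^ 2) : |formDet A| ≤ n.factorial * l ^ n := by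
  have hl' : ∀ ξ : E n, 0 ≤ A ξ ξ ∧ A ξ ξ ≤ l * ‖ξ‖ ^ 2 := by
    intro ξ
    rcases eq_or_ne ξ 0 with rfl | hξ
    · simp
    · exact ⟨(hl ξ hξ).1.le, (hl ξ hξ).2.le⟩
  have hij : ∀ i j : Fin n, |A (e i) (e j)| ≤ l := by
    intro i j
    have hn : ∀ i : Fin n, ‖e i‖ = 1 := fun i => by simp [e]
    by_cases hij : i = j
    · subst hij
      have := hl' (e i)
      rw [hn] at this
      rw [abs_of_nonneg this.1]
      linarith [this.2]
    · have hin : inner ℝ (e i) (e j) = 0 := by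
        simp [e, EuclideanSpace.inner_single_left, hij]
      have n1 : ‖e i + e j‖ ^ 2 = 2 := by
        rw [norm_add_sq_real, hin, hn, hn]; norm_num
      have n2 : ‖e i - e j‖ ^ 2 = 2 := by
        rw [norm_sub_sq_real, hin, hn, hn]; norm_num
      have a1 := hl' (e i + e j)
      have a2 := hl' (e i - e j)
      rw [n1] at a1
      rw [n2] at a2
      simp only [map_add, map_sub, _root_.add_apply, _root_.sub_apply] at a1 a2
      have := hsymm (e i) (e j)
      rw [abs_le]
      constructor <;> linarith [a1.1, a1.2, a2.1, a2.2]
  have := Matrix.det_le (A := Matrix.of fun i j : Fin n => A (e i) (e j))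
    (abv := (IsAbsoluteValue.toAbsoluteValue (abs : ℝ → ℝ))) (x := l) (fun i j => by simpa using hij i j)
  simpa [nsmul_eq_mul, formDet] using this

/-! ### Change of variables -/

/-- The set `s` need not be measurable. -/
theorem setLIntegral_le_mul_of_subset {α : Type*} [MeasurableSpace α] {μ : Measure α}
    {s W : Set α} (hsW : s ⊆ W) (hW : MeasurableSet W) {q : α → ENNReal} {k : ENNReal}
    (hq : ∀ y ∈ W, q y ≤ k) : ∫⁻ y in s, q y ∂μ ≤ k * μ s := by
  calc ∫⁻ y in s, q y ∂μ ≤ ∫⁻ y in toMeasurable μ s ∩ W, q y ∂μ :=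
        lintegral_mono_set (subset_inter (subset_toMeasurable μ s) hsW)
    _ ≤ ∫⁻ _ in toMeasurable μ s ∩ W, k ∂μ :=
        setLIntegral_mono' ((measurableSet_toMeasurable μ s).inter hW) fun y hy => hq y hy.2
    _ = k * μ (toMeasurable μ s ∩ W) := by simp
    _ ≤ k * μ s := by
        refine mul_le_mul' le_rfl ?_
        exact (measure_mono inter_subset_left).trans (measure_toMeasurable s).le

/-- Infinitesimal change of variables: a strict inequality between `q(T x) |det DT(x)|` and `p(x)` at a
point implies the integrated inequality on small measurable sets around it. -/
theorem exists_nhds_lintegral_image_le [BorelSpace M.Pt] (hM : HasRegularCharts M)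
    {T : M.Pt → M.Pt} {x : M.Pt} (hTx : ContinuousAt T x) {Θ : E n → E n} {L : E n →L[ℝ] E n}
    (hΘ : HasStrictFDerivAt Θ L 0) (hT : ∀ᶠ ξ in 𝓝 0, T (M.coord x ξ) = M.coord (T x) (Θ ξ))
    {p q : M.Pt → ℝ} (hp : Continuous p) (hq : Continuous q) (hq0 : ∀ y, 0 ≤ q y)
    (hlt : q (T x) * |L.det| < p x) :
    ∃ U, IsOpen U ∧ x ∈ U ∧ ∀ B ⊆ U, MeasurableSet B →
      ∫⁻ y in T '' B, ENNReal.ofReal (q y) ∂M.vol ≤ ∫⁻ x in B, ENNReal.ofReal (p x) ∂M.vol := by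
  -- `s` is the room left for the variation of `q`, of the Jacobian, of the chart and of `p`.
  obtain ⟨s, hs0, hs⟩ : ∃ s > (0 : ℝ), (q (T x) + s) * (|L.det| + s) * (1 + s) < p x - s := by
    have h1 : ContinuousAt
        (fun s : ℝ => (p x - s) - (q (T x) + s) * (|L.det| + s) * (1 + s)) 0 := by fun_prop
    have h2 := h1.eventually (lt_mem_nhds (a := 0) (by simpa using hlt))
    obtain ⟨s, hs, hs'⟩ := (h2.filter_mono nhdsWithin_le_nhds |>.and
      (self_mem_nhdsWithin (s := Ioi (0 : ℝ)))).exists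
    exact ⟨s, hs', by linarith⟩
  have hdet : ENNReal.ofReal |L.det| < ((|L.det| + s).toNNReal : ENNReal) := by
    exact (ENNReal.ofReal_lt_ofReal_iff (by positivity)).2 (by linarith)
  obtain ⟨κ, hκ, hκ0⟩ := ((addHaar_image_le_mul_of_det_lt (volume : Measure (E n)) L hdet).and
    self_mem_nhdsWithin).exists
  obtain ⟨N, hN, hNap⟩ := hΘ.approximates_deriv_on_nhds (c := κ) (Or.inr hκ0)
  obtain ⟨δ, hδ, hδvol⟩ := hM.vol_preimage_le s hs0
  let N' := N ∩ Metric.ball 0 δ ∩ {ξ | T (M.coord x ξ) = M.coord (T x) (Θ ξ)}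
  have hN' : M.coord x '' N' ∈ 𝓝 x := hM.nhds_le_map x
    (image_mem_map (inter_mem (inter_mem hN (Metric.ball_mem_nhds _ hδ)) hT))
  have hpx : ∀ᶠ z in 𝓝 x, p x - s < p z := hp.continuousAt.eventually (lt_mem_nhds (by linarith))
  have hqx : ∀ᶠ z in 𝓝 x, q (T z) < q (T x) + s :=
    (hq.continuousAt.comp hTx).eventually (gt_mem_nhds (by simpa using hs0))
  obtain ⟨U, hU, hUo, hxU⟩ := mem_nhds_iff.1 (inter_mem (inter_mem hN' hpx) hqx)
  refine ⟨U, hUo, hxU, fun B hBU hB => ?_⟩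
  set A := M.coord x ⁻¹' B ∩ N' with hA
  have hTB : T '' B ⊆ M.coord (T x) '' (Θ '' A) := by
    rintro _ ⟨z, hz, rfl⟩
    obtain ⟨ξ, hξ, rfl⟩ := (hU (hBU hz)).1.1
    exact ⟨Θ ξ, ⟨ξ, ⟨hz, hξ⟩, rfl⟩, hξ.2.symm⟩
  have hvol : M.vol (T '' B) ≤ ENNReal.ofReal ((|L.det| + s) * (1 + s)) * M.vol B := by
    calc M.vol (T '' B) ≤ volume (Θ '' A) := (measure_mono hTB).trans (hM.vol_image_le _ _)
      _ ≤ ((|L.det| + s).toNNReal : ENNReal) * volume A :=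
          hκ _ _ (hNap.mono_set fun ξ hξ => hξ.2.1.1)
      _ ≤ ((|L.det| + s).toNNReal : ENNReal) * (ENNReal.ofReal (1 + s) * M.vol B) := by
          refine mul_le_mul' le_rfl (le_trans (measure_mono ?_) (hδvol x B hB))
          exact fun ξ hξ => ⟨hξ.1, hξ.2.1.2⟩
      _ = ENNReal.ofReal ((|L.det| + s) * (1 + s)) * M.vol B := by
          rw [ENNReal.ofReal_mul (by positivity), mul_assoc]; rfl
  calc ∫⁻ y in T '' B, ENNReal.ofReal (q y) ∂M.vol
      ≤ ENNReal.ofReal (q (T x) + s) * M.vol (T '' B) := by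
        refine setLIntegral_le_mul_of_subset (W := {y | q y < q (T x) + s}) ?_
          (hq.measurable measurableSet_Iio) fun y hy => ENNReal.ofReal_le_ofReal hy.le
        rintro _ ⟨z, hz, rfl⟩
        exact (hU (hBU hz)).2
    _ ≤ ENNReal.ofReal (q (T x) + s) * (ENNReal.ofReal ((|L.det| + s) * (1 + s)) * M.vol B) := by
        gcongr
    _ = ENNReal.ofReal ((q (T x) + s) * (|L.det| + s) * (1 + s)) * M.vol B := by
        rw [mul_assoc, ENNReal.ofReal_mul (p := q (T x) + s) (by linarith [hq0 (T x)]), mul_assoc]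
    _ ≤ ENNReal.ofReal (p x - s) * M.vol B := by gcongr
    _ = ∫⁻ _ in B, ENNReal.ofReal (p x - s) ∂M.vol := by simp
    _ ≤ ∫⁻ x in B, ENNReal.ofReal (p x) ∂M.vol :=
        setLIntegral_mono' hB fun z hz => ENNReal.ofReal_le_ofReal (hU (hBU hz)).1.2.le

/-- The comparison of integrals over `T '' B` and `B` is subadditive in `B`, so by compactness it holds
globally as soon as it holds locally. -/
theorem lintegral_image_le_of_local {X : Type*} [TopologicalSpace X] [CompactSpace X]
    [MeasurableSpace X] [OpensMeasurableSpace X] {μ : Measure X} {T : X → X} {p q : X → ENNReal}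
    (h : ∀ x, ∃ U, IsOpen U ∧ x ∈ U ∧ ∀ B ⊆ U, MeasurableSet B →
      ∫⁻ y in T '' B, q y ∂μ ≤ ∫⁻ x in B, p x ∂μ)
    {B : Set X} (hB : MeasurableSet B) : ∫⁻ y in T '' B, q y ∂μ ≤ ∫⁻ x in B, p x ∂μ := by
  suffices ∃ s : Set X, MeasurableSet s ∧ univ ⊆ s ∧ ∀ B ⊆ s, MeasurableSet B →
      ∫⁻ y in T '' B, q y ∂μ ≤ ∫⁻ x in B, p x ∂μ by
    obtain ⟨s, _, hs, h⟩ := this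
    exact h B ((subset_univ B).trans hs) hB
  refine isCompact_univ.induction_on (p := fun t => ∃ s : Set X, MeasurableSet s ∧ t ⊆ s ∧
    ∀ B ⊆ s, MeasurableSet B → ∫⁻ y in T '' B, q y ∂μ ≤ ∫⁻ x in B, p x ∂μ) ?_ ?_ ?_ ?_
  · exact ⟨∅, .empty, Subset.rfl, fun B hB _ => by simp [subset_empty_iff.1 hB]⟩
  · rintro t t' htt' ⟨s, hs, hts, h⟩
    exact ⟨s, hs, htt'.trans hts, h⟩
  · rintro t t' ⟨s, hs, hts, h⟩ ⟨s', hs', hts', h'⟩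
    refine ⟨s ∪ s', hs.union hs', union_subset_union hts hts', fun B hBs hB => ?_⟩
    calc ∫⁻ y in T '' B, q y ∂μ = ∫⁻ y in T '' (B ∩ s) ∪ T '' (B \ s), q y ∂μ := by
          rw [← image_union, inter_union_sdiff]
      _ ≤ ∫⁻ y in T '' (B ∩ s), q y ∂μ + ∫⁻ y in T '' (B \ s), q y ∂μ := lintegral_union_le _ _ _
      _ ≤ ∫⁻ x in B ∩ s, p x ∂μ + ∫⁻ x in B \ s, p x ∂μ :=
          add_le_add (h _ inter_subset_right (hB.inter hs))
            (h' _ (fun z hz => (hBs hz.1).resolve_left hz.2) (hB.diff hs))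
      _ = ∫⁻ x in B, p x ∂μ := lintegral_inter_add_sdiff _ _ hs
  · intro x _
    obtain ⟨U, hU, hxU, h⟩ := h x
    exact ⟨U, mem_nhdsWithin_of_mem_nhds (hU.mem_nhds hxU), U, hU.measurableSet, Subset.rfl, h⟩

/-! ### The mixed Hessian of the cost -/

/-- The Jacobian of a transition map between nearby charts is bounded below, uniformly in the centre.
This follows by comparing the volume of a small ball with that of its image under the transition
map. -/
theorem exists_half_le_abs_det_transition [BorelSpace M.Pt] [T2Space M.Pt]
    (hM : HasRegularCharts M) :
    ∃ δ > (0 : ℝ), ∀ x, ∀ ξ ∈ Metric.ball (0 : E n) δ, ∀ Φ : E n → E n, ContDiffAt ℝ 4 Φ 0 →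
      Φ 0 = ξ → (∀ᶠ ζ in 𝓝 0, M.coord (M.coord x ξ) ζ = M.coord x (Φ ζ)) →
      1 / 2 ≤ |(fderiv ℝ Φ 0).det| := by
  obtain ⟨δ, hδ, hvol⟩ := hM.vol_preimage_le (1 / 2) (by norm_num)
  refine ⟨δ, hδ, fun x ξ hξ Φ hΦ hΦ0 hcoord => ?_⟩
  by_contra! hlt
  have hdet : ENNReal.ofReal |(fderiv ℝ Φ 0).det| < ((1 / 2 : ℝ≥0) : ENNReal) := by
    rw [ENNReal.ofReal_lt_iff_lt_toReal (abs_nonneg _) ENNReal.coe_ne_top]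
    simpa using hlt
  obtain ⟨κ, hκ, hκ0⟩ := ((addHaar_image_le_mul_of_det_lt (volume : Measure (E n)) _ hdet).and
    self_mem_nhdsWithin).exists
  have hst : HasStrictFDerivAt Φ (fderiv ℝ Φ 0) 0 := hΦ.hasStrictFDerivAt (by norm_num)
  obtain ⟨N, hN, hNap⟩ := hst.approximates_deriv_on_nhds (c := κ) (Or.inr hκ0)
  have hcontΦ := hΦ.eventually (by simp) |>.mono fun ζ h => h.continuousAt
  obtain ⟨R, hR, hRsub⟩ := Metric.mem_nhds_iff.1 (inter_mem (inter_mem hN hcoord)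
    (inter_mem (Metric.ball_mem_nhds (0 : E n) hδ) hcontΦ))
  have hC : Metric.closedBall (0 : E n) (R / 2) ⊆ Metric.ball 0 R :=
    Metric.closedBall_subset_ball (by linarith)
  set C := Metric.closedBall (0 : E n) (R / 2)
  have hCcomp : IsCompact C := isCompact_closedBall _ _
  have hBmeas : MeasurableSet (M.coord (M.coord x ξ) '' C) :=
    (hCcomp.image (hM.continuous_coord _)).isClosed.measurableSet
  have h1 := hvol (M.coord x ξ) _ hBmeas
  have h2 : volume C ≤ ENNReal.ofReal (1 + 1 / 2) * ((1 / 2 : ℝ≥0) * volume C) := by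
    calc volume C ≤ volume (M.coord (M.coord x ξ) ⁻¹' (M.coord (M.coord x ξ) '' C) ∩
          Metric.ball 0 δ) :=
          measure_mono fun ζ hζ => ⟨mem_image_of_mem _ hζ, (hRsub (hC hζ)).2.1⟩
      _ ≤ _ := h1
      _ ≤ ENNReal.ofReal (1 + 1 / 2) * volume (Φ '' C) := by
          gcongr
          refine (measure_mono ?_).trans (hM.vol_image_le x _)
          rintro _ ⟨ζ, hζ, rfl⟩
          exact ⟨Φ ζ, mem_image_of_mem _ hζ, (hRsub (hC hζ)).1.2.symm⟩
      _ ≤ _ := by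
          gcongr
          exact hκ _ _ (hNap.mono_set fun ζ hζ => (hRsub (hC hζ)).1.1)
  have hpos : 0 < volume C := Metric.measure_closedBall_pos _ _ (by linarith)
  have hfin : volume C < ⊤ := hCcomp.measure_lt_top
  have h3 := ENNReal.toReal_mono (by finiteness) h2
  simp only [ENNReal.toReal_mul, ENNReal.coe_toReal] at h3
  rw [ENNReal.toReal_ofReal (by norm_num)] at h3
  have h4 : 0 < (volume C).toReal := ENNReal.toReal_pos hpos.ne' hfin.ne
  norm_num at h3
  linarith

/-- The mixed Hessian is tensorial: it transforms with the first derivatives of the transition maps. -/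
theorem hessXY_coord {x y : M.Pt} {ξ η : E n} (hF : ContDiffAt ℝ 4 (costRep M c x y) (ξ, η))
    {Φ Ψ : E n → E n} (hΦ : ContDiffAt ℝ 4 Φ 0) (hΨ : ContDiffAt ℝ 4 Ψ 0) (hΦ0 : Φ 0 = ξ)
    (hΨ0 : Ψ 0 = η) (hcΦ : ∀ᶠ ζ in 𝓝 0, M.coord (M.coord x ξ) ζ = M.coord x (Φ ζ))
    (hcΨ : ∀ᶠ ζ in 𝓝 0, M.coord (M.coord y η) ζ = M.coord y (Ψ ζ)) (a b : E n) :
    hessXY M c (M.coord x ξ) (M.coord y η) a b =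
      fderiv ℝ (fderiv ℝ (costRep M c x y)) (ξ, η) (fderiv ℝ Φ 0 a, 0) (0, fderiv ℝ Ψ 0 b) := by
  subst hΦ0 hΨ0
  set F := costRep M c x y
  have dΦ : HasFDerivAt Φ (fderiv ℝ Φ 0) 0 := (hΦ.differentiableAt (by norm_num)).hasFDerivAt
  have dΨ : HasFDerivAt Ψ (fderiv ℝ Ψ 0) 0 := (hΨ.differentiableAt (by norm_num)).hasFDerivAt
  have hΦt : Tendsto (fun ζ => (Φ ζ, Ψ 0)) (𝓝 0) (𝓝 (Φ 0, Ψ 0)) :=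
    hΦ.continuousAt.tendsto.prodMk_nhds tendsto_const_nhds
  have h1 : (fun ζ => fderiv ℝ
      (fun ζ' => (c (M.coord (M.coord x (Φ 0)) ζ) (M.coord (M.coord y (Ψ 0)) ζ')).toReal) 0) =ᶠ[𝓝 0]
      fun ζ => (fderiv ℝ F (Φ ζ, Ψ 0)).comp
        ((ContinuousLinearMap.inr ℝ (E n) (E n)).comp (fderiv ℝ Ψ 0)) := by
    filter_upwards [hΦt.eventually (hF.eventually (by simp)), hcΦ] with ζ hζ hcζ
    refine HasFDerivAt.fderiv ?_
    have h2 : HasFDerivAt (fun ζ' => F (Φ ζ, Ψ ζ')) _ 0 :=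
      HasFDerivAt.comp (g := F) (f := fun ζ' => (Φ ζ, Ψ ζ')) (0 : E n)
      (hζ.differentiableAt (by norm_num)).hasFDerivAt
      ((hasFDerivAt_prodMk_right (𝕜 := ℝ) (Φ ζ) (Ψ 0)).comp (0 : E n) dΨ)
    refine h2.congr_of_eventuallyEq ?_
    filter_upwards [hcΨ] with ζ' hζ'
    simp only [F, costRep, hcζ, hζ']
  have h2 : HasFDerivAt (fderiv ℝ F) (fderiv ℝ (fderiv ℝ F) (Φ 0, Ψ 0)) (Φ 0, Ψ 0) :=
    ((hF.fderiv_right (m := 1) (by norm_num)).differentiableAt (by norm_num)).hasFDerivAt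
  have h3 : HasFDerivAt (fun ζ : E n => fderiv ℝ F (Φ ζ, Ψ 0)) _ 0 :=
    HasFDerivAt.comp (g := fderiv ℝ F) (f := fun ζ => (Φ ζ, Ψ 0)) 0 h2
      ((hasFDerivAt_prodMk_left (𝕜 := ℝ) (Φ 0) (Ψ 0)).comp (0 : E n) dΦ)
  have h4 := h3.clm_comp (hasFDerivAt_const
    ((ContinuousLinearMap.inr ℝ (E n) (E n)).comp (fderiv ℝ Ψ 0)) (0 : E n))
  unfold hessXY
  rw [h1.fderiv_eq, h4.fderiv]
  simp

/-- The determinant of the mixed Hessian is taken in frames that need not depend continuously on the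
base points, so compactness of `K` is used through fixed charts and
`exists_half_le_abs_det_transition`. -/
theorem exists_le_abs_formDet_hessXY [BorelSpace M.Pt] [T2Space M.Pt]
    (hM : HasRegularCharts M) (hc : IsAdmissibleCost M c K) :
    ∃ m > (0 : ℝ), ∀ z ∈ K, m ≤ |formDet (hessXY M c z.1 z.2)| := by
  obtain ⟨δ, hδ, hdet⟩ := exists_half_le_abs_det_transition hM
  refine hc.isCompact.induction_on
    (p := fun s => ∃ m > (0 : ℝ), ∀ z ∈ s, m ≤ |formDet (hessXY M c z.1 z.2)|) ?_ ?_ ?_ ?_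
  · exact ⟨1, one_pos, by simp⟩
  · rintro s t hst ⟨m, hm, h⟩
    exact ⟨m, hm, fun z hz => h z (hst hz)⟩
  · rintro s t ⟨m, hm, h⟩ ⟨m', hm', h'⟩
    refine ⟨min m m', lt_min hm hm', fun z hz => ?_⟩
    rcases hz with hz | hz
    · exact (min_le_left _ _).trans (h z hz)
    · exact (min_le_right _ _).trans (h' z hz)
  · rintro ⟨x, y⟩ hxy
    have hF : ContDiffAt ℝ 4 (costRep M c x y) 0 := hc.contDiffAt x y hxy
    set F := costRep M c x y
    let Q : E n × E n → E n →L[ℝ] E n →L[ℝ] ℝ := fun z =>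
      ((ContinuousLinearMap.compL ℝ (E n) (E n × E n) ℝ).flip
        (ContinuousLinearMap.inr ℝ (E n) (E n))).comp
        ((fderiv ℝ (fderiv ℝ F) z).comp (ContinuousLinearMap.inl ℝ (E n) (E n)))
    have hQ : ∀ z a b, Q z a b = fderiv ℝ (fderiv ℝ F) z (a, 0) (0, b) := fun z a b => rfl
    have hF2 : ContinuousAt (fderiv ℝ (fderiv ℝ F)) 0 :=
      ((hF.fderiv_right (m := 2) (by norm_num)).fderiv_right (m := 1) (by norm_num)).continuousAt
    have hQdet : ContinuousAt (fun z => |formDet (Q z)|) 0 := by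
      refine ContinuousAt.abs ?_
      have h1 : Continuous fun A : Matrix (Fin n) (Fin n) ℝ => A.det := Continuous.matrix_det continuous_id
      refine h1.continuousAt.comp (f := fun z => Matrix.of fun i j : Fin n => Q z (e i) (e j)) ?_
      refine continuousAt_pi.2 fun i => continuousAt_pi.2 fun j => ?_
      exact (hF2.clm_apply continuousAt_const).clm_apply continuousAt_const
    have hQ0 : 0 < |formDet (Q 0)| := by
      have h1 : Q 0 = hessXY M c x y := by
        ext a b
        rw [hQ, hessXY_apply hF]
      rw [h1]
      exact abs_pos.2 (hc.nondegenerate x y hxy)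
    set m := |formDet (Q 0)| / 2 with hm
    have hev : ∀ᶠ z in 𝓝 (0 : E n × E n), m < |formDet (Q z)| :=
      hQdet.eventually (lt_mem_nhds (by linarith))
    have hball : ∀ᶠ z in 𝓝 (0 : E n × E n), z.1 ∈ Metric.ball (0 : E n) δ ∧
        z.2 ∈ Metric.ball (0 : E n) δ :=
      ((continuous_fst.tendsto (0 : E n × E n)).eventually (Metric.ball_mem_nhds _ hδ)).and
        ((continuous_snd.tendsto (0 : E n × E n)).eventually (Metric.ball_mem_nhds _ hδ))
    have hnh : (fun z : E n × E n => (M.coord x z.1, M.coord y z.2)) ''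
        {z | m < |formDet (Q z)| ∧ (z.1 ∈ Metric.ball (0 : E n) δ ∧ z.2 ∈ Metric.ball (0 : E n) δ) ∧
          ContDiffAt ℝ 4 F z} ∈ 𝓝 (x, y) := by
      have h2 : 𝓝 (x, y) ≤ map (fun z : E n × E n => (M.coord x z.1, M.coord y z.2)) (𝓝 0) := by
        have h1 : (fun z : E n × E n => (M.coord x z.1, M.coord y z.2)) =
          Prod.map (M.coord x) (M.coord y) := rfl
        have h0 : (0 : E n × E n) = (0, 0) := rfl
        rw [nhds_prod_eq, h0, nhds_prod_eq, h1, ← Filter.prod_map_map_eq']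
        exact Filter.prod_mono (hM.nhds_le_map x) (hM.nhds_le_map y)
      exact h2 (image_mem_map (hev.and (hball.and (hF.eventually (by simp)))))
    refine ⟨_, mem_nhdsWithin_of_mem_nhds hnh, m / 4, by positivity, ?_⟩
    rintro _ ⟨⟨ξ, η⟩, ⟨h1, ⟨h2, h3⟩, h4⟩, rfl⟩
    obtain ⟨Φ, hΦ, hΦ0, -, hcΦ⟩ := hM.transition x ξ
    obtain ⟨Ψ, hΨ, hΨ0, -, hcΨ⟩ := hM.transition y η
    have d1 := hdet x ξ h2 Φ hΦ hΦ0 hcΦ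
    have d2 := hdet y η h3 Ψ hΨ hΨ0 hcΨ
    dsimp only at h1 ⊢
    rw [formDet_comp (Q (ξ, η)) (fderiv ℝ Φ 0) (fderiv ℝ Ψ 0)
      (fun a b => by rw [hQ, hessXY_coord h4 hΦ hΨ hΦ0 hΨ0 hcΦ hcΨ]), abs_mul, abs_mul]
    have hmpos : 0 < m := by positivity
    calc m / 4 = 1 / 2 * m * (1 / 2) := by ring
      _ ≤ _ := by gcongr

end

section

variable {n : ℕ}
variable {M : Manifold n} {c : M.Pt → M.Pt → EReal} {K : Set (M.Pt × M.Pt)}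

/-! ### Maximizers in the c-transform -/

/-- If `k` is semi-concave, `V` is differentiable and `k + V` has a local minimum at `0`, then `k` is
differentiable at `0`, with derivative `-DV(0)`. -/
theorem hasFDerivAt_of_semiconcave_of_touching {k V : E n → ℝ} {V' : E n →L[ℝ] ℝ} {C ρ : ℝ}
    (hρ : 0 < ρ) (hk : ConcaveOn ℝ (Metric.ball 0 ρ) fun ξ => k ξ - C * ‖ξ‖ ^ 2)
    (hV : HasFDerivAt V V' 0) (hmin : ∀ᶠ ξ in 𝓝 0, k 0 + V 0 ≤ k ξ + V ξ) :
    HasFDerivAt k (-V') 0 := by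
  rw [hasFDerivAt_iff_isLittleO_nhds_zero] at hV ⊢
  simp only [zero_add] at hV ⊢
  have hneg : Tendsto (fun ξ : E n => -ξ) (𝓝 0) (𝓝 0) := Continuous.tendsto' (by fun_prop) _ _ (by simp)
  have hV2 := (hV.comp_tendsto hneg).norm_right
  simp only [Function.comp_def, norm_neg] at hV2
  have hsq : (fun ξ : E n => 2 * |C| * ‖ξ‖ ^ 2) =o[𝓝 0] fun ξ => ‖ξ‖ :=
    ((Asymptotics.isLittleO_norm_pow_id one_lt_two).const_mul_left _).norm_right
  have hsum := (hV.norm_right.norm_left.add hV2.norm_left).add hsq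
  refine (Asymptotics.IsBigO.trans_isLittleO ?_ hsum).of_norm_right
  refine Asymptotics.IsBigO.of_bound 1 ?_
  -- The minimum gives the bound from below at `ξ`; at `-ξ` it gives, by midpoint concavity, the
  -- bound from above at `ξ`.
  filter_upwards [hmin, hneg.eventually hmin, Metric.ball_mem_nhds (0 : E n) hρ] with ξ h1 h2 h3
  have h4 : -ξ ∈ Metric.ball (0 : E n) ρ := by simpa using h3
  have h5 := hk.2 h3 h4 (show (0 : ℝ) ≤ 1 / 2 by norm_num)
    (show (0 : ℝ) ≤ 1 / 2 by norm_num) (by norm_num)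
  have h6 : (1 / 2 : ℝ) • ξ + (1 / 2 : ℝ) • -ξ = 0 := by simp
  rw [h6] at h5
  simp only [norm_zero, norm_neg, smul_eq_mul] at h5
  rw [one_mul]
  refine le_trans ?_ (le_abs_self _)
  simp only [map_neg, Real.norm_eq_abs, _root_.neg_apply]
  have hC : C * ‖ξ‖ ^ 2 ≤ |C| * ‖ξ‖ ^ 2 := by gcongr; exact le_abs_self C
  have hC0 : 0 ≤ |C| * ‖ξ‖ ^ 2 := by positivity
  rw [abs_le]
  constructor
  · linarith [le_abs_self (V ξ - V 0 - V' ξ), abs_nonneg (V (-ξ) - V 0 - -V' ξ)]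
  · linarith [le_abs_self (V (-ξ) - V 0 - -V' ξ), abs_nonneg (V ξ - V 0 - V' ξ)]

/-- A maximizer in the `c`-transform is critical, although the cost is only assumed semi-concave there. -/
theorem isCriticalPair_of_forall_le (hM : HasRegularCharts M) (hc : IsAdmissibleCost M c K)
    {v : M.Pt → ℝ} (hv : IsCk M 2 v) {x y : M.Pt} (hne : c x y ≠ ⊤)
    (hmax : ∀ x', c x' y ≠ ⊤ → -(c x' y).toReal - v x' ≤ -(c x y).toReal - v x) :
    IsCriticalPair M c v x y := by
  obtain ⟨C, ρ, hρ, hconc⟩ := hc.semiconcave x y hne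
  have hfin : ∀ᶠ ξ in 𝓝 (0 : E n), c (M.coord x ξ) y ≠ ⊤ := by
    have h1 : Continuous fun ξ => c (M.coord x ξ) y :=
      hc.continuous.comp ((hM.continuous_coord x).prodMk continuous_const)
    exact h1.continuousAt.eventually_ne (by rwa [hM.coord_zero])
  have hk : ConcaveOn ℝ (Metric.ball (0 : E n) ρ)
      fun ξ => (c (M.coord x ξ) y).toReal - C * ‖ξ‖ ^ 2 := by
    have h1 := hconc.comp_linearMap (LinearMap.inl ℝ (E n) (E n))
    have h2 : (LinearMap.inl ℝ (E n) (E n)) ⁻¹'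
        (Metric.ball (0 : E n) ρ ×ˢ Metric.ball (0 : E n) ρ) = Metric.ball (0 : E n) ρ := by
      ext ξ
      simp [hρ]
    rw [h2] at h1
    simpa [Function.comp_def, hM.coord_zero] using h1
  have hd := hasFDerivAt_of_semiconcave_of_touching hρ hk
    ((hv x).differentiableAt (by norm_num)).hasFDerivAt (by
      filter_upwards [hfin] with ξ hξ
      have := hmax _ hξ
      simp only [hM.coord_zero]
      linarith)
  refine ⟨⟨hne, hd.differentiableAt⟩, ?_⟩
  unfold gradX grad
  rw [gradient_eq_neg_iff, hd.fderiv, neg_add_cancel]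

theorem continuous_neg_cost_sub (hc : IsAdmissibleCost M c K) {v : M.Pt → ℝ} (hv : Continuous v) :
    Continuous fun z : M.Pt × M.Pt => -c z.2 z.1 - (v z.2 : EReal) := by
  have h1 : Continuous fun z : M.Pt × M.Pt => -c z.2 z.1 :=
    (hc.continuous.comp continuous_swap).neg
  have h2 : Continuous fun z : M.Pt × M.Pt => -(v z.2 : EReal) :=
    (continuous_coe_real_ereal.comp (hv.comp continuous_snd)).neg
  refine continuous_iff_continuousAt.2 fun z => ?_
  have h3 : -(v z.2 : EReal) ≠ ⊥ ∧ -(v z.2 : EReal) ≠ ⊤ := by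
    rw [← EReal.coe_neg]
    exact ⟨EReal.coe_ne_bot _, EReal.coe_ne_top _⟩
  exact ContinuousAt.comp (g := fun p : EReal × EReal => p.1 + p.2)
    (f := fun z : M.Pt × M.Pt => (-c z.2 z.1, -(v z.2 : EReal)))
    (EReal.continuousAt_add (.inr h3.1) (.inr h3.2)) (h1.prodMk h2).continuousAt

theorem neg_cost_sub_eq_coe (hc : IsAdmissibleCost M c K) {x y : M.Pt} (hne : c x y ≠ ⊤) (s : ℝ) :
    -c x y - (s : EReal) = ((-(c x y).toReal - s : ℝ) : EReal) := by
  conv_lhs => rw [← EReal.coe_toReal hne (hc.ne_bot x y)]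
  push_cast
  rfl

section Compact

variable [CompactSpace M.Pt]

/-- By compactness the supremum in the `c`-transform is attained, where the cost is finite. -/
theorem exists_cTransform_eq (hc : IsAdmissibleCost M c K) {v : M.Pt → ℝ} (hv : Continuous v)
    {x₀ y : M.Pt} (hne : c x₀ y ≠ ⊤) :
    ∃ x, c x y ≠ ⊤ ∧ cTransform M c v y = ((-(c x y).toReal - v x : ℝ) : EReal) ∧
      ∀ x', c x' y ≠ ⊤ → -(c x' y).toReal - v x' ≤ -(c x y).toReal - v x := by
  have hcont : Continuous fun x => -c x y - (v x : EReal) :=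
    (continuous_neg_cost_sub hc hv).comp (Continuous.prodMk_right y)
  obtain ⟨x, -, hx⟩ := isCompact_univ.exists_isMaxOn ⟨x₀, mem_univ _⟩ hcont.continuousOn
  have hx' : ∀ x', -c x' y - (v x' : EReal) ≤ -c x y - (v x : EReal) := fun x' => hx (mem_univ x')
  have hxt : c x y ≠ ⊤ := by
    intro h
    have h1 := hx' x₀
    rw [h, neg_cost_sub_eq_coe hc hne] at h1
    simp at h1
    exact EReal.coe_ne_bot _ (by exact_mod_cast h1)
  refine ⟨x, hxt, ?_, fun x' hx't => ?_⟩
  · rw [← neg_cost_sub_eq_coe hc hxt]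
    exact le_antisymm (iSup_le hx') (le_iSup (fun x => -c x y - (v x : EReal)) x)
  · have := hx' x'
    rw [neg_cost_sub_eq_coe hc hxt, neg_cost_sub_eq_coe hc hx't] at this
    exact_mod_cast this

theorem le_toReal_cTransform (hc : IsAdmissibleCost M c K) {v : M.Pt → ℝ} (hv : Continuous v)
    {x y : M.Pt} (hne : c x y ≠ ⊤) : -(c x y).toReal - v x ≤ (cTransform M c v y).toReal := by
  obtain ⟨x', -, h2, h3⟩ := exists_cTransform_eq hc hv hne
  rw [h2, EReal.toReal_coe]
  exact h3 x hne

theorem continuous_toReal_cTransform (hc : IsAdmissibleCost M c K)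
    (hfin : ∀ y, ∃ x, c x y ≠ ⊤) {v : M.Pt → ℝ} (hv : Continuous v) :
    Continuous fun y => (cTransform M c v y).toReal := by
  have h1 : Continuous fun y => cTransform M c v y := by
    have h2 := IsCompact.continuous_sSup (f := fun y x : M.Pt => -c x y - (v x : EReal))
      (isCompact_univ (X := M.Pt)) (continuous_neg_cost_sub hc hv)
    simpa [cTransform, image_univ, sSup_range] using h2
  refine EReal.continuousOn_toReal.comp_continuous h1 fun y => ?_
  obtain ⟨x₀, hx₀⟩ := hfin y
  obtain ⟨x, -, h2, -⟩ := exists_cTransform_eq hc hv hx₀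
  rw [h2]
  simp only [mem_compl_iff, mem_insert_iff, mem_singleton_iff, EReal.coe_ne_bot, EReal.coe_ne_top,
    or_self, not_false_eq_true]

/-- For an invertible transport map, its inverse selects the unique maximizers in the
`c`-transform. -/
theorem toReal_cTransform_eq (hM : HasRegularCharts M) (hc : IsAdmissibleCost M c K) {a b : ℝ}
    {v : M.Pt → ℝ} (hv : IsCk M 2 v) (hev : EigenvaluesBetween M c K a b v) {X : M.Pt → M.Pt}
    (hTX : ∀ y, transportMap M c v (X y) = y) (hXT : ∀ x, X (transportMap M c v x) = x) (y : M.Pt) :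
    c (X y) y ≠ ⊤ ∧ (cTransform M c v y).toReal = -(c (X y) y).toReal - v (X y) := by
  have hne : c (X y) y ≠ ⊤ := by
    have := hc.ne_top _ _ (hev (X y)).1
    rwa [hTX] at this
  obtain ⟨x, h1, h2, h3⟩ := exists_cTransform_eq hc (hv.continuous hM) hne
  have h4 : X y = x := by
    rw [← hXT x, (isCriticalPair_iff hM hc hev).1 (isCriticalPair_of_forall_le hM hc hv h1 h3)]
  refine ⟨hne, ?_⟩
  rw [h2, h4, EReal.toReal_coe]

/-! ### First variation of the dual functional -/

variable [T2Space M.Pt] [BorelSpace M.Pt] [SecondCountableTopology M.Pt] [IsFiniteMeasure M.vol]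

theorem integrable_of_continuous {φ : M.Pt → ℝ} (hφ : Continuous φ) : Integrable φ M.vol := by
  rw [← integrableOn_univ]
  exact hφ.continuousOn.integrableOn_compact isCompact_univ

/-- The subgradient inequality for the dual functional, given a continuous selection `X` of maximizers
in the `c`-transform. -/
theorem dualJ_add_ge (hc : IsAdmissibleCost M c K) {f g v h : M.Pt → ℝ} (hf : Continuous f)
    (hg : Continuous g) (hg0 : ∀ y, 0 ≤ g y) (hv : Continuous v) (hh : Continuous h)
    {X : M.Pt → M.Pt} (hX : Continuous X)
    (hmax : ∀ y, c (X y) y ≠ ⊤ ∧ (cTransform M c v y).toReal = -(c (X y) y).toReal - v (X y)) :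
    dualJ M c f g v + (∫ x, h x * f x ∂M.vol - ∫ y, h (X y) * g y ∂M.vol) ≤
      dualJ M c f g fun x => v x + h x := by
  have hfin : ∀ y, ∃ x, c x y ≠ ⊤ := fun y => ⟨X y, (hmax y).1⟩
  have hvh : Continuous fun x => v x + h x := hv.add hh
  have h1 : ∫ x, (v x + h x) * f x ∂M.vol = ∫ x, v x * f x ∂M.vol + ∫ x, h x * f x ∂M.vol := by
    have i1 : Integrable (fun x => v x * f x) M.vol := integrable_of_continuous (hv.mul hf)
    have i2 : Integrable (fun x => h x * f x) M.vol := integrable_of_continuous (hh.mul hf)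
    rw [← integral_add i1 i2]
    simp [add_mul]
  have h2 : ∫ y, (cTransform M c v y).toReal * g y ∂M.vol - ∫ y, h (X y) * g y ∂M.vol ≤
      ∫ y, (cTransform M c (fun x => v x + h x) y).toReal * g y ∂M.vol := by
    have i1 : Integrable (fun y => (cTransform M c v y).toReal * g y) M.vol :=
      integrable_of_continuous ((continuous_toReal_cTransform hc hfin hv).mul hg)
    have i2 : Integrable (fun y => h (X y) * g y) M.vol :=
      integrable_of_continuous ((hh.comp hX).mul hg)
    rw [← integral_sub i1 i2]
    refine integral_mono (i1.sub i2) (integrable_of_continuous ((continuous_toReal_cTransform hc hfin hvh).mul hg)) fun y => ?_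
    have h3 := le_toReal_cTransform hc hvh (hmax y).1
    dsimp only
    rw [← sub_mul, (hmax y).2]
    exact mul_le_mul_of_nonneg_right (by linarith) (hg0 y)
  unfold dualJ
  linarith

/-- The first variation is the unique subgradient. -/
theorem integral_firstVariation_mul (hc : IsAdmissibleCost M c K) {f g v h j : M.Pt → ℝ}
    (hf : Continuous f) (hg : Continuous g) (hg0 : ∀ y, 0 ≤ g y) (hv : Continuous v)
    (hh : Continuous h) {X : M.Pt → M.Pt} (hX : Continuous X)
    (hmax : ∀ y, c (X y) y ≠ ⊤ ∧ (cTransform M c v y).toReal = -(c (X y) y).toReal - v (X y))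
    (hj : IsFirstVariation M (dualJ M c f g) v j) :
    ∫ x, j x * h x ∂M.vol = ∫ x, h x * f x ∂M.vol - ∫ y, h (X y) * g y ∂M.vol := by
  set D := ∫ x, h x * f x ∂M.vol - ∫ y, h (X y) * g y ∂M.vol with hD
  have h1 : ∀ ε : ℝ, dualJ M c f g v + ε * D ≤ dualJ M c f g fun x => v x + ε * h x := by
    intro ε
    have := dualJ_add_ge hc hf hg hg0 hv (h := fun x => ε * h x) (continuous_const.mul hh) hX hmax
    simp only [mul_assoc, integral_const_mul] at this
    rw [hD, mul_sub]
    exact this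
  have h2 := (hj.2 h hh).sub ((hasDerivAt_id (0 : ℝ)).mul_const D)
  have h3 : IsLocalMin
      ((fun ε : ℝ => dualJ M c f g fun x => v x + ε * h x) - fun ε => id ε * D) 0 := by
    refine Filter.Eventually.of_forall fun ε => ?_
    have := h1 ε
    simp
    linarith
  have h4 := h3.hasDerivAt_eq_zero h2
  linarith

end Compact

end

section

variable {n : ℕ}
variable {M : Manifold n} {c : M.Pt → M.Pt → EReal} {K : Set (M.Pt × M.Pt)}

/-! ### Change of variables for the transport map -/

section

variable {a b : ℝ} {v : M.Pt → ℝ}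

theorem isCk_const (k : ℕ) (s : ℝ) : IsCk M k fun _ => s := fun _ => contDiffAt_const

theorem continuous_transportMap (hM : HasRegularCharts M) (hc : IsAdmissibleCost M c K)
    (ha : 0 ≤ a) (hv : IsCk M 2 v) (hev : EigenvaluesBetween M c K a b v) :
    Continuous (transportMap M c v) := by
  have h1 := continuous_transportMap_segment (h := fun _ => 0) hM hc ha hv (isCk_const 2 0)
    (by simpa using hev)
  simp only [mul_zero, add_zero] at h1
  exact h1.comp (Continuous.prodMk_right (0 : I))

/-- The transport map in charts is strictly differentiable with Jacobian `|det ω| / |det D²ₓᵧ c|`. -/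
theorem exists_strictDeriv_transportMap (hM : HasRegularCharts M) (hc : IsAdmissibleCost M c K)
    (ha : 0 ≤ a) (hv : IsCk M 2 v) (hev : EigenvaluesBetween M c K a b v) (x : M.Pt) :
    ∃ (Θ : E n → E n) (L : E n →L[ℝ] E n), HasStrictFDerivAt Θ L 0 ∧
      (∀ᶠ ξ in 𝓝 0, transportMap M c v (M.coord x ξ) =
        M.coord (transportMap M c v x) (Θ ξ)) ∧
      |L.det| * |formDet (hessXY M c x (transportMap M c v x))| = |formDet (omega M c v x)| := by
  obtain ⟨Ξ, Θ, Ξ', Θ', h1, h2, h3, h4, h5, h6, h7⟩ :=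
    exists_local_transportMap (h := fun _ => 0) hM hc ha hv (isCk_const 2 0)
      (by simpa using hev) 0 x
  simp only [mul_zero, add_zero] at h5 h6 h7
  rw [Icc.coe_zero] at h1 h2 h3 h4
  have hpair : Continuous fun ξ : E n => ((0 : ℝ), ξ) := by fun_prop
  refine ⟨fun ξ => Θ (0, ξ), Θ'.comp (ContinuousLinearMap.inr ℝ ℝ (E n)), ?_, ?_, ?_⟩
  · exact HasStrictFDerivAt.comp (g := Θ) (f := fun ξ : E n => ((0 : ℝ), ξ)) (0 : E n) h2
      (ContinuousLinearMap.inr ℝ ℝ (E n)).hasStrictFDerivAt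
  · have c1 : Tendsto (fun ξ : E n => Θ (0, ξ)) (𝓝 0) (𝓝 0) := by
      have h8 := h2.continuousAt.tendsto.comp (hpair.tendsto 0)
      rwa [h4] at h8
    have c2 : Tendsto (fun ξ : E n => ((0 : I), ξ, Θ (0, ξ))) (𝓝 0) (𝓝 (0, 0, 0)) :=
      tendsto_const_nhds.prodMk_nhds (tendsto_id.prodMk_nhds c1)
    filter_upwards [c2.eventually h5] with ξ hξ
    exact hξ.2.2 (by simp)
  · exact abs_det_mul_abs_formDet fun ξ a => h7 ξ a

/-- Change of variables for the transport map, for a strict inequality of the integrands. -/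
theorem lintegral_image_transportMap_le [CompactSpace M.Pt] [BorelSpace M.Pt]
    (hM : HasRegularCharts M) (hc : IsAdmissibleCost M c K) (ha : 0 ≤ a) (hv : IsCk M 2 v)
    (hev : EigenvaluesBetween M c K a b v) {p q : M.Pt → ℝ} (hp : Continuous p)
    (hq : Continuous q) (hq0 : ∀ y, 0 ≤ q y)
    (hlt : ∀ x, q (transportMap M c v x) * |formDet (omega M c v x)| <
      p x * |formDet (hessXY M c x (transportMap M c v x))|)
    {B : Set M.Pt} (hB : MeasurableSet B) :
    ∫⁻ y in transportMap M c v '' B, ENNReal.ofReal (q y) ∂M.vol ≤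
      ∫⁻ x in B, ENNReal.ofReal (p x) ∂M.vol := by
  refine lintegral_image_le_of_local (fun x => ?_) hB
  obtain ⟨Θ, L, h1, h2, h3⟩ := exists_strictDeriv_transportMap hM hc ha hv hev x
  refine exists_nhds_lintegral_image_le hM
    (continuous_transportMap hM hc ha hv hev).continuousAt h1 h2 hp hq hq0 ?_
  have h4 := hlt x
  rw [← h3, ← mul_assoc] at h4
  exact lt_of_mul_lt_mul_right h4 (abs_nonneg _)

theorem omega_symm (hM : HasRegularCharts M) (hc : IsAdmissibleCost M c K) (hv : IsCk M 2 v)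
    (hev : EigenvaluesBetween M c K a b v) (x : M.Pt) (ξ η : E n) :
    omega M c v x ξ η = omega M c v x η ξ := by
  have hF := hc.contDiffAt _ _ (hev x).1
  have h1 : hess M v x ξ η = hess M v x η ξ := ((hv x).isSymmSndFDerivAt (by simp)).eq _ _
  have h2 := (hF.isSymmSndFDerivAt (by simp; norm_num)).eq (ξ, (0 : E n)) (η, (0 : E n))
  simp only [omega, _root_.add_apply, h1, hessXX_apply hM hF]
  exact congrArg _ h2

theorem abs_formDet_omega_le (hM : HasRegularCharts M) (hc : IsAdmissibleCost M c K)
    (ha : 0 ≤ a) (hv : IsCk M 2 v) (hev : EigenvaluesBetween M c K a b v) (x : M.Pt) :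
    |formDet (omega M c v x)| ≤ n.factorial * b ^ n :=
  abs_formDet_le (omega_symm hM hc hv hev x) fun ξ hξ =>
    ⟨omega_pos ha hev x ξ hξ, ((hev x).2.2 ξ hξ).2⟩

end

variable [CompactSpace M.Pt] [T2Space M.Pt] [BorelSpace M.Pt] [SecondCountableTopology M.Pt]
  [IsFiniteMeasure M.vol]

/-- The inverse transport maps push the volume forward to a measure with density at most `C`, uniformly
over all potentials whose Hessians `ω` are bounded by `b`. -/
theorem exists_integral_comp_inverse_le (hM : HasRegularCharts M) (hc : IsAdmissibleCost M c K)
    (b : ℝ) : ∃ C > (0 : ℝ), ∀ (a : ℝ) (v : M.Pt → ℝ), 0 ≤ a → IsCk M 2 v →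
      EigenvaluesBetween M c K a b v → ∀ X : M.Pt → M.Pt, Continuous X →
      (∀ y, transportMap M c v (X y) = y) → (∀ x, X (transportMap M c v x) = x) →
      ∀ ψ : M.Pt → ℝ, Continuous ψ → (∀ x, 0 ≤ ψ x) →
        ∫ y, ψ (X y) ∂M.vol ≤ C * ∫ x, ψ x ∂M.vol := by
  obtain ⟨m, hm, hK⟩ := exists_le_abs_formDet_hessXY hM hc
  set D : ℝ := n.factorial * |b| ^ n with hD
  have hD0 : 0 ≤ D := by positivity
  set C := (D + 1) / m with hC
  have hC0 : 0 < C := by positivity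
  refine ⟨C, hC0, fun a v ha hv hev X hX hTX hXT ψ hψ hψ0 => ?_⟩
  have himg : ∀ B, X ⁻¹' B = transportMap M c v '' B := by
    intro B
    ext y
    exact ⟨fun hy => ⟨X y, hy, hTX y⟩, by rintro ⟨x, hx, rfl⟩; rwa [mem_preimage, hXT]⟩
  have hle : M.vol.map X ≤ ENNReal.ofReal C • M.vol := by
    refine Measure.le_iff.2 fun B hB => ?_
    rw [Measure.map_apply hX.measurable hB, himg]
    have h1 := lintegral_image_transportMap_le hM hc ha hv hev (p := fun _ => C)
      (q := fun _ => 1) continuous_const continuous_const (fun _ => zero_le_one) (fun x => ?_) hB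
    · simpa using h1
    · have h2 := abs_formDet_omega_le hM hc ha hv hev x
      have h3 := hK _ (hev x).1
      have h4 : (n.factorial : ℝ) * b ^ n ≤ D := by
        rw [hD, ← abs_pow]
        gcongr
        exact le_abs_self _
      calc 1 * |formDet (omega M c v x)| < D + 1 := by linarith
        _ = C * m := by rw [hC, div_mul_cancel₀ _ hm.ne']
        _ ≤ _ := by gcongr
  calc ∫ y, ψ (X y) ∂M.vol = ∫ x, ψ x ∂(M.vol.map X) :=
        (integral_map hX.aemeasurable hψ.aestronglyMeasurable).symm
    _ ≤ ∫ x, ψ x ∂(ENNReal.ofReal C • M.vol) :=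
        integral_mono_measure hle (Eventually.of_forall hψ0)
          ((integrable_of_continuous hψ).smul_measure ENNReal.ofReal_ne_top)
    _ = C * ∫ x, ψ x ∂M.vol := by
        rw [integral_smul_measure, ENNReal.toReal_ofReal hC0.le, smul_eq_mul]

/-! ### The Monge–Ampère equation -/

theorem IsCkHolder.isCk {M : Manifold n} {k : ℕ} {α : ℝ≥0} {u : M.Pt → ℝ}
    (hu : IsCkHolder M k α u) : IsCk M k u := by
  intro x
  obtain ⟨ρ, hρ, C, h, -⟩ := hu x
  exact h.contDiffAt (Metric.ball_mem_nhds _ hρ)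

section

variable {a b : ℝ} {f g u : M.Pt → ℝ}

/-- The strict inequality required in `lintegral_image_transportMap_le` holds for `(1 + ε) f` in place
of `f`. -/
theorem lintegral_image_le_of_solvesMongeAmpere (hM : HasRegularCharts M)
    (hc : IsAdmissibleCost M c K) (ha : 0 ≤ a) (hu : IsCk M 2 u)
    (hev : EigenvaluesBetween M c K a b u) (hf : Continuous f) (hg : Continuous g)
    (hf0 : ∀ x, 0 < f x) (hg0 : ∀ y, 0 ≤ g y) (hMA : SolvesMongeAmpere M c f g u)
    {B : Set M.Pt} (hB : MeasurableSet B) :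
    ∫⁻ y in transportMap M c u '' B, ENNReal.ofReal (g y) ∂M.vol ≤
      ∫⁻ x in B, ENNReal.ofReal (f x) ∂M.vol := by
  set J := ∫⁻ x in B, ENNReal.ofReal (f x) ∂M.vol
  have h1 : ∀ ε > (0 : ℝ), ∫⁻ y in transportMap M c u '' B, ENNReal.ofReal (g y) ∂M.vol ≤
      ENNReal.ofReal (1 + ε) * J := by
    intro ε hε
    have h2 := lintegral_image_transportMap_le hM hc ha hu hev (p := fun x => (1 + ε) * f x)
      (q := g) (continuous_const.mul hf) hg hg0 (fun x => ?_) hB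
    · rw [← lintegral_const_mul _ hf.measurable.ennreal_ofReal]
      simpa only [ENNReal.ofReal_mul (show 0 ≤ 1 + ε by positivity)] using h2
    · have h3 : f x - g (transportMap M c u x) /
          |formDet (hessXY M c x (transportMap M c u x))| * formDet (omega M c u x) = 0 := hMA x
      have h4 : 0 < |formDet (hessXY M c x (transportMap M c u x))| :=
        abs_pos.2 (hc.nondegenerate _ _ (hev x).1)
      have h5 : g (transportMap M c u x) * formDet (omega M c u x) =
          f x * |formDet (hessXY M c x (transportMap M c u x))| := by
        field_simp at h3
        linarith
      have h6 : 0 < f x * |formDet (hessXY M c x (transportMap M c u x))| := mul_pos (hf0 x) h4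
      have h7 : g (transportMap M c u x) * |formDet (omega M c u x)| =
          f x * |formDet (hessXY M c x (transportMap M c u x))| := by
        rw [← abs_of_nonneg (hg0 (transportMap M c u x)), ← abs_mul, h5, abs_of_pos h6]
      rw [h7]
      nlinarith
  have h8 : Tendsto (fun ε : ℝ => ENNReal.ofReal (1 + ε) * J) (𝓝[>] 0) (𝓝 J) := by
    have h9 : Tendsto (fun ε : ℝ => ENNReal.ofReal (1 + ε)) (𝓝[>] 0) (𝓝 1) := by
      have : Tendsto (fun ε : ℝ => ENNReal.ofReal (1 + ε)) (𝓝 0) (𝓝 1) :=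
        Continuous.tendsto' (ENNReal.continuous_ofReal.comp (by fun_prop)) _ _ (by simp)
      exact this.mono_left nhdsWithin_le_nhds
    simpa using ENNReal.Tendsto.mul_const (b := J) h9 (.inl one_ne_zero)
  exact ge_of_tendsto h8 (eventually_mem_nhdsWithin.mono fun ε hε => h1 ε hε)

theorem lintegral_ofReal_eq_one (hf : Continuous f) (hf0 : ∀ x, 0 ≤ f x)
    (h1 : ∫ x, f x ∂M.vol = 1) : ∫⁻ x, ENNReal.ofReal (f x) ∂M.vol = 1 := by
  rw [← ofReal_integral_eq_lintegral_ofReal (integrable_of_continuous hf)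
    (Eventually.of_forall hf0), h1, ENNReal.ofReal_one]

/-- If two points had the same image, then the image of the complement of a small neighbourhood `W`
of the first would still be everything, and the mass of `g` would be at most that of `f` outside
`W`. -/
theorem bijective_transportMap_of_solvesMongeAmpere [ConnectedSpace M.Pt] [M.vol.IsOpenPosMeasure]
    (hM : HasRegularCharts M) (hc : IsAdmissibleCost M c K) (ha : 0 ≤ a) (hu : IsCk M 2 u)
    (hev : EigenvaluesBetween M c K a b u) (hf : Continuous f) (hg : Continuous g)
    (hf0 : ∀ x, 0 < f x) (hg0 : ∀ y, 0 ≤ g y) (hf1 : ∫ x, f x ∂M.vol = 1)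
    (hg1 : ∫ x, g x ∂M.vol = 1) (hMA : SolvesMongeAmpere M c f g u) :
    Function.Bijective (transportMap M c u) := by
  have hsurj := surjective_transportMap hM hc ha hu hev
  have hcont := continuous_transportMap hM hc ha hu hev
  refine ⟨fun x₁ x₂ hx => ?_, hsurj⟩
  by_contra hne
  obtain ⟨U₁, U₂, hU₁, hU₂, hx₁, hx₂, hdisj⟩ := t2_separation hne
  have h1 := transportMap_segment_locally_surjective (h := fun _ => 0) hM hc ha hu
    (isCk_const 2 0) (by simpa using hev) 0 x₂ (hU₂.mem_nhds hx₂)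
  simp only [mul_zero, add_zero] at h1
  have h2 : Tendsto (fun x => ((0 : I), transportMap M c u x)) (𝓝 x₁)
      (𝓝 (0, transportMap M c u x₂)) := by
    rw [← hx]
    exact ((Continuous.prodMk_right (0 : I)).comp hcont).tendsto x₁
  obtain ⟨W, hW, hWo, hxW⟩ := mem_nhds_iff.1 (inter_mem (hU₁.mem_nhds hx₁) (h2.eventually h1))
  have himg : transportMap M c u '' Wᶜ = univ := by
    refine eq_univ_of_forall fun y => ?_
    obtain ⟨x, rfl⟩ := hsurj y
    by_cases hxW : x ∈ W
    · obtain ⟨x', hx', hTx'⟩ := (hW hxW).2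
      exact ⟨x', fun h => disjoint_left.1 hdisj (hW h).1 hx', hTx'⟩
    · exact ⟨x, hxW, rfl⟩
  have h3 := lintegral_image_le_of_solvesMongeAmpere hM hc ha hu hev hf hg hf0 hg0 hMA
    hWo.measurableSet.compl
  have h4 : ∫⁻ x in W, ENNReal.ofReal (f x) ∂M.vol + ∫⁻ x in Wᶜ, ENNReal.ofReal (f x) ∂M.vol = 1 := by
    rw [lintegral_add_compl _ hWo.measurableSet, lintegral_ofReal_eq_one hf (fun x => (hf0 x).le) hf1]
  rw [himg, Measure.restrict_univ, lintegral_ofReal_eq_one hg hg0 hg1] at h3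
  have h5 : ∫⁻ x in W, ENNReal.ofReal (f x) ∂M.vol = 0 := by
    have h6 : ∫⁻ x in W, ENNReal.ofReal (f x) ∂M.vol + 1 ≤ 0 + 1 := by
      rw [zero_add]
      exact (add_le_add le_rfl h3).trans h4.le
    exact le_antisymm ((ENNReal.add_le_add_iff_right ENNReal.one_ne_top).1 h6) bot_le
  have h7 : 0 < ∫⁻ x in W, ENNReal.ofReal (f x) ∂M.vol := by
    refine (setLIntegral_pos_iff hf.measurable.ennreal_ofReal).2 ?_
    have : Function.support (fun x => ENNReal.ofReal (f x)) = univ :=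
      eq_univ_of_forall fun x => (ENNReal.ofReal_pos.2 (hf0 x)).ne'
    rw [this, univ_inter]
    exact hWo.measure_pos M.vol ⟨x₁, hxW⟩
  exact h7.ne' h5

/-- The transport map of a solution pushes `f` forward to `g`. -/
theorem integral_comp_inverse_of_solvesMongeAmpere
    (hM : HasRegularCharts M) (hc : IsAdmissibleCost M c K) (ha : 0 ≤ a) (hu : IsCk M 2 u)
    (hev : EigenvaluesBetween M c K a b u) (hf : Continuous f) (hg : Continuous g)
    (hf0 : ∀ x, 0 < f x) (hg0 : ∀ y, 0 ≤ g y) (hf1 : ∫ x, f x ∂M.vol = 1)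
    (hg1 : ∫ x, g x ∂M.vol = 1) (hMA : SolvesMongeAmpere M c f g u)
    {X : M.Pt → M.Pt} (hX : Continuous X) (hTX : ∀ y, transportMap M c u (X y) = y)
    (hXT : ∀ x, X (transportMap M c u x) = x) {h : M.Pt → ℝ} (hh : Continuous h) :
    ∫ y, h (X y) * g y ∂M.vol = ∫ x, h x * f x ∂M.vol := by
  have himg : ∀ B, X ⁻¹' B = transportMap M c u '' B := by
    intro B
    ext y
    exact ⟨fun hy => ⟨X y, hy, hTX y⟩, by rintro ⟨x, hx, rfl⟩; rwa [mem_preimage, hXT]⟩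
  set μ := M.vol.withDensity fun x => ENNReal.ofReal (f x) with hμ
  set ν := M.vol.withDensity fun y => ENNReal.ofReal (g y) with hν
  have hμ1 : μ univ = 1 := by
    rw [hμ, withDensity_apply _ .univ, Measure.restrict_univ,
      lintegral_ofReal_eq_one hf (fun x => (hf0 x).le) hf1]
  have hν1 : ν univ = 1 := by
    rw [hν, withDensity_apply _ .univ, Measure.restrict_univ, lintegral_ofReal_eq_one hg hg0 hg1]
  have : IsProbabilityMeasure μ := ⟨hμ1⟩
  have hle : ν.map X ≤ μ := by
    refine Measure.le_iff.2 fun B hB => ?_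
    rw [Measure.map_apply hX.measurable hB, hμ, hν, withDensity_apply _ hB,
      withDensity_apply _ (hX.measurable hB), himg]
    exact lintegral_image_le_of_solvesMongeAmpere hM hc ha hu hev hf hg hf0 hg0 hMA hB
  have : IsFiniteMeasure (ν.map X) := isFiniteMeasure_of_le μ hle
  have heq : ν.map X = μ := by
    refine Measure.eq_of_le_of_measure_univ_eq hle ?_
    rw [Measure.map_apply hX.measurable .univ, preimage_univ, hν1, hμ1]
  have key : ∀ (k φ : M.Pt → ℝ), Continuous k → (∀ x, 0 ≤ k x) →
      ∫ x, φ x ∂(M.vol.withDensity fun x => ENNReal.ofReal (k x)) = ∫ x, φ x * k x ∂M.vol := by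
    intro k φ hk hk0
    rw [integral_withDensity_eq_integral_toReal_smul hk.measurable.ennreal_ofReal
      (Eventually.of_forall fun x => ENNReal.ofReal_lt_top)]
    simp [ENNReal.toReal_ofReal, hk0, mul_comm]
  rw [← key g (fun y => h (X y)) hg hg0, ← key f h hf fun x => (hf0 x).le, ← hμ, ← hν, ← heq,
    integral_map hX.aemeasurable hh.aestronglyMeasurable]

end

end

section

variable {n : ℕ}
variable {M : Manifold n} {c : M.Pt → M.Pt → EReal} {K : Set (M.Pt × M.Pt)}

/-! ### Motion of the maximizer along a segment -/

theorem fderiv_apply_eq_inner_grad (h : M.Pt → ℝ) (x : M.Pt) (ξ : E n) :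
    fderiv ℝ (fun ξ => h (M.coord x ξ)) 0 ξ = inner ℝ (grad M h x) ξ := by
  unfold grad gradient
  rw [InnerProductSpace.toDual_symm_apply]

section Segment

variable {lam : ℝ} {v h : M.Pt → ℝ} {X : I → M.Pt → M.Pt}

/-- For fixed `y` the maximizer `X_t(y)` has velocity `p` with `ω p = -∇h`, so `-h(X_t(y))` has the
derivative `ω(p, p)`, and `1/λ < ω` bounds `|p|` by `λ |∇h|`. -/
theorem exists_hasDerivWithinAt_comp_inverse (hM : HasRegularCharts M)
    (hc : IsAdmissibleCost M c K) (hlam : 0 < lam) (hv : IsCk M 2 v) (hh : IsCk M 2 h)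
    (hseg : ∀ t : I, EigenvaluesBetween M c K (1 / lam) lam fun x => v x + t * h x)
    (hTX : ∀ (t : I) y, transportMap M c (fun x => v x + t * h x) (X t y) = y)
    (hXT : ∀ (t : I) x, X t (transportMap M c (fun x => v x + t * h x) x) = x)
    (t₀ : I) (y : M.Pt) :
    ∃ d : ℝ, HasDerivWithinAt (fun t => -h (X (projIcc 0 1 zero_le_one t) y)) d (Icc 0 1) t₀ ∧
      0 ≤ d ∧ d ≤ lam * ‖grad M h (X t₀ y)‖ ^ 2 ∧ (d = 0 → grad M h (X t₀ y) = 0) := by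
  have ha : 0 ≤ 1 / lam := by positivity
  set x := X t₀ y with hx
  obtain ⟨Ξ, Θ, Ξ', Θ', h1, h2, h3, h4, h5, h6, h7⟩ :=
    exists_local_transportMap hM hc ha hv hh hseg t₀ x
  rw [hx, hTX, ← hx] at h5
  set p := Ξ' (1, 0) with hp
  set ω := omega M c (fun x => v x + t₀ * h x) x with hω
  have hpair : HasDerivAt (fun t : ℝ => (t, (0 : E n))) (1, 0) t₀ :=
    (hasDerivAt_id _).prodMk (hasDerivAt_const _ _)
  have hpath : HasDerivAt (fun t : ℝ => Ξ (t, 0)) p t₀ :=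
    HasFDerivAt.comp_hasDerivAt (l := Ξ) (f := fun t : ℝ => (t, (0 : E n))) (t₀ : ℝ)
      h1.hasFDerivAt hpair
  have hH : HasFDerivAt (fun ξ => h (M.coord x ξ)) (fderiv ℝ (fun ξ => h (M.coord x ξ)) 0)
      (Ξ ((t₀ : ℝ), 0)) := by
    rw [h3]
    exact ((hh x).differentiableAt (by norm_num)).hasFDerivAt
  have hcomp : HasDerivAt (fun t : ℝ => -h (M.coord x (Ξ (t, 0)))) (ω p p) t₀ := by
    rw [h6 p]
    exact (hH.comp_hasDerivAt (t₀ : ℝ) hpath).neg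
  have hev : ∀ᶠ t in 𝓝[Icc 0 1] (t₀ : ℝ), X (projIcc 0 1 zero_le_one t) y =
      M.coord x (Ξ (t, 0)) := by
    rw [nhdsWithin_eq_map_subtype_coe t₀.2, eventually_map]
    have c1 : Tendsto (fun t : I => (t, Ξ ((t : ℝ), 0), (0 : E n))) (𝓝 t₀) (𝓝 (t₀, 0, 0)) := by
      refine tendsto_id.prodMk_nhds (Tendsto.prodMk_nhds ?_ tendsto_const_nhds)
      have h8 := hpath.continuousAt.tendsto.comp (continuous_subtype_val.tendsto t₀)
      rwa [h3] at h8
    have h9 := c1.eventually h5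
    filter_upwards [h9] with t ht
    have h8 := ht.1.2 rfl
    rw [hM.coord_zero] at h8
    rw [projIcc_val, ← hXT t (M.coord x (Ξ ((t : ℝ), 0))), h8]
  have hωp : ω p p = -inner ℝ (grad M h x) p := by
    rw [h6 p, fderiv_apply_eq_inner_grad]
  have hle : 1 / lam * ‖p‖ ^ 2 ≤ ω p p := by
    rcases eq_or_ne p 0 with h0 | h0
    · simp [h0]
    · exact ((hseg t₀ x).2.2 p h0).1.le
  have hcs : ω p p ≤ ‖grad M h x‖ * ‖p‖ := by
    rw [hωp, ← inner_neg_right]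
    simpa using real_inner_le_norm (grad M h x) (-p)
  refine ⟨ω p p, ?_, ?_, ?_, ?_⟩
  · refine (hcomp.hasDerivWithinAt).congr_of_eventuallyEq ?_ ?_
    · filter_upwards [hev] with t ht
      rw [ht]
    · rw [hev.self_of_nhdsWithin t₀.2]
  · exact le_trans (by positivity) hle
  · have h8 : ‖p‖ ≤ lam * ‖grad M h x‖ := by
      rcases eq_or_ne p 0 with h0 | h0
      · rw [h0, norm_zero]; positivity
      · have h9 : 0 < ‖p‖ := norm_pos_iff.2 h0
        have h10 : ‖p‖ ^ 2 ≤ lam * (‖grad M h x‖ * ‖p‖) := by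
          have := mul_le_mul_of_nonneg_left (hle.trans hcs) hlam.le
          rwa [← mul_assoc, mul_one_div_cancel hlam.ne', one_mul] at this
        nlinarith
    calc ω p p ≤ ‖grad M h x‖ * ‖p‖ := hcs
      _ ≤ ‖grad M h x‖ * (lam * ‖grad M h x‖) := by gcongr
      _ = lam * ‖grad M h x‖ ^ 2 := by ring
  · intro h0
    have hp0 : p = 0 := by
      by_contra hne
      have := ((hseg t₀ x).2.2 p hne).1
      have h9 : 0 < ‖p‖ := norm_pos_iff.2 hne
      rw [← hω, h0] at this
      exact absurd this (not_lt.2 (by positivity))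
    refine ext_inner_right ℝ fun w => ?_
    have h8 := h6 w
    rw [hp0, map_zero, _root_.zero_apply] at h8
    rw [← fderiv_apply_eq_inner_grad, inner_zero_left]
    linarith

/-- The integrated bound on the derivative of `t ↦ -h(X_t(y))`. The derivative is not known to be
integrable, but its continuous majorant `λ |∇h(X_t(y))|²` suffices. -/
theorem comp_inverse_sub_le_integral [CompactSpace M.Pt] [T2Space M.Pt] (hM : HasRegularCharts M)
    (hc : IsAdmissibleCost M c K) (hlam : 0 < lam) (hv : IsCk M 2 v) (hh : IsCk M 2 h)
    (hseg : ∀ t : I, EigenvaluesBetween M c K (1 / lam) lam fun x => v x + t * h x)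
    (hX : Continuous fun q : I × M.Pt => X q.1 q.2)
    (hTX : ∀ (t : I) y, transportMap M c (fun x => v x + t * h x) (X t y) = y)
    (hXT : ∀ (t : I) x, X t (transportMap M c (fun x => v x + t * h x) x) = x) (y : M.Pt) :
    h (X 0 y) - h (X 1 y) ≤
      ∫ t in (0 : ℝ)..1, lam * ‖grad M h (X (projIcc 0 1 zero_le_one t) y)‖ ^ 2 := by
  have hpath : Continuous fun t : ℝ => X (projIcc 0 1 zero_le_one t) y :=
    hX.comp ((continuous_projIcc (h := zero_le_one)).prodMk continuous_const)
  choose! d hd using fun t₀ : I =>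
    exists_hasDerivWithinAt_comp_inverse hM hc hlam hv hh hseg hTX hXT t₀ y
  have h1 := intervalIntegral.sub_le_integral_of_hasDeriv_right_of_le
    (g := fun t : ℝ => -h (X (projIcc 0 1 zero_le_one t) y))
    (g' := fun t => d (projIcc 0 1 zero_le_one t))
    (φ := fun t => lam * ‖grad M h (X (projIcc 0 1 zero_le_one t) y)‖ ^ 2)
    (zero_le_one (α := ℝ)) ((hh.continuous hM).comp hpath).neg.continuousOn
    (fun t ht => by
      have h2 := (hd ⟨t, Ioo_subset_Icc_self ht⟩).1
      rw [← projIcc_of_mem zero_le_one (Ioo_subset_Icc_self ht)] at h2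
      rw [projIcc_of_mem zero_le_one (Ioo_subset_Icc_self ht)] at h2
      rw [projIcc_of_mem zero_le_one (Ioo_subset_Icc_self ht)]
      exact (h2.hasDerivAt (Icc_mem_nhds ht.1 ht.2)).hasDerivWithinAt)
    ((continuous_const.mul (((hM.continuous_norm_grad h hh).comp hpath).pow 2)).continuousOn.integrableOn_compact
      isCompact_Icc)
    (fun t ht => (hd _).2.2.1)
  rw [projIcc_left, projIcc_right] at h1
  have h3 : -h (X 1 y) - -h (X 0 y) ≤ _ := h1
  linarith

/-- Monotonicity of the inverse transport maps along a segment. A nonnegative derivative with vanishing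
integral has a constant primitive, so the derivative at `t = 0` vanishes. -/
theorem comp_inverse_monotone (hM : HasRegularCharts M)
    (hc : IsAdmissibleCost M c K) (hlam : 0 < lam) (hv : IsCk M 2 v) (hh : IsCk M 2 h)
    (hseg : ∀ t : I, EigenvaluesBetween M c K (1 / lam) lam fun x => v x + t * h x)
    (hTX : ∀ (t : I) y, transportMap M c (fun x => v x + t * h x) (X t y) = y)
    (hXT : ∀ (t : I) x, X t (transportMap M c (fun x => v x + t * h x) x) = x) (y : M.Pt) :
    h (X 1 y) ≤ h (X 0 y) ∧ (h (X 1 y) = h (X 0 y) → grad M h (X 0 y) = 0) := by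
  choose! d hd using fun t₀ : I =>
    exists_hasDerivWithinAt_comp_inverse hM hc hlam hv hh hseg hTX hXT t₀ y
  set a := fun t : ℝ => -h (X (projIcc 0 1 zero_le_one t) y) with ha
  have hmono : MonotoneOn a (Icc 0 1) := by
    refine monotoneOn_of_deriv_nonneg (convex_Icc 0 1)
      (fun t ht => (hd ⟨t, ht⟩).1.continuousWithinAt) (fun t ht => ?_) (fun t ht => ?_)
    all_goals
      rw [interior_Icc] at ht
      have h1 := (hd ⟨t, Ioo_subset_Icc_self ht⟩).1.hasDerivAt (Icc_mem_nhds ht.1 ht.2)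
    · exact h1.differentiableAt.differentiableWithinAt
    · rw [h1.deriv]
      exact (hd _).2.1
  have h0 : a 0 = -h (X 0 y) := by simp only [ha, projIcc_left]; rfl
  have h1 : a 1 = -h (X 1 y) := by simp only [ha, projIcc_right]; rfl
  have m0 : (0 : ℝ) ∈ Icc (0 : ℝ) 1 := ⟨le_rfl, zero_le_one⟩
  have m1 : (1 : ℝ) ∈ Icc (0 : ℝ) 1 := ⟨zero_le_one, le_rfl⟩
  refine ⟨?_, fun heq => ?_⟩
  · have := hmono m0 m1 zero_le_one
    linarith
  · refine (hd 0).2.2.2 ?_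
    have hconst : ∀ t ∈ Icc (0 : ℝ) 1, a t = a 0 := by
      intro t ht
      have h2 := hmono m0 ht ht.1
      have h3 := hmono ht m1 ht.2
      linarith
    have h2 : HasDerivWithinAt a 0 (Icc 0 1) 0 :=
      (hasDerivWithinAt_const (0 : ℝ) (Icc 0 1) (a 0)).congr hconst rfl
    exact (uniqueDiffOn_Icc (zero_lt_one (α := ℝ)) 0 m0).eq_deriv _ (hd 0).1 h2

end Segment

/-! ### Convexity of the neighbourhood -/

theorem bddAbove_of_continuous [CompactSpace M.Pt] {φ : M.Pt → ℝ} (hφ : Continuous φ) :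
    BddAbove (range φ) := (isCompact_range hφ).bddAbove

theorem c2Norm_convex [CompactSpace M.Pt] [Nonempty M.Pt] (hM : HasRegularCharts M) {p q : M.Pt → ℝ}
    (hp : IsCk M 2 p) (hq : IsCk M 2 q) {t : ℝ} (ht0 : 0 ≤ t) (ht1 : t ≤ 1) :
    c2Norm M (fun x => (1 - t) * p x + t * q x) ≤ (1 - t) * c2Norm M p + t * c2Norm M q := by
  have ht1' : 0 ≤ 1 - t := by linarith
  have hp' : IsCk M 2 fun x => (1 - t) * p x := hp.const_mul _
  have b0 : ∀ w : M.Pt → ℝ, IsCk M 2 w → BddAbove (range fun x => |w x|) := fun w hw =>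
    bddAbove_of_continuous (hw.continuous hM).abs
  have b1 : ∀ w : M.Pt → ℝ, IsCk M 2 w → BddAbove (range fun x => ‖grad M w x‖) := fun w hw =>
    bddAbove_of_continuous (hM.continuous_norm_grad w hw)
  have b2 : ∀ w : M.Pt → ℝ, IsCk M 2 w → BddAbove (range fun x => ‖hess M w x‖) := fun w hw => by
    obtain ⟨C, hC⟩ := hM.norm_hess_le w hw
    exact ⟨C, by rintro _ ⟨x, rfl⟩; exact hC x⟩
  have g0 : ∀ x, grad M (fun x => (1 - t) * p x + t * q x) x =
      (1 - t) • grad M p x + t • grad M q x := by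
    intro x
    have h1 := grad_add_mul (isCk_const 2 0) hp (1 - t) x
    have h2 := grad_add_mul (isCk_const 2 0) (isCk_const (M := M) 2 0) 0 x
    simp only [zero_add, mul_zero, zero_smul, add_zero] at h1 h2
    have h3 : grad M (fun _ : M.Pt => (0 : ℝ)) x = 0 := by
      unfold grad gradient
      simp
    rw [grad_add_mul hp' hq, h1, h3, zero_add]
  have s0 : ∀ x, hess M (fun x => (1 - t) * p x + t * q x) x =
      (1 - t) • hess M p x + t • hess M q x := by
    intro x
    have h1 := hess_add_mul (isCk_const 2 0) hp (1 - t) x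
    have h3 : hess M (fun _ : M.Pt => (0 : ℝ)) x = 0 := by
      unfold hess
      simp
    simp only [zero_add] at h1
    rw [hess_add_mul hp' hq, h1, h3, zero_add]
  have i0 : (⨆ x, |(1 - t) * p x + t * q x|) ≤ (1 - t) * (⨆ x, |p x|) + t * ⨆ x, |q x| := by
    refine ciSup_le fun x => ?_
    calc |(1 - t) * p x + t * q x| ≤ |(1 - t) * p x| + |t * q x| := abs_add_le _ _
      _ = (1 - t) * |p x| + t * |q x| := by
          rw [abs_mul, abs_mul, abs_of_nonneg ht0, abs_of_nonneg ht1']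
      _ ≤ _ := by
          gcongr
          · exact le_ciSup (b0 p hp) x
          · exact le_ciSup (b0 q hq) x
  have i1 : (⨆ x, ‖grad M (fun x => (1 - t) * p x + t * q x) x‖) ≤
      (1 - t) * (⨆ x, ‖grad M p x‖) + t * ⨆ x, ‖grad M q x‖ := by
    refine ciSup_le fun x => ?_
    rw [g0]
    refine (norm_add_le _ _).trans ?_
    rw [norm_smul, norm_smul, Real.norm_of_nonneg ht0, Real.norm_of_nonneg ht1']
    gcongr
    · exact le_ciSup (b1 p hp) x
    · exact le_ciSup (b1 q hq) x
  have i2 : (⨆ x, ‖hess M (fun x => (1 - t) * p x + t * q x) x‖) ≤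
      (1 - t) * (⨆ x, ‖hess M p x‖) + t * ⨆ x, ‖hess M q x‖ := by
    refine ciSup_le fun x => ?_
    rw [s0]
    refine (norm_add_le ((1 - t) • hess M p x) (t • hess M q x)).trans ?_
    rw [norm_smul, norm_smul, Real.norm_of_nonneg ht0, Real.norm_of_nonneg ht1']
    gcongr
    · exact le_ciSup (b2 p hp) x
    · exact le_ciSup (b2 q hq) x
  unfold c2Norm
  linarith

section Nbhd

variable [CompactSpace M.Pt] [T2Space M.Pt] [BorelSpace M.Pt] [SecondCountableTopology M.Pt]
  [IsFiniteMeasure M.vol] [Nonempty M.Pt]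

theorem segment_mem_nbhd (hM : HasRegularCharts M) {u : M.Pt → ℝ} {r : ℝ} (hu : IsCk M 2 u)
    {v w : M.Pt → ℝ} (hv : v ∈ nbhd M u r) (hw : w ∈ nbhd M u r) (t : I) :
    (fun x => v x + t * (w x - v x)) ∈ nbhd M u r := by
  obtain ⟨hv2, hv0, hvr⟩ := hv
  obtain ⟨hw2, hw0, hwr⟩ := hw
  refine ⟨hv2.add ((hw2.sub hv2).const_mul t), ?_, ?_⟩
  · have iv : Integrable v M.vol := integrable_of_continuous (hv2.continuous hM)
    have iw : Integrable w M.vol := integrable_of_continuous (hw2.continuous hM)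
    have i2 : Integrable (fun x => (t : ℝ) * (w x - v x)) M.vol := (iw.sub iv).const_mul _
    have h1 : ∫ x, (v x + t * (w x - v x)) ∂M.vol = 0 := by
      rw [integral_add iv i2, integral_const_mul, integral_sub iw iv, hv0, hw0]
      simp
    exact h1
  · have h1 := c2Norm_convex hM (hu.sub hv2) (hu.sub hw2) t.2.1 t.2.2
    have h2 : (fun x => u x - (v x + t * (w x - v x))) =
        fun x => (1 - (t : ℝ)) * (u x - v x) + t * (u x - w x) := by
      ext x; ring
    rw [h2]
    refine h1.trans ?_
    have := t.2.1
    have := t.2.2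
    nlinarith

theorem self_mem_nbhd (hM : HasRegularCharts M) {u : M.Pt → ℝ} {r : ℝ} (hr : 0 ≤ r)
    (hu : IsCk M 2 u) (hu0 : ∫ x, u x ∂M.vol = 0) : u ∈ nbhd M u r := by
  refine ⟨hu, hu0, ?_⟩
  have h1 := c2Norm_convex hM (isCk_const (M := M) 2 0) (isCk_const 2 0) (t := 0) le_rfl zero_le_one
  simp only [sub_self]
  have h3 : ∀ x, hess M (fun _ : M.Pt => (0 : ℝ)) x = 0 := by
    intro x; unfold hess; simp
  have h4 : ∀ x, grad M (fun _ : M.Pt => (0 : ℝ)) x = 0 := by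
    intro x; unfold grad gradient; simp
  unfold c2Norm
  simpa [h3, h4] using hr

end Nbhd

end

section

variable {n : ℕ}
variable {M : Manifold n} {c : M.Pt → M.Pt → EReal} {K : Set (M.Pt × M.Pt)}

/-! ### Functions with vanishing gradient, and Green's formula -/

/-- Vanishing of the gradient at all points, expressed in a fixed chart. -/
theorem eventually_fderiv_eq_zero (hM : HasRegularCharts M) {h : M.Pt → ℝ} (hh : IsCk M 2 h)
    (h0 : ∀ x, grad M h x = 0) (x : M.Pt) :
    ∀ᶠ ξ in 𝓝 (0 : E n), fderiv ℝ (fun ξ => h (M.coord x ξ)) ξ = 0 := by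
  filter_upwards [hh.eventually x] with ξ hξ
  obtain ⟨Φ, hΦ, rfl, hinj, hcoord⟩ := hM.transition x ξ
  have hsurj : Function.Surjective (fderiv ℝ Φ 0) :=
    (LinearMap.injective_iff_surjective (f := (fderiv ℝ Φ 0 : E n →ₗ[ℝ] E n))).1 hinj
  have h1 : HasFDerivAt (fun ζ => h (M.coord (M.coord x (Φ 0)) ζ))
      ((fderiv ℝ (fun ξ => h (M.coord x ξ)) (Φ 0)).comp (fderiv ℝ Φ 0)) 0 := by
    refine ((hξ.differentiableAt (by norm_num)).hasFDerivAt.comp 0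
      (hΦ.differentiableAt (by norm_num)).hasFDerivAt).congr_of_eventuallyEq ?_
    filter_upwards [hcoord] with ζ hζ
    simp [hζ]
  ext a
  obtain ⟨b, rfl⟩ := hsurj a
  have h2 := fderiv_apply_eq_inner_grad h (M.coord x (Φ 0)) b
  rw [h0, inner_zero_left, h1.fderiv] at h2
  exact h2

theorem hess_eq_zero_of_grad_eq_zero (hM : HasRegularCharts M) {h : M.Pt → ℝ} (hh : IsCk M 2 h)
    (h0 : ∀ x, grad M h x = 0) (x : M.Pt) : hess M h x = 0 := by
  have h1 : fderiv ℝ (fun ξ => h (M.coord x ξ)) =ᶠ[𝓝 0] fun _ => 0 :=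
    eventually_fderiv_eq_zero hM hh h0 x
  unfold hess
  rw [h1.fderiv_eq]
  simp

theorem eq_of_grad_eq_zero [ConnectedSpace M.Pt] (hM : HasRegularCharts M) {h : M.Pt → ℝ}
    (hh : IsCk M 2 h) (h0 : ∀ x, grad M h x = 0) (x y : M.Pt) : h x = h y := by
  have hloc : IsLocallyConstant h := by
    rw [IsLocallyConstant.iff_eventually_eq]
    intro x
    obtain ⟨ρ, hρ, hball⟩ := Metric.mem_nhds_iff.1
      ((eventually_fderiv_eq_zero hM hh h0 x).and (hh.eventually x))
    refine hM.nhds_le_map x ?_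
    rw [mem_map]
    filter_upwards [Metric.ball_mem_nhds (0 : E n) hρ] with ξ hξ
    have h1 := (convex_ball (0 : E n) ρ).is_const_of_fderivWithin_eq_zero (𝕜 := ℝ)
      (f := fun ξ => h (M.coord x ξ))
      (fun ζ hζ => ((hball hζ).2.differentiableAt (by norm_num)).differentiableWithinAt)
      (fun ζ hζ => by rw [fderivWithin_of_isOpen Metric.isOpen_ball hζ]; exact (hball hζ).1)
      hξ (Metric.mem_ball_self hρ)
    simpa [hM.coord_zero] using h1
  exact hloc.apply_eq_of_isPreconnected isPreconnected_univ (mem_univ x) (mem_univ y)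

theorem lap_mul_self (hM : HasRegularCharts M) {h : M.Pt → ℝ} (hh : IsCk M 2 h) (x : M.Pt) :
    lap M (fun x => h x * h x) x = 2 * (h x * lap M h x) + 2 * ‖grad M h x‖ ^ 2 := by
  have h1 : fderiv ℝ (fun ξ => h (M.coord x ξ) * h (M.coord x ξ)) =ᶠ[𝓝 0]
      fun ξ => (2 * h (M.coord x ξ)) • fderiv ℝ (fun ξ => h (M.coord x ξ)) ξ := by
    filter_upwards [hh.eventually x] with ξ hξ
    have hd := (hξ.differentiableAt (by norm_num)).hasFDerivAt
    refine (HasFDerivAt.fderiv (hd.mul hd)).trans ?_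
    rw [← add_smul, two_mul]
  have d1 : HasFDerivAt (fun ξ => h (M.coord x ξ)) (fderiv ℝ (fun ξ => h (M.coord x ξ)) 0) 0 :=
    ((hh x).differentiableAt (by norm_num)).hasFDerivAt
  have d2 : HasFDerivAt (fderiv ℝ (fun ξ => h (M.coord x ξ))) (hess M h x) 0 :=
    (((hh x).fderiv_right (m := 1) (by norm_num)).differentiableAt (by norm_num)).hasFDerivAt
  have h2 : ∀ ξ : E n, hess M (fun x => h x * h x) x ξ ξ =
      2 * h x * hess M h x ξ ξ + 2 * (inner ℝ (grad M h x) ξ) ^ 2 := by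
    intro ξ
    have h3 := h1.fderiv_eq.trans (HasFDerivAt.fderiv ((d1.const_mul 2).smul d2))
    unfold hess at h3 ⊢
    rw [h3, ← fderiv_apply_eq_inner_grad]
    simp [hM.coord_zero]
    ring
  have h4 : ∑ i, (inner ℝ (grad M h x) (e i)) ^ 2 = ‖grad M h x‖ ^ 2 := by
    rw [EuclideanSpace.norm_sq_eq]
    refine Finset.sum_congr rfl fun i _ => ?_
    simp [e, EuclideanSpace.inner_single_right]
  unfold lap
  simp only [h2, Finset.sum_add_distrib, ← Finset.mul_sum, h4]
  ring

theorem grad_sub {v w : M.Pt → ℝ} (hv : IsCk M 2 v) (hw : IsCk M 2 w) (x : M.Pt) :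
    grad M (fun x => w x - v x) x = grad M w x - grad M v x := by
  have := grad_add_mul hw hv (-1) x
  simpa [sub_eq_add_neg] using this

theorem lap_sub {v w : M.Pt → ℝ} (hv : IsCk M 2 v) (hw : IsCk M 2 w) (x : M.Pt) :
    lap M (fun x => w x - v x) x = lap M w x - lap M v x := by
  have h1 := hess_add_mul hw hv (-1) x
  have h2 : (fun x => w x + -1 * v x) = fun x => w x - v x := by ext x; ring
  rw [h2] at h1
  unfold lap
  rw [h1, ← Finset.sum_sub_distrib]
  refine Finset.sum_congr rfl fun i _ => ?_
  simp [sub_eq_add_neg]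

section

variable [CompactSpace M.Pt] [T2Space M.Pt] [BorelSpace M.Pt] [SecondCountableTopology M.Pt]
  [IsFiniteMeasure M.vol]

/-- Green's formula, from `∫ Δ(h²) = 0`. -/
theorem integral_mul_lap (hM : HasRegularCharts M) {h : M.Pt → ℝ} (hh : IsCk M 2 h)
    (hl : Continuous (lap M h)) :
    ∫ x, h x * lap M h x ∂M.vol = -∫ x, ‖grad M h x‖ ^ 2 ∂M.vol := by
  have i1 : Integrable (fun x => 2 * (h x * lap M h x)) M.vol :=
    integrable_of_continuous (continuous_const.mul ((hh.continuous hM).mul hl))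
  have i2 : Integrable (fun x => 2 * ‖grad M h x‖ ^ 2) M.vol :=
    integrable_of_continuous (continuous_const.mul ((hM.continuous_norm_grad h hh).pow 2))
  have h1 := hM.integral_lap _ (hh.mul hh)
  simp only [lap_mul_self hM hh] at h1
  rw [integral_add i1 i2, integral_const_mul, integral_const_mul] at h1
  linarith

theorem eq_zero_of_integral_eq_zero [M.vol.IsOpenPosMeasure] {φ : M.Pt → ℝ} (hφ : Continuous φ)
    (h0 : ∀ x, 0 ≤ φ x) (hint : ∫ x, φ x ∂M.vol = 0) (x : M.Pt) : φ x = 0 := by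
  have h1 := (integral_eq_zero_iff_of_nonneg h0 (integrable_of_continuous hφ)).1 hint
  exact congrFun ((hφ.ae_eq_iff_eq M.vol continuous_const).1 h1) x

/-! ### Inverse transport maps along a segment -/

theorem exists_inverse_family [ConnectedSpace M.Pt] (hM : HasRegularCharts M)
    (hc : IsAdmissibleCost M c K) {a b : ℝ} (ha : 0 ≤ a) {v h : M.Pt → ℝ} (hv : IsCk M 2 v)
    (hh : IsCk M 2 h) (hseg : ∀ t : I, EigenvaluesBetween M c K a b fun x => v x + t * h x)
    (hbij : Function.Bijective (transportMap M c v)) :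
    ∃ X : I → M.Pt → M.Pt, (Continuous fun q : I × M.Pt => X q.1 q.2) ∧
      (∀ (t : I) y, transportMap M c (fun x => v x + t * h x) (X t y) = y) ∧
      (∀ (t : I) x, X t (transportMap M c (fun x => v x + t * h x) x) = x) := by
  have hb := bijective_transportMap_segment hM hc ha hv hh hseg hbij
  have h1 := fun t : I => Equiv.ofBijective_apply_symm_apply _ (hb t)
  have h2 := fun t : I => Equiv.ofBijective_symm_apply_apply _ (hb t)
  exact ⟨fun t => (Equiv.ofBijective _ (hb t)).symm, continuous_inverse_of_existsUnique
    (continuous_transportMap_segment hM hc ha hv hh hseg) h1 h2, h1, h2⟩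

theorem integral_energy_mul_le {p g : M.Pt → ℝ} (hp : Continuous p) (hg : Continuous g)
    {lam G A : ℝ} (hlam : 0 ≤ lam) (hG : ∀ y, g y ≤ G) (hp0 : ∀ y, 0 ≤ p y) (hG0 : 0 ≤ G)
    {C : ℝ} (hA : ∫ y, p y ∂M.vol ≤ C * A) :
    ∫ y, lam * p y * g y ∂M.vol ≤ lam * G * C * A := by
  calc ∫ y, lam * p y * g y ∂M.vol
      ≤ ∫ y, lam * G * p y ∂M.vol := by
        refine integral_mono (integrable_of_continuous ((continuous_const.mul hp).mul hg))
          (integrable_of_continuous (continuous_const.mul hp)) fun y => ?_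
        have h1 := mul_le_mul_of_nonneg_left (hG y) (mul_nonneg hlam (hp0 y))
        dsimp only
        linarith
    _ = lam * G * ∫ y, p y ∂M.vol := integral_const_mul _ _
    _ ≤ lam * G * (C * A) := mul_le_mul_of_nonneg_left hA (mul_nonneg hlam hG0)
    _ = lam * G * C * A := by ring

/-- The first variations of the dual functional at the ends of a segment differ by a multiple of the
Dirichlet energy at most. -/
theorem integral_comp_inverse_sub_le (hM : HasRegularCharts M)
    (hc : IsAdmissibleCost M c K) {lam : ℝ} (hlam : 0 < lam) {v h g : M.Pt → ℝ} (hv : IsCk M 2 v)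
    (hh : IsCk M 2 h)
    (hseg : ∀ t : I, EigenvaluesBetween M c K (1 / lam) lam fun x => v x + t * h x)
    {X : I → M.Pt → M.Pt} (hX : Continuous fun q : I × M.Pt => X q.1 q.2)
    (hTX : ∀ (t : I) y, transportMap M c (fun x => v x + t * h x) (X t y) = y)
    (hXT : ∀ (t : I) x, X t (transportMap M c (fun x => v x + t * h x) x) = x)
    (hg : Continuous g) (hg0 : ∀ y, 0 ≤ g y) {G C : ℝ} (hG : ∀ y, g y ≤ G)
    (hC : ∀ (t : I) (ψ : M.Pt → ℝ), Continuous ψ → (∀ x, 0 ≤ ψ x) →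
      ∫ y, ψ (X t y) ∂M.vol ≤ C * ∫ x, ψ x ∂M.vol) (hG0 : 0 ≤ G) :
    ∫ y, h (X 0 y) * g y ∂M.vol - ∫ y, h (X 1 y) * g y ∂M.vol ≤
      lam * G * C * ∫ x, ‖grad M h x‖ ^ 2 ∂M.vol := by
  have hXt : ∀ t, Continuous (X t) := fun t => hX.comp (Continuous.prodMk_right t)
  have hhc := hh.continuous hM
  have hgr := (hM.continuous_norm_grad h hh).pow 2
  have i0 : ∀ t, Integrable (fun y => h (X t y) * g y) M.vol := fun t =>
    integrable_of_continuous ((hhc.comp (hXt t)).mul hg)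
  set β : M.Pt → ℝ → ℝ := fun y t =>
    (lam * ‖grad M h (X (projIcc 0 1 zero_le_one t) y)‖ ^ 2) * g y with hβ
  have hβcont : Continuous (Function.uncurry β) := by
    have h1 : Continuous fun q : M.Pt × ℝ => X (projIcc 0 1 zero_le_one q.2) q.1 :=
      hX.comp (((continuous_projIcc (h := zero_le_one)).comp continuous_snd).prodMk continuous_fst)
    exact (continuous_const.mul (hgr.comp h1)).mul (hg.comp continuous_fst)
  have hβint : Integrable (Function.uncurry β) (M.vol.prod (volume.restrict (Ioc (0 : ℝ) 1))) := by
    have h1 : IntegrableOn (Function.uncurry β) (univ ×ˢ Icc (0 : ℝ) 1) (M.vol.prod volume) :=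
      hβcont.continuousOn.integrableOn_compact (isCompact_univ.prod isCompact_Icc)
    have h2 := h1.mono_set (prod_mono_right (s := univ) (Ioc_subset_Icc_self (a := (0 : ℝ)) (b := 1)))
    rwa [IntegrableOn, ← Measure.prod_restrict, Measure.restrict_univ] at h2
  calc ∫ y, h (X 0 y) * g y ∂M.vol - ∫ y, h (X 1 y) * g y ∂M.vol
      = ∫ y, (h (X 0 y) * g y - h (X 1 y) * g y) ∂M.vol := (integral_sub (i0 0) (i0 1)).symm
    _ ≤ ∫ y, (∫ t in Ioc (0 : ℝ) 1, β y t) ∂M.vol := by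
        refine integral_mono ((i0 0).sub (i0 1)) hβint.integral_prod_left fun y => ?_
        have h1 := comp_inverse_sub_le_integral hM hc hlam hv hh hseg hX hTX hXT y
        rw [intervalIntegral.integral_of_le zero_le_one] at h1
        dsimp only
        rw [← sub_mul, hβ, integral_mul_const]
        exact mul_le_mul_of_nonneg_right h1 (hg0 y)
    _ = ∫ t in Ioc (0 : ℝ) 1, (∫ y, β y t ∂M.vol) := integral_integral_swap hβint
    _ ≤ ∫ _ in Ioc (0 : ℝ) 1, (lam * G * C * ∫ x, ‖grad M h x‖ ^ 2 ∂M.vol) := by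
        refine integral_mono hβint.integral_prod_right (integrable_const _) fun t => ?_
        have hXs := hXt (projIcc 0 1 zero_le_one t)
        exact integral_energy_mul_le (hgr.comp hXs) hg hlam.le hG
          (fun y => sq_nonneg ‖grad M h (X (projIcc 0 1 zero_le_one t) y)‖) hG0
          (hC (projIcc 0 1 zero_le_one t) (fun x => ‖grad M h x‖ ^ 2) hgr fun x => sq_nonneg _)
    _ = lam * G * C * ∫ x, ‖grad M h x‖ ^ 2 ∂M.vol := by simp

/-! ### The descent estimate -/

theorem IsDensity.continuous (hM : HasRegularCharts M) {f : M.Pt → ℝ} (hf : IsDensity M f) :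
    Continuous f := hf.regular.isCk.continuous hM

theorem IsDensity.pos {M : Manifold n} {f : M.Pt → ℝ} (hf : IsDensity M f) (x : M.Pt) :
    0 < f x := by
  obtain ⟨m, hm, h⟩ := hf.lower_bound
  exact hm.trans_le (h x)

/-- The descent estimate on any compact connected manifold with regular charts. Neither `c`-convexity
nor the bounds on `ω` at `u` itself are needed, since `u` lies in its own neighbourhood. -/
theorem exists_step_bound_of_hasRegularCharts [ConnectedSpace M.Pt] [M.vol.IsOpenPosMeasure]
    (hM : HasRegularCharts M) (hc : IsAdmissibleCost M c K)
    {g : M.Pt → ℝ} (hg : IsDensity M g) {lam : ℝ} (hlam : 0 < lam) :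
    ∃ τmax : ℝ, 0 < τmax ∧
      ∀ f : M.Pt → ℝ, IsDensity M f →
      ∀ (α : ℝ≥0) (u : M.Pt → ℝ), IsCkHolder M 3 α u →
        ∫ x, u x ∂M.vol = 0 → SolvesMongeAmpere M c f g u →
      ∀ r : ℝ, 0 < r → (∀ v ∈ nbhd M u r, EigenvaluesBetween M c K (1 / lam) lam v) →
      ∀ τ : ℝ, 0 < τ → τ < τmax → ∀ w : ℕ → M.Pt → ℝ, (∀ k, w k ∈ nbhd M u r) →
        IsSobolevDescent M (dualJ M c f g) τ w →
        ∀ k, (w k ≠ u → dualJ M c f g (w (k + 1)) < dualJ M c f g (w k)) ∧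
          dualJ M c f g (w k) - dualJ M c f g (w (k + 1)) ≥
            1 / (2 * τmax) * ∫ x, ‖grad M (w k) x - grad M (w (k + 1)) x‖ ^ 2 ∂M.vol := by
  have hgc := hg.continuous hM
  have hg0 : ∀ y, 0 ≤ g y := fun y => (hg.pos y).le
  obtain ⟨G, hGub⟩ := (isCompact_range hgc).bddAbove
  have hG : ∀ y, g y ≤ G := fun y => hGub (mem_range_self y)
  obtain ⟨C, hC0, hC⟩ := exists_integral_comp_inverse_le hM hc lam
  have ha : 0 ≤ 1 / lam := by positivity
  obtain ⟨y₀⟩ : Nonempty M.Pt := inferInstance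
  have hGpos : 0 < G := (hg.pos y₀).trans_le (hG y₀)
  -- the Lipschitz constant of the first variation with respect to the Dirichlet energy
  set L := lam * G * C with hL
  have hL0 : 0 < L := by positivity
  refine ⟨1 / (2 * L), by positivity, ?_⟩
  intro f hf α u huα hu0 hMA r hr hnb τ hτ hτmax w hw hdesc k
  have hfc := hf.continuous hM
  have hu : IsCk M 2 u := fun x => (huα.isCk x).of_le (by norm_num)
  have hunb := self_mem_nbhd hM hr.le hu hu0
  have hTu := bijective_transportMap_of_solvesMongeAmpere hM hc ha hu (hnb u hunb) hfc hgc
    hf.pos hg0 hf.mass hg.mass hMA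
  have hsegm : ∀ v ∈ nbhd M u r, ∀ v' ∈ nbhd M u r, ∀ t : I,
      EigenvaluesBetween M c K (1 / lam) lam fun x => v x + t * (v' x - v x) :=
    fun v hv v' hv' t => hnb _ (segment_mem_nbhd hM hu hv hv' t)
  have hbij : ∀ v ∈ nbhd M u r, Function.Bijective (transportMap M c v) := by
    intro v hv
    have := bijective_transportMap_segment hM hc ha hu (hv.1.sub hu) (hsegm u hunb v hv) hTu 1
    simpa using this
  set v := w k with hvdef
  set v' := w (k + 1) with hv'def
  have hv := hw k
  have hv' := hw (k + 1)
  rw [← hvdef] at hv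
  rw [← hv'def] at hv'
  set h : M.Pt → ℝ := fun x => v' x - v x with hh
  have hhk : IsCk M 2 h := hv'.1.sub hv.1
  have hhc := hhk.continuous hM
  obtain ⟨X, hX, hTX, hXT⟩ := exists_inverse_family hM hc ha hv.1 hhk (hsegm v hv v' hv') (hbij v hv)
  have hXt : ∀ t, Continuous (X t) := fun t => hX.comp (Continuous.prodMk_right t)
  have hmax0 : ∀ y, c (X 0 y) y ≠ ⊤ ∧
      (cTransform M c v y).toReal = -(c (X 0 y) y).toReal - v (X 0 y) :=
    toReal_cTransform_eq hM hc hv.1 (hnb v hv) (by simpa using hTX 0) (by simpa using hXT 0)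
  have hmax1 : ∀ y, c (X 1 y) y ≠ ⊤ ∧
      (cTransform M c v' y).toReal = -(c (X 1 y) y).toReal - v' (X 1 y) :=
    toReal_cTransform_eq hM hc hv'.1 (hnb v' hv') (by simpa [hh] using hTX 1)
      (by simpa [hh] using hXT 1)
  obtain ⟨j, hj, hlap⟩ := hdesc k
  have hlaph : ∀ x, lap M h x = τ * j x := by
    intro x
    rw [hh, lap_sub hv.1 hv'.1, hvdef, hv'def, hlap x]
    ring
  set N := ∫ x, ‖grad M h x‖ ^ 2 ∂M.vol with hN
  have hN0 : 0 ≤ N := integral_nonneg fun x => by positivity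
  -- the first variation at `v` in the direction `h`
  have hD0 : τ * (∫ x, h x * f x ∂M.vol - ∫ y, h (X 0 y) * g y ∂M.vol) = -N := by
    rw [← integral_firstVariation_mul hc hfc hgc hg0 (hv.1.continuous hM) hhc (hXt 0) hmax0 hj,
      hN, ← integral_mul_lap hM hhk (by
        have : lap M h = fun x => τ * j x := funext hlaph
        rw [this]
        exact continuous_const.mul hj.1), ← integral_const_mul]
    refine integral_congr_ae (Eventually.of_forall fun x => ?_)
    simp only [hlaph]
    ring
  -- convexity, at the endpoint `v'`
  have hD1 : dualJ M c f g v' - (∫ x, h x * f x ∂M.vol - ∫ y, h (X 1 y) * g y ∂M.vol) ≤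
      dualJ M c f g v := by
    have h1 := dualJ_add_ge hc hfc hgc hg0 (hv'.1.continuous hM) hhc.neg (hXt 1) hmax1
    have h2 : (fun x => v' x + (-h) x) = v := by
      ext x
      simp [hh]
    have h3 : ∫ x, (-h) x * f x ∂M.vol = -∫ x, h x * f x ∂M.vol := by
      rw [← integral_neg]; simp
    have h4 : ∫ y, (-h) (X 1 y) * g y ∂M.vol = -∫ y, h (X 1 y) * g y ∂M.vol := by
      rw [← integral_neg]; simp
    rw [h2, h3, h4] at h1
    linarith
  have hD2 := integral_comp_inverse_sub_le hM hc hlam hv.1 hhk (hsegm v hv v' hv') hX hTX hXT hgc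
    hg0 hG (C := C) (fun t ψ hψ hψ0 => hC _ _ ha (hv.1.add (hhk.const_mul t))
      (hsegm v hv v' hv' t) (X t) (hXt t) (hTX t) (hXT t) ψ hψ hψ0) hGpos.le
  rw [← hL, ← hN] at hD2
  have hmain : L * N ≤ dualJ M c f g v - dualJ M c f g v' := by
    have h1 : 2 * L * τ < 1 := by
      rw [lt_div_iff₀ (by positivity)] at hτmax
      linarith
    have h2 : 2 * L * N ≤ -(∫ x, h x * f x ∂M.vol - ∫ y, h (X 0 y) * g y ∂M.vol) := by
      rw [← mul_le_mul_iff_right₀ hτ]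
      have : 2 * L * τ * N ≤ 1 * N := mul_le_mul_of_nonneg_right h1.le hN0
      linarith
    linarith
  have hgradN : ∫ x, ‖grad M v x - grad M v' x‖ ^ 2 ∂M.vol = N := by
    refine integral_congr_ae (Eventually.of_forall fun x => ?_)
    simp only [hh]
    rw [grad_sub hv.1 hv'.1, norm_sub_rev]
  refine ⟨fun hne => ?_, ?_⟩
  · have hNpos : 0 < N := by
      refine lt_of_le_of_ne hN0 fun hN00 => hne ?_
      have hgrad : ∀ x, grad M h x = 0 := fun x => by
        have h1 := eq_zero_of_integral_eq_zero ((hM.continuous_norm_grad h hhk).pow 2)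
          (fun x => sq_nonneg _) hN00.symm x
        simpa using h1
      -- The first variation at `v` vanishes, so it takes the same value as at the solution `u`.
      have hj0 : ∀ x, j x = 0 := by
        intro x
        have h1 := hlaph x
        simp only [lap, hess_eq_zero_of_grad_eq_zero hM hhk hgrad x] at h1
        simpa [hτ.ne'] using h1.symm
      set l : M.Pt → ℝ := fun x => v x - u x with hl
      have hlk : IsCk M 2 l := hv.1.sub hu
      have hlc := hlk.continuous hM
      obtain ⟨Y, hY, hTY, hYT⟩ := exists_inverse_family hM hc ha hu hlk (hsegm u hunb v hv) hTu
      have hYt : ∀ t, Continuous (Y t) := fun t => hY.comp (Continuous.prodMk_right t)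
      have hmaxY : ∀ y, c (Y 1 y) y ≠ ⊤ ∧
          (cTransform M c v y).toReal = -(c (Y 1 y) y).toReal - v (Y 1 y) :=
        toReal_cTransform_eq hM hc hv.1 (hnb v hv) (by simpa [hl] using hTY 1)
          (by simpa [hl] using hYT 1)
      have e1 := integral_firstVariation_mul hc hfc hgc hg0 (hv.1.continuous hM) hlc (hYt 1) hmaxY hj
      have e2 := integral_comp_inverse_of_solvesMongeAmpere hM hc ha hu (hnb u hunb) hfc hgc
        hf.pos hg0 hf.mass hg.mass hMA (hYt 0) (by simpa using hTY 0) (by simpa using hYT 0) hlc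
      simp only [hj0, zero_mul, integral_zero] at e1
      have hmono := comp_inverse_monotone hM hc hlam hu hlk (hsegm u hunb v hv) hTY hYT
      have i0 : ∀ t, Integrable (fun y => l (Y t y) * g y) M.vol := fun t =>
        integrable_of_continuous ((hlc.comp (hYt t)).mul hgc)
      have e3 : ∫ y, (l (Y 0 y) * g y - l (Y 1 y) * g y) ∂M.vol = 0 := by
        rw [integral_sub (i0 0) (i0 1)]
        linarith
      have e4 := eq_zero_of_integral_eq_zero
        (((hlc.comp (hYt 0)).mul hgc).sub ((hlc.comp (hYt 1)).mul hgc))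
        (fun y => by
          have h1 : l (Y 1 y) * g y ≤ l (Y 0 y) * g y :=
            mul_le_mul_of_nonneg_right (hmono y).1 (hg0 y)
          simp only [Function.comp_apply, Pi.sub_apply, Pi.mul_apply]
          linarith) e3
      have hgl : ∀ x, grad M l x = 0 := by
        intro x
        have h1 := e4 (transportMap M c (fun x => u x + (0 : I) * l x) x)
        have h2 := (hmono (transportMap M c (fun x => u x + (0 : I) * l x) x)).2
        rw [hYT] at h2
        refine h2 ?_
        simp only [Function.comp_apply, Pi.sub_apply, Pi.mul_apply, hYT] at h1
        rw [← sub_mul] at h1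
        have h3 := (mul_eq_zero.1 h1).resolve_right (hg.pos _).ne'
        linarith
      have hconst := eq_of_grad_eq_zero hM hlk hgl
      have hint : ∫ x, l x ∂M.vol = 0 := by
        rw [hl, integral_sub (integrable_of_continuous (hv.1.continuous hM))
          (integrable_of_continuous (hu.continuous hM)), hv.2.1, hu0, sub_zero]
      have hl0 : l y₀ = 0 := by
        have h1 : ∫ x, l x ∂M.vol = ∫ _, l y₀ ∂M.vol :=
          integral_congr_ae (Eventually.of_forall fun x => hconst x y₀)
        rw [hint, integral_const, smul_eq_mul] at h1
        refine (mul_eq_zero.1 h1.symm).resolve_left ?_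
        rw [measureReal_def]
        exact ENNReal.toReal_ne_zero.2 ⟨(isOpen_univ.measure_pos M.vol ⟨y₀, mem_univ _⟩).ne', measure_ne_top _ _⟩
      ext x
      have h1 : l x = 0 := (hconst x y₀).trans hl0
      simp only [hl] at h1
      linarith
    have := mul_pos hL0 hNpos
    linarith
  · rw [hgradN, ge_iff_le]
    have h1 : 1 / (2 * (1 / (2 * L))) = L := by field_simp
    rw [h1]
    exact hmain

end

end

section

variable {n : ℕ}

/-! ### Integrating derivatives along measure-preserving flows -/

/-- The derivative of a function along a measure-preserving flow has mean zero. -/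
theorem integral_eq_zero_of_flow {X : Type*} [TopologicalSpace X] [CompactSpace X] [T2Space X]
    [MeasurableSpace X] [BorelSpace X] [SecondCountableTopology X] {μ : Measure X}
    [IsFiniteMeasure μ] {θ : ℝ → X → X} (hθ : Continuous fun q : ℝ × X => θ q.1 q.2)
    (hμ : ∀ t, MeasurePreserving (θ t) μ μ) {ψ ψ' : X → ℝ} (hψ : Continuous ψ)
    (hψ' : Continuous ψ') (hd : ∀ x t, HasDerivAt (fun t => ψ (θ t x)) (ψ' (θ t x)) t) :
    ∫ x, ψ' x ∂μ = 0 := by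
  have hint : ∀ {w : X → ℝ}, Continuous w → Integrable w μ := fun hw =>
    hw.integrable_of_hasCompactSupport (HasCompactSupport.of_compactSpace _)
  have hinv : ∀ {w : X → ℝ}, Continuous w → ∀ t, ∫ x, w (θ t x) ∂μ = ∫ x, w x ∂μ := by
    intro w hw t
    have h1 := integral_map (μ := μ) (hμ t).measurable.aemeasurable
      (f := w) hw.aestronglyMeasurable
    rw [(hμ t).map_eq] at h1
    exact h1.symm
  have hcont : Continuous (Function.uncurry fun (x : X) (t : ℝ) => ψ' (θ t x)) :=
    hψ'.comp (hθ.comp (continuous_snd.prodMk continuous_fst))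
  have hprod : Integrable (Function.uncurry fun (x : X) (t : ℝ) => ψ' (θ t x))
      (μ.prod (volume.restrict (Ioc (0 : ℝ) 1))) := by
    have h1 : IntegrableOn (Function.uncurry fun (x : X) (t : ℝ) => ψ' (θ t x))
        (univ ×ˢ Icc (0 : ℝ) 1) (μ.prod volume) :=
      hcont.continuousOn.integrableOn_compact (isCompact_univ.prod isCompact_Icc)
    have h2 := h1.mono_set (prod_mono_right (s := univ) (Ioc_subset_Icc_self (a := (0 : ℝ)) (b := 1)))
    rwa [IntegrableOn, ← Measure.prod_restrict, Measure.restrict_univ] at h2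
  have hftc : ∀ x, ∫ t in Ioc (0 : ℝ) 1, ψ' (θ t x) = ψ (θ 1 x) - ψ (θ 0 x) := by
    intro x
    rw [← intervalIntegral.integral_of_le zero_le_one]
    exact intervalIntegral.integral_eq_sub_of_hasDerivAt (fun t _ => hd x t)
      ((hcont.comp (Continuous.prodMk_right x)).intervalIntegrable _ _)
  calc ∫ x, ψ' x ∂μ = ∫ t in Ioc (0 : ℝ) 1, (∫ x, ψ' (θ t x) ∂μ) := by
        simp [hinv hψ']
    _ = ∫ x, (∫ t in Ioc (0 : ℝ) 1, ψ' (θ t x)) ∂μ := (integral_integral_swap hprod).symm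
    _ = ∫ x, (ψ (θ 1 x) - ψ (θ 0 x)) ∂μ := by simp only [hftc]
    _ = 0 := by
        have i1 : ∀ t, Integrable (fun x => ψ (θ t x)) μ := fun t =>
          hint (hψ.comp (hθ.comp (Continuous.prodMk_right t)))
        rw [integral_sub (i1 1) (i1 0), hinv hψ, hinv hψ, sub_self]

/-! ### The flat torus -/

/-- The covering map `ℝⁿ → ℝⁿ / ℤⁿ`. -/
def torusMk (ξ : E n) : UnitAddTorus (Fin n) := fun i => ((ξ i : ℝ) : UnitAddCircle)

theorem torusMk_add (ξ ζ : E n) : torusMk (ξ + ζ) = torusMk ξ + torusMk ζ := by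
  ext i
  simp [torusMk]

theorem continuous_torusMk : Continuous (torusMk (n := n)) :=
  continuous_pi fun i => (AddCircle.continuous_mk' 1).comp (EuclideanSpace.proj i).continuous

theorem isOpenMap_torusMk : IsOpenMap (torusMk (n := n)) := by
  have h1 : IsOpenMap (Pi.map fun (_ : Fin n) (t : ℝ) => (t : UnitAddCircle)) :=
    IsOpenMap.piMap (fun _ => QuotientAddGroup.isOpenMap_coe)
      (Eventually.of_forall fun _ => QuotientAddGroup.mk_surjective)
  exact h1.comp (EuclideanSpace.equiv (Fin n) ℝ).toHomeomorph.isOpenMap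

/-- The half-open unit cube with smallest corner `a`. -/
def unitCube (a : Fin n → ℝ) : Set (E n) := {ξ | ∀ i, ξ i ∈ Ioc (a i) (a i + 1)}

theorem measurePreserving_torusMk (a : Fin n → ℝ) :
    MeasurePreserving (torusMk (n := n)) (volume.restrict (unitCube a)) volume := by
  have h1 := measurePreserving_pi (fun i => volume.restrict (Ioc (a i) (a i + 1)))
    (fun _ => (volume : Measure UnitAddCircle)) fun i => UnitAddCircle.measurePreserving_mk (a i)
  rw [← Measure.restrict_pi_pi] at h1
  have h2 := (PiLp.volume_preserving_ofLp (Fin n)).restrict_preimage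
    (s := univ.pi fun i => Ioc (a i) (a i + 1)) (MeasurableSet.univ_pi fun i => measurableSet_Ioc)
  have h3 : WithLp.ofLp ⁻¹' (univ.pi fun i => Ioc (a i) (a i + 1)) = unitCube a := by
    ext ξ
    simp [unitCube]
  rw [h3] at h2
  exact h1.comp h2

theorem injOn_torusMk (a : Fin n → ℝ) : InjOn (torusMk (n := n)) (unitCube a) := by
  intro ξ hξ ζ hζ h
  ext i
  have h1 := congrFun h i
  exact (AddCircle.coe_eq_coe_iff_of_mem_Ioc (p := 1) (hξ i) (hζ i)).1 h1

theorem measurableSet_unitCube (a : Fin n → ℝ) : MeasurableSet (unitCube a) := by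
  have : unitCube a = ⋂ i, (fun ξ : E n => ξ i) ⁻¹' Ioc (a i) (a i + 1) := by
    ext ξ
    simp [unitCube]
  rw [this]
  exact MeasurableSet.iInter fun i =>
    (EuclideanSpace.proj (𝕜 := ℝ) i).continuous.measurable measurableSet_Ioc

/-- On each integer translate of the unit cube the covering map preserves volume. -/
theorem volume_torusMk_image_le (S : Set (E n)) :
    (volume : Measure (UnitAddTorus (Fin n))) (torusMk '' S) ≤ volume S := by
  have hmeas : ∀ S : Set (E n), MeasurableSet S →
      (volume : Measure (UnitAddTorus (Fin n))) (torusMk '' S) ≤ volume S := by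
    intro S hS
    set Q : (Fin n → ℤ) → Set (E n) := fun k => unitCube fun i => (k i : ℝ) with hQ
    have hcov : (⋃ k, S ∩ Q k) = S := by
      rw [← inter_iUnion, inter_eq_left]
      intro ξ _
      refine mem_iUnion.2 ⟨fun i => ⌈ξ i⌉ - 1, fun i => ?_⟩
      have h1 := Int.ceil_lt_add_one (ξ i)
      have h2 := Int.le_ceil (ξ i)
      constructor <;> push_cast <;> linarith
    have hdisj : Pairwise (Function.onFun Disjoint fun k => S ∩ Q k) := by
      intro k l hkl
      refine Set.disjoint_left.2 fun ξ hξ hξ' => hkl (funext fun i => ?_)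
      have h1 := hξ.2 i
      have h2 := hξ'.2 i
      have h3 : (k i : ℝ) < l i + 1 := h1.1.trans_le h2.2
      have h4 : (l i : ℝ) < k i + 1 := h2.1.trans_le h1.2
      norm_cast at h3 h4
      omega
    have hpiece : ∀ k, (volume : Measure (UnitAddTorus (Fin n))) (torusMk '' (S ∩ Q k)) =
        volume (S ∩ Q k) := by
      intro k
      have hinj := injOn_torusMk (n := n) fun i => (k i : ℝ)
      have hmk := measurePreserving_torusMk (n := n) fun i => (k i : ℝ)
      have hmS : MeasurableSet (S ∩ Q k) := hS.inter (measurableSet_unitCube _)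
      have h1 := hmS.image_of_measurable_injOn hmk.measurable (hinj.mono inter_subset_right)
      rw [← hmk.measure_preimage h1.nullMeasurableSet,
        Measure.restrict_apply (hmk.measurable h1)]
      congr 1
      ext ξ
      constructor
      · rintro ⟨⟨ζ, hζ, hζξ⟩, hξ⟩
        rwa [← hinj hζ.2 hξ hζξ]
      · exact fun hξ => ⟨⟨ξ, hξ, rfl⟩, hξ.2⟩
    calc (volume : Measure (UnitAddTorus (Fin n))) (torusMk '' S)
        = volume (⋃ k, torusMk '' (S ∩ Q k)) := by rw [← image_iUnion, hcov]
      _ ≤ ∑' k, volume (torusMk '' (S ∩ Q k)) := measure_iUnion_le _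
      _ = ∑' k, volume (S ∩ Q k) := by simp only [hpiece]
      _ = volume S := by
          rw [← measure_iUnion hdisj fun k => hS.inter (measurableSet_unitCube _), hcov]
  calc (volume : Measure (UnitAddTorus (Fin n))) (torusMk '' S)
      ≤ volume (torusMk '' toMeasurable volume S) :=
        measure_mono (image_mono (subset_toMeasurable _ _))
    _ ≤ volume (toMeasurable volume S) := hmeas _ (measurableSet_toMeasurable _ _)
    _ = volume S := measure_toMeasurable _

theorem torus_coord_coord (x : (torus n).Pt) (ξ ζ : E n) :
    (torus n).coord ((torus n).coord x ξ) ζ = (torus n).coord x (ξ + ζ) := by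
  change x + torusMk ξ + torusMk ζ = x + torusMk (ξ + ζ)
  rw [torusMk_add, add_assoc]

theorem torus_comp_coord_coord (φ : (torus n).Pt → ℝ) (x : (torus n).Pt) (ξ : E n) :
    (fun ζ => φ ((torus n).coord ((torus n).coord x ξ) ζ)) =
      fun ζ => φ ((torus n).coord x (ξ + ζ)) :=
  funext fun ζ => congrArg φ (torus_coord_coord x ξ ζ)

theorem torus_fderiv (φ : (torus n).Pt → ℝ) (x : (torus n).Pt) (ξ ζ : E n) :
    fderiv ℝ (fun ζ => φ ((torus n).coord ((torus n).coord x ξ) ζ)) ζ =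
      fderiv ℝ (fun ξ => φ ((torus n).coord x ξ)) (ξ + ζ) := by
  rw [torus_comp_coord_coord]
  exact fderiv_comp_add_left (f := fun ξ => φ ((torus n).coord x ξ)) ξ

theorem torus_grad (φ : (torus n).Pt → ℝ) (x : (torus n).Pt) (ξ a : E n) :
    inner ℝ (grad (torus n) φ ((torus n).coord x ξ)) a =
      fderiv ℝ (fun ξ => φ ((torus n).coord x ξ)) ξ a := by
  rw [← fderiv_apply_eq_inner_grad, torus_fderiv, add_zero]

theorem torus_hess (φ : (torus n).Pt → ℝ) (x : (torus n).Pt) (ξ : E n) :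
    hess (torus n) φ ((torus n).coord x ξ) =
      fderiv ℝ (fderiv ℝ (fun ξ => φ ((torus n).coord x ξ))) ξ := by
  unfold hess
  rw [show fderiv ℝ (fun ζ => φ ((torus n).coord ((torus n).coord x ξ) ζ)) =
    fun ζ => fderiv ℝ (fun ξ => φ ((torus n).coord x ξ)) (ξ + ζ) from funext (torus_fderiv φ x ξ)]
  exact (fderiv_comp_add_left (f := fderiv ℝ fun ξ => φ ((torus n).coord x ξ)) ξ).trans
    (by rw [add_zero])

theorem torus_coord_zero (x : (torus n).Pt) : (torus n).coord x 0 = x := by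
  funext i
  simp

theorem torus_nhds_le (x : (torus n).Pt) : 𝓝 x ≤ map ((torus n).coord x) (𝓝 0) := by
  have h1 : IsOpenMap ((torus n).coord x) :=
    (Homeomorph.addLeft x).isOpenMap.comp isOpenMap_torusMk
  have h2 := h1.nhds_le 0
  rwa [torus_coord_zero] at h2

theorem torus_continuous_hess {φ : (torus n).Pt → ℝ} (hφ : IsCk (torus n) 2 φ) :
    Continuous (hess (torus n) φ) := by
  refine continuous_of_nhds_le torus_coord_zero torus_nhds_le fun x => ?_
  rw [show (fun ξ => hess (torus n) φ ((torus n).coord x ξ)) =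
    fderiv ℝ (fderiv ℝ (fun ξ => φ ((torus n).coord x ξ))) from funext (torus_hess φ x)]
  exact (((hφ x).fderiv_right (m := 1) (by norm_num)).fderiv_right
    (m := 0) (by norm_num)).continuousAt

theorem torus_continuous_grad {φ : (torus n).Pt → ℝ} (hφ : IsCk (torus n) 2 φ) :
    Continuous (grad (torus n) φ) := by
  refine continuous_of_nhds_le torus_coord_zero torus_nhds_le fun x => ?_
  have h1 : ∀ ξ, grad (torus n) φ ((torus n).coord x ξ) =
      (InnerProductSpace.toDual ℝ (E n)).symm (fderiv ℝ (fun ξ => φ ((torus n).coord x ξ)) ξ) :=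
    fun ξ => ext_inner_right ℝ fun a => by
      rw [torus_grad, InnerProductSpace.toDual_symm_apply]
  rw [show (fun ξ => grad (torus n) φ ((torus n).coord x ξ)) = _ from funext h1]
  exact (InnerProductSpace.toDual ℝ (E n)).symm.continuous.continuousAt.comp
    ((hφ x).fderiv_right (m := 1) (by norm_num)).continuousAt

theorem torus_integral_hess {φ : (torus n).Pt → ℝ} (hφ : IsCk (torus n) 2 φ) (a : E n) :
    ∫ x, hess (torus n) φ x a a ∂(torus n).vol = 0 := by
  have hev : Continuous fun L : E n →L[ℝ] E n →L[ℝ] ℝ => L a a := by fun_prop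
  refine integral_eq_zero_of_flow (θ := fun t x => (torus n).coord x (t • a))
    (ψ := fun x => inner ℝ (grad (torus n) φ x) a) ?_ (fun t => ?_) ?_
    (hev.comp (torus_continuous_hess hφ)) fun x t => ?_
  · exact continuous_snd.add (continuous_torusMk.comp (continuous_fst.smul continuous_const))
  · exact measurePreserving_add_right volume (torusMk (t • a))
  · exact (torus_continuous_grad hφ).inner continuous_const
  · set x' := (torus n).coord x (t • a) with hx'
    have h1 : ∀ s : ℝ, (torus n).coord x (s • a) = (torus n).coord x' ((s - t) • a) := by
      intro s
      rw [hx', torus_coord_coord, ← add_smul, add_sub_cancel]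
    have h2 : (fun s : ℝ => inner ℝ (grad (torus n) φ ((torus n).coord x (s • a))) a) =
        fun s => fderiv ℝ (fun ξ => φ ((torus n).coord x' ξ)) ((s - t) • a) a :=
      funext fun s => by rw [h1, torus_grad]
    rw [h2]
    have d1 : HasDerivAt (fun s : ℝ => (s - t) • a) a t := by
      simpa using ((hasDerivAt_id t).sub_const t).smul_const a
    have d2 : HasFDerivAt (fderiv ℝ (fun ξ => φ ((torus n).coord x' ξ))) (hess (torus n) φ x')
        ((t - t) • a) := by
      rw [sub_self, zero_smul]
      exact (((hφ x').fderiv_right (m := 1) (by norm_num)).differentiableAt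
        (by norm_num)).hasFDerivAt
    have d3 : HasDerivAt (fun s : ℝ => fderiv ℝ (fun ξ => φ ((torus n).coord x' ξ)) ((s - t) • a))
        (hess (torus n) φ x' a) t := HasFDerivAt.comp_hasDerivAt t d2 d1
    exact HasFDerivAt.comp_hasDerivAt (l := fun L : E n →L[ℝ] ℝ => L a) t
      (ContinuousLinearMap.apply ℝ ℝ a).hasFDerivAt d3

theorem hasRegularCharts_torus (n : ℕ) : HasRegularCharts (torus n) where
  coord_zero := torus_coord_zero
  continuous_coord x := continuous_const.add continuous_torusMk
  nhds_le_map := torus_nhds_le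
  transition x ξ := by
    refine ⟨fun ζ => ξ + ζ, (contDiff_const.add contDiff_id).contDiffAt, add_zero ξ, ?_,
      Eventually.of_forall fun ζ => ?_⟩
    · rw [HasFDerivAt.fderiv (f := fun ζ : E n => ξ + ζ) ((hasFDerivAt_id (0 : E n)).const_add ξ)]
      exact Function.injective_id
    · exact torus_coord_coord x ξ ζ
  vol_image_le x S := by
    have h1 : (torus n).coord x '' S = (fun z => x + z) '' (torusMk '' S) := by
      rw [image_image]
      rfl
    rw [h1]
    change (volume : Measure (UnitAddTorus (Fin n))) _ ≤ _
    rw [image_add_left, measure_preimage_add]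
    exact volume_torusMk_image_le S
  vol_preimage_le ε hε := by
    refine ⟨1 / 2, by norm_num, fun x B hB => ?_⟩
    have hB' : MeasurableSet ((fun z => x + z) ⁻¹' B) := measurable_const_add x hB
    have hmk := measurePreserving_torusMk (n := n) fun _ => -(1 / 2)
    calc volume ((torus n).coord x ⁻¹' B ∩ Metric.ball 0 (1 / 2))
        ≤ volume (torusMk ⁻¹' ((fun z => x + z) ⁻¹' B) ∩ unitCube fun _ => -(1 / 2)) := by
          refine measure_mono (inter_subset_inter_right _ fun ξ hξ i => ?_)
          have h1 := (PiLp.norm_apply_le ξ i).trans_lt (mem_ball_zero_iff.1 hξ)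
          have h2 := abs_lt.1 h1
          exact ⟨h2.1, by linarith [h2.2]⟩
      _ = (volume : Measure (UnitAddTorus (Fin n))) ((fun z => x + z) ⁻¹' B) := by
          rw [← hmk.measure_preimage hB'.nullMeasurableSet,
            Measure.restrict_apply (hmk.measurable hB')]
      _ = (torus n).vol B := measure_preimage_add volume x B
      _ ≤ ENNReal.ofReal (1 + ε) * (torus n).vol B := by
          refine le_mul_of_one_le_left zero_le ?_
          rw [ENNReal.one_le_ofReal]
          linarith
  continuous_norm_grad φ hφ := (torus_continuous_grad hφ).norm
  norm_hess_le φ hφ := by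
    obtain ⟨C, hC⟩ := (isCompact_range (torus_continuous_hess hφ).norm).bddAbove
    exact ⟨C, fun x => hC (mem_range_self x)⟩
  integral_lap φ hφ := by
    have hev : ∀ a, Continuous fun x => hess (torus n) φ x a a := fun a => by
      have := torus_continuous_hess hφ
      fun_prop
    unfold lap
    rw [integral_finsetSum _ fun i _ => integrable_of_continuous (hev (e i))]
    exact Finset.sum_eq_zero fun i _ => torus_integral_hess hφ (e i)

end

section

variable {n : ℕ}

/-! ### Central projection charts of the sphere -/

/-- The orthonormal frame of the tangent space of the sphere at `x`, as a linear isometry. -/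
def tangentFrame (x : SpherePt n) : E n →ₗᵢ[ℝ] E (n + 1) :=
  (Submodule.subtypeₗᵢ _).comp (OrthonormalBasis.fromOrthogonalSpanSingleton (𝕜 := ℝ) n
    (ne_zero_of_mem_unit_sphere x)).repr.symm.toLinearIsometry

theorem inner_tangentFrame (x : SpherePt n) (ξ : E n) :
    inner ℝ (x : E (n + 1)) (tangentFrame x ξ) = 0 := inner_sphereFrame x ξ

/-- The coordinates in the frame at `x` of the orthogonal projection to the tangent space. -/
def tangentPart (x : SpherePt n) : E (n + 1) →L[ℝ] E n :=
  ContinuousLinearMap.adjoint (tangentFrame x).toContinuousLinearMap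

theorem inner_tangentPart (x : SpherePt n) (ξ : E n) (z : E (n + 1)) :
    inner ℝ ξ (tangentPart x z) = inner ℝ (tangentFrame x ξ) z :=
  ContinuousLinearMap.adjoint_inner_right _ _ _

theorem tangentPart_tangentFrame (x : SpherePt n) (ξ : E n) :
    tangentPart x (tangentFrame x ξ) = ξ :=
  ext_inner_left ℝ fun ζ => by rw [inner_tangentPart, LinearIsometry.inner_map_map]

theorem tangentPart_self (x : SpherePt n) : tangentPart x (x : E (n + 1)) = 0 :=
  ext_inner_left ℝ fun ζ => by
    rw [inner_tangentPart, real_inner_comm, inner_tangentFrame, inner_zero_right]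

theorem inner_self_eq_one (x : SpherePt n) : inner ℝ (x : E (n + 1)) (x : E (n + 1)) = 1 := by
  rw [real_inner_self_eq_norm_sq, norm_eq_of_mem_sphere, one_pow]

theorem inner_smul_add_tangentFrame (x : SpherePt n) (z : E (n + 1)) :
    (inner ℝ (x : E (n + 1)) z : ℝ) • (x : E (n + 1)) + tangentFrame x (tangentPart x z) = z := by
  set b := OrthonormalBasis.fromOrthogonalSpanSingleton (𝕜 := ℝ) n (ne_zero_of_mem_unit_sphere x)
  have h1 : z - (inner ℝ (x : E (n + 1)) z : ℝ) • (x : E (n + 1)) ∈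
      (Submodule.span ℝ {(x : E (n + 1))})ᗮ := by
    rw [Submodule.mem_orthogonal_singleton_iff_inner_right, inner_sub_right, inner_smul_right,
      inner_self_eq_one, mul_one, sub_self]
  have h2 : tangentFrame x (b.repr ⟨_, h1⟩) =
      z - (inner ℝ (x : E (n + 1)) z : ℝ) • (x : E (n + 1)) := by
    change ((b.repr.symm (b.repr ⟨_, h1⟩) : _) : E (n + 1)) = _
    rw [LinearIsometryEquiv.symm_apply_apply]
  have h3 : tangentPart x z = b.repr ⟨_, h1⟩ := by
    have h4 : z = (inner ℝ (x : E (n + 1)) z : ℝ) • (x : E (n + 1)) +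
        tangentFrame x (b.repr ⟨_, h1⟩) := by rw [h2]; abel
    conv_lhs => rw [h4]
    rw [map_add, map_smul, tangentPart_self, smul_zero, zero_add, tangentPart_tangentFrame]
  rw [h3, h2]
  abel

/-- The inverse of the central projection `coord x`, as a function that is homogeneous of degree
zero on the half space `⟪x, z⟫ > 0`. -/
def gnomonic (x : SpherePt n) (z : E (n + 1)) : E n :=
  (inner ℝ (x : E (n + 1)) z : ℝ)⁻¹ • tangentPart x z

theorem gnomonic_smul (x : SpherePt n) {s : ℝ} (hs : s ≠ 0) (z : E (n + 1)) :
    gnomonic x (s • z) = gnomonic x z := by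
  unfold gnomonic
  rw [inner_smul_right, map_smul, smul_smul, mul_inv, mul_right_comm, inv_mul_cancel₀ hs, one_mul]

theorem inner_add_tangentFrame (x : SpherePt n) (ξ : E n) :
    inner ℝ (x : E (n + 1)) ((x : E (n + 1)) + tangentFrame x ξ) = 1 := by
  rw [inner_add_right, inner_self_eq_one, inner_tangentFrame, add_zero]

theorem gnomonic_add_tangentFrame (x : SpherePt n) (ξ : E n) :
    gnomonic x ((x : E (n + 1)) + tangentFrame x ξ) = ξ := by
  unfold gnomonic
  rw [inner_add_tangentFrame, map_add, tangentPart_self, tangentPart_tangentFrame, zero_add, inv_one,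
    one_smul]

theorem gnomonic_self (x : SpherePt n) : gnomonic x (x : E (n + 1)) = 0 := by
  rw [gnomonic, tangentPart_self, smul_zero]

theorem add_tangentFrame_gnomonic (x : SpherePt n) {z : E (n + 1)}
    (hz : inner ℝ (x : E (n + 1)) z ≠ 0) :
    (x : E (n + 1)) + tangentFrame x (gnomonic x z) = (inner ℝ (x : E (n + 1)) z : ℝ)⁻¹ • z := by
  conv_rhs => rw [← inner_smul_add_tangentFrame x z]
  rw [smul_add, smul_smul, inner_smul_add_tangentFrame, inv_mul_cancel₀ hz, one_smul, gnomonic,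
    map_smul]

theorem contDiffAt_gnomonic (x : SpherePt n) {z : E (n + 1)}
    (hz : inner ℝ (x : E (n + 1)) z ≠ 0) : ContDiffAt ℝ 4 (gnomonic x) z := by
  refine ContDiffAt.smul (ContDiffAt.inv ?_ hz) (tangentPart x).contDiff.contDiffAt
  exact (contDiff_const.inner ℝ contDiff_id).contDiffAt

/-- The radial projection `z ↦ z / |z|`, with an arbitrary value at `0`. -/
def radialProj (z : E (n + 1)) : SpherePt n :=
  if h : z = 0 then ⟨e 0, by simp⟩ else ⟨‖z‖⁻¹ • z, by
    rw [mem_sphere_zero_iff_norm, norm_smul, norm_inv, norm_norm,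
      inv_mul_cancel₀ (norm_ne_zero_iff.2 h)]⟩

theorem coe_radialProj {z : E (n + 1)} (hz : z ≠ 0) :
    (radialProj z : E (n + 1)) = ‖z‖⁻¹ • z := by
  simp [radialProj, hz]

theorem radialProj_smul {s : ℝ} (hs : 0 < s) {z : E (n + 1)} (hz : z ≠ 0) :
    radialProj (s • z) = radialProj z := by
  apply Subtype.ext
  rw [coe_radialProj hz, coe_radialProj (smul_ne_zero hs.ne' hz), norm_smul, Real.norm_of_nonneg hs.le,
    smul_smul, mul_inv, mul_right_comm, inv_mul_cancel₀ hs.ne', one_mul]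

theorem radialProj_coe (x : SpherePt n) : radialProj (x : E (n + 1)) = x := by
  apply Subtype.ext
  rw [coe_radialProj (ne_zero_of_mem_unit_sphere x), norm_eq_of_mem_sphere, inv_one, one_smul]

theorem add_tangentFrame_ne_zero (x : SpherePt n) (ξ : E n) :
    (x : E (n + 1)) + tangentFrame x ξ ≠ 0 := add_sphereFrame_ne_zero x ξ

theorem sphere_coord (x : SpherePt n) (ξ : E n) :
    (sphere n).coord x ξ = radialProj ((x : E (n + 1)) + tangentFrame x ξ) := by
  apply Subtype.ext
  rw [coe_radialProj (add_tangentFrame_ne_zero x ξ)]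
  rfl

theorem ne_zero_of_inner_pos {x : SpherePt n} {z : E (n + 1)}
    (hz : 0 < inner ℝ (x : E (n + 1)) z) : z ≠ 0 := by
  rintro rfl
  simp at hz

theorem sphere_coord_gnomonic (x : SpherePt n) {z : E (n + 1)}
    (hz : 0 < inner ℝ (x : E (n + 1)) z) : (sphere n).coord x (gnomonic x z) = radialProj z := by
  rw [sphere_coord, add_tangentFrame_gnomonic x hz.ne',
    radialProj_smul (inv_pos.2 hz) (ne_zero_of_inner_pos hz)]

theorem sphere_coord_zero (x : SpherePt n) : (sphere n).coord x 0 = x := by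
  rw [sphere_coord, map_zero, add_zero, radialProj_coe]

theorem coe_sphere_coord (x : SpherePt n) (ξ : E n) :
    (((sphere n).coord x ξ : SpherePt n) : E (n + 1)) =
      ‖(x : E (n + 1)) + tangentFrame x ξ‖⁻¹ • ((x : E (n + 1)) + tangentFrame x ξ) := rfl

theorem inner_sphere_coord_pos (x : SpherePt n) (ξ : E n) :
    0 < inner ℝ (x : E (n + 1)) ((sphere n).coord x ξ : SpherePt n) := by
  rw [coe_sphere_coord, inner_smul_right, inner_add_tangentFrame, mul_one]
  exact inv_pos.2 (norm_pos_iff.2 (add_tangentFrame_ne_zero x ξ))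

theorem gnomonic_sphere_coord (x : SpherePt n) (ξ : E n) :
    gnomonic x ((sphere n).coord x ξ : SpherePt n) = ξ := by
  rw [coe_sphere_coord, gnomonic_smul, gnomonic_add_tangentFrame]
  exact inv_ne_zero (norm_ne_zero_iff.2 (add_tangentFrame_ne_zero x ξ))

theorem sphere_continuous_coord (x : SpherePt n) : Continuous ((sphere n).coord x) := by
  have h1 : Continuous fun ξ : E n => (x : E (n + 1)) + tangentFrame x ξ :=
    continuous_const.add (tangentFrame x).continuous
  exact Continuous.subtype_mk
    ((h1.norm.inv₀ fun ξ => norm_ne_zero_iff.2 (add_tangentFrame_ne_zero x ξ)).smul h1) _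

theorem continuousAt_inner_left (x : SpherePt n) (z : E (n + 1)) :
    ContinuousAt (fun z => (inner ℝ (x : E (n + 1)) z : ℝ)) z :=
  (continuous_const.inner continuous_id).continuousAt

theorem sphere_nhds_le (x : SpherePt n) : 𝓝 x ≤ map ((sphere n).coord x) (𝓝 0) := by
  have h1 : Tendsto (fun y : SpherePt n => gnomonic x (y : E (n + 1))) (𝓝 x) (𝓝 0) := by
    have h2 : ContinuousAt (gnomonic x) (x : E (n + 1)) :=
      (contDiffAt_gnomonic x (by rw [inner_self_eq_one]; exact one_ne_zero)).continuousAt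
    have h3 : ContinuousAt (fun y : SpherePt n => gnomonic x (y : E (n + 1))) x :=
      ContinuousAt.comp (g := gnomonic x) h2 continuous_subtype_val.continuousAt
    rw [ContinuousAt, gnomonic_self] at h3
    exact h3
  have h4 : ∀ᶠ y : SpherePt n in 𝓝 x, 0 < inner ℝ (x : E (n + 1)) (y : E (n + 1)) :=
    (continuous_const.inner continuous_subtype_val).continuousAt.eventually
      (lt_mem_nhds (by dsimp only; rw [inner_self_eq_one]; exact one_pos))
  intro s hs
  filter_upwards [h1.eventually (mem_map.1 hs), h4] with y hy hxy
  have h5 : (sphere n).coord x (gnomonic x (y : E (n + 1))) ∈ s := hy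
  rwa [sphere_coord_gnomonic x hxy, radialProj_coe] at h5

theorem sphere_transition (x : SpherePt n) (ξ : E n) : ∃ Φ : E n → E n, ContDiffAt ℝ 4 Φ 0 ∧
    Φ 0 = ξ ∧ Function.Injective (fderiv ℝ Φ 0) ∧
    ∀ᶠ ζ in 𝓝 0, (sphere n).coord ((sphere n).coord x ξ) ζ = (sphere n).coord x (Φ ζ) := by
  obtain ⟨x₀, hx₀⟩ : ∃ x₀ : SpherePt n, x₀ = (sphere n).coord x ξ := ⟨_, rfl⟩
  rw [← hx₀]
  set ι : E n → E (n + 1) := fun ζ => (x₀ : E (n + 1)) + tangentFrame x₀ ζ with hι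
  have hιs : ContDiff ℝ 4 ι := contDiff_const.add (tangentFrame x₀).contDiff
  have hι0 : ι 0 = x₀ := by rw [hι]; dsimp only; rw [map_zero, add_zero]
  have hpos : 0 < inner ℝ (x : E (n + 1)) (ι 0) := by
    rw [hι0, hx₀]
    exact inner_sphere_coord_pos x ξ
  have hev : ∀ᶠ ζ in 𝓝 (0 : E n), 0 < inner ℝ (x : E (n + 1)) (ι ζ) :=
    (continuous_const.inner hιs.continuous).continuousAt.eventually (lt_mem_nhds hpos)
  have hΦ : ContDiffAt ℝ 4 (fun ζ => gnomonic x (ι ζ)) 0 :=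
    ContDiffAt.comp (g := gnomonic x) 0 (contDiffAt_gnomonic x hpos.ne') hιs.contDiffAt
  have hΦ0 : gnomonic x (ι 0) = ξ := by
    rw [hι0, hx₀]
    exact gnomonic_sphere_coord x ξ
  refine ⟨fun ζ => gnomonic x (ι ζ), hΦ, hΦ0, ?_, ?_⟩
  · -- the chart at `x₀` provides a smooth left inverse
    set Ψ : E n → E n := fun ζ => gnomonic x₀ ((x : E (n + 1)) + tangentFrame x ζ) with hΨdef
    have hΨ : DifferentiableAt ℝ Ψ (gnomonic x (ι 0)) := by
      have h1 : inner ℝ (x₀ : E (n + 1)) ((x : E (n + 1)) + tangentFrame x (gnomonic x (ι 0))) ≠ 0 := by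
        rw [add_tangentFrame_gnomonic x hpos.ne', inner_smul_right, hι0, inner_self_eq_one, mul_one,
          ← hι0]
        exact inv_ne_zero hpos.ne'
      exact DifferentiableAt.comp (g := gnomonic x₀) _
        ((contDiffAt_gnomonic x₀ h1).differentiableAt (by norm_num))
        ((contDiff_const (n := 4).add (tangentFrame x).contDiff).differentiable (by norm_num) _)
    have hid : (fun ζ => Ψ (gnomonic x (ι ζ))) =ᶠ[𝓝 0] fun ζ => ζ := by
      filter_upwards [hev] with ζ hζ
      rw [hΨdef]
      dsimp only
      rw [add_tangentFrame_gnomonic x hζ.ne', gnomonic_smul _ (inv_ne_zero hζ.ne'), hι]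
      exact gnomonic_add_tangentFrame x₀ ζ
    have h1 := HasFDerivAt.comp (g := Ψ) 0 hΨ.hasFDerivAt
      (hΦ.differentiableAt (by norm_num)).hasFDerivAt
    have h2 := (h1.congr_of_eventuallyEq hid.symm).unique (hasFDerivAt_id 0)
    intro a b hab
    have h3 := DFunLike.congr_fun h2 a
    have h4 := DFunLike.congr_fun h2 b
    simp only [ContinuousLinearMap.comp_apply, ContinuousLinearMap.id_apply] at h3 h4
    rw [← h3, ← h4, hab]
  · filter_upwards [hev] with ζ hζ
    exact (sphere_coord x₀ ζ).trans (sphere_coord_gnomonic x hζ).symm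

/-! ### The radial extension of a function on the sphere -/

/-- The extension of `φ` to `ℝⁿ⁺¹ \ {0}` that is homogeneous of degree zero. -/
def radialExt (φ : SpherePt n → ℝ) (z : E (n + 1)) : ℝ := φ (radialProj z)

theorem contDiffAt_radialExt {φ : SpherePt n → ℝ} (hφ : IsCk (sphere n) 2 φ) {z : E (n + 1)}
    (hz : z ≠ 0) : ContDiffAt ℝ 2 (radialExt φ) z := by
  have hpos : 0 < inner ℝ (radialProj z : E (n + 1)) z := by
    rw [coe_radialProj hz, real_inner_smul_left, real_inner_self_eq_norm_sq]
    have := norm_pos_iff.2 hz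
    positivity
  have h0 : gnomonic (radialProj z) z = 0 := by
    have h1 : z = ‖z‖ • (radialProj z : E (n + 1)) := by
      rw [coe_radialProj hz, smul_smul, mul_inv_cancel₀ (norm_ne_zero_iff.2 hz), one_smul]
    conv_lhs => rw [h1, gnomonic_smul _ (norm_ne_zero_iff.2 hz)]
    rw [← h1]
    exact gnomonic_self _
  have h2 : ContDiffAt ℝ 2
      (fun w => (fun ξ => φ ((sphere n).coord (radialProj z) ξ)) (gnomonic (radialProj z) w)) z := by
    refine ContDiffAt.comp (g := fun ξ => φ ((sphere n).coord (radialProj z) ξ)) z ?_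
      ((contDiffAt_gnomonic _ hpos.ne').of_le (by norm_num))
    rw [h0]
    exact hφ (radialProj z)
  refine h2.congr_of_eventuallyEq ?_
  filter_upwards [(continuousAt_inner_left (radialProj z) z).eventually (lt_mem_nhds hpos)] with w hw
  exact (congrArg φ (sphere_coord_gnomonic _ hw)).symm

theorem comp_sphere_coord (φ : SpherePt n → ℝ) (x : SpherePt n) :
    (fun ξ => φ ((sphere n).coord x ξ)) =
      fun ξ => radialExt φ ((x : E (n + 1)) + tangentFrame x ξ) :=
  funext fun ξ => congrArg φ (sphere_coord x ξ)

theorem fderiv_comp_sphere_coord {φ : SpherePt n → ℝ} (hφ : IsCk (sphere n) 2 φ) (x : SpherePt n)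
    (ξ : E n) : fderiv ℝ (fun ξ => φ ((sphere n).coord x ξ)) ξ =
      (fderiv ℝ (radialExt φ) ((x : E (n + 1)) + tangentFrame x ξ)).comp
        (tangentFrame x).toContinuousLinearMap := by
  rw [comp_sphere_coord]
  exact (HasFDerivAt.comp (g := radialExt φ) ξ
    ((contDiffAt_radialExt hφ (add_tangentFrame_ne_zero x ξ)).differentiableAt
      (by norm_num)).hasFDerivAt
    ((tangentFrame x).toContinuousLinearMap.hasFDerivAt.const_add _)).fderiv

theorem hasFDerivAt_fderiv_radialExt {φ : SpherePt n → ℝ} (hφ : IsCk (sphere n) 2 φ)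
    {z : E (n + 1)} (hz : z ≠ 0) :
    HasFDerivAt (fderiv ℝ (radialExt φ)) (fderiv ℝ (fderiv ℝ (radialExt φ)) z) z :=
  (((contDiffAt_radialExt hφ hz).fderiv_right (m := 1) (by norm_num)).differentiableAt
    (by norm_num)).hasFDerivAt

/-- The chart `coord x` followed by `φ` is the restriction of the radial extension to the affine tangent
plane at `x`, so no curvature terms appear. -/
theorem sphere_hess {φ : SpherePt n → ℝ} (hφ : IsCk (sphere n) 2 φ) (x : SpherePt n) (a b : E n) :
    hess (sphere n) φ x a b = fderiv ℝ (fderiv ℝ (radialExt φ)) (x : E (n + 1))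
      (tangentFrame x a) (tangentFrame x b) := by
  have h0 : (x : E (n + 1)) + tangentFrame x 0 = x := by rw [map_zero, add_zero]
  have h1 : HasFDerivAt
      (fun ξ => fderiv ℝ (radialExt φ) ((x : E (n + 1)) + tangentFrame x ξ))
      ((fderiv ℝ (fderiv ℝ (radialExt φ)) (x : E (n + 1))).comp
        (tangentFrame x).toContinuousLinearMap) 0 := by
    refine HasFDerivAt.comp (g := fderiv ℝ (radialExt φ)) 0 ?_
      ((tangentFrame x).toContinuousLinearMap.hasFDerivAt.const_add _)
    have h2 := hasFDerivAt_fderiv_radialExt hφ (ne_zero_of_mem_unit_sphere x)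
    change HasFDerivAt _ _ ((x : E (n + 1)) + tangentFrame x 0)
    rwa [h0]
  unfold hess
  rw [show fderiv ℝ (fun ξ => φ ((sphere n).coord x ξ)) = _ from
    funext (fderiv_comp_sphere_coord hφ x)]
  have h3 := HasFDerivAt.comp (g := fun L : E (n + 1) →L[ℝ] ℝ =>
    L.comp (tangentFrame x).toContinuousLinearMap) 0
    ((ContinuousLinearMap.compL ℝ (E n) (E (n + 1)) ℝ).flip
      (tangentFrame x).toContinuousLinearMap).hasFDerivAt h1
  exact DFunLike.congr_fun (DFunLike.congr_fun (HasFDerivAt.fderiv h3) a) b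

/-- Differentiating `φ(s z) = φ(z)` in `s`. -/
theorem fderiv_radialExt_self {φ : SpherePt n → ℝ} (hφ : IsCk (sphere n) 2 φ) {z : E (n + 1)}
    (hz : z ≠ 0) : fderiv ℝ (radialExt φ) z z = 0 := by
  have d1 : HasDerivAt (fun s : ℝ => s • z) z 1 := by
    simpa using (hasDerivAt_id (1 : ℝ)).smul_const z
  have d2 : HasFDerivAt (radialExt φ) (fderiv ℝ (radialExt φ) z) ((1 : ℝ) • z) := by
    rw [one_smul]
    exact ((contDiffAt_radialExt hφ hz).differentiableAt (by norm_num)).hasFDerivAt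
  have d3 : HasDerivAt (fun s : ℝ => radialExt φ (s • z)) (fderiv ℝ (radialExt φ) z z) 1 :=
    HasFDerivAt.comp_hasDerivAt (l := radialExt φ) 1 d2 d1
  refine d3.unique ((hasDerivAt_const (1 : ℝ) (radialExt φ z)).congr_of_eventuallyEq ?_)
  filter_upwards [lt_mem_nhds (one_pos : (0 : ℝ) < 1)] with s hs
  exact congrArg φ (radialProj_smul hs hz)

/-- Differentiating `⟨∇φ(s z), s z⟩ = 0` in `s`. -/
theorem fderiv_fderiv_radialExt_self {φ : SpherePt n → ℝ} (hφ : IsCk (sphere n) 2 φ)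
    {z : E (n + 1)} (hz : z ≠ 0) : fderiv ℝ (fderiv ℝ (radialExt φ)) z z z = 0 := by
  have d1 : HasDerivAt (fun s : ℝ => s • z) z 1 := by
    simpa using (hasDerivAt_id (1 : ℝ)).smul_const z
  have d2 : HasFDerivAt (fderiv ℝ (radialExt φ)) (fderiv ℝ (fderiv ℝ (radialExt φ)) z)
      ((1 : ℝ) • z) := by
    rw [one_smul]
    exact hasFDerivAt_fderiv_radialExt hφ hz
  have d3 : HasDerivAt (fun s : ℝ => fderiv ℝ (radialExt φ) (s • z))
      (fderiv ℝ (fderiv ℝ (radialExt φ)) z z) 1 := HasFDerivAt.comp_hasDerivAt 1 d2 d1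
  have d4 : HasDerivAt (fun s : ℝ => fderiv ℝ (radialExt φ) (s • z) z)
      (fderiv ℝ (fderiv ℝ (radialExt φ)) z z z) 1 :=
    HasFDerivAt.comp_hasDerivAt (l := fun L : E (n + 1) →L[ℝ] ℝ => L z) 1
      (ContinuousLinearMap.apply ℝ ℝ z).hasFDerivAt d3
  refine d4.unique ((hasDerivAt_const (1 : ℝ) (0 : ℝ)).congr_of_eventuallyEq ?_)
  filter_upwards [lt_mem_nhds (one_pos : (0 : ℝ) < 1)] with s hs
  have h1 := fderiv_radialExt_self hφ (smul_ne_zero hs.ne' hz)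
  rw [map_smul, smul_eq_mul] at h1
  exact (mul_eq_zero.1 h1).resolve_left hs.ne'

theorem norm_tangentPart_le (x : SpherePt n) (z : E (n + 1)) : ‖tangentPart x z‖ ≤ ‖z‖ := by
  refine (ContinuousLinearMap.le_opNorm _ _).trans (mul_le_of_le_one_left (norm_nonneg _) ?_)
  rw [tangentPart, LinearIsometryEquiv.norm_map]
  exact (tangentFrame x).norm_toContinuousLinearMap_le

/-- The derivative of the radial extension vanishes in the radial direction. The right-hand side
involves no frame, which makes continuity visible. -/
theorem norm_sphere_grad {φ : SpherePt n → ℝ} (hφ : IsCk (sphere n) 2 φ) (x : SpherePt n) :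
    ‖grad (sphere n) φ x‖ = ‖fderiv ℝ (radialExt φ) (x : E (n + 1))‖ := by
  have h0 : (x : E (n + 1)) + tangentFrame x 0 = x := by rw [map_zero, add_zero]
  have h1 : ‖grad (sphere n) φ x‖ = ‖(fderiv ℝ (radialExt φ) (x : E (n + 1))).comp
      (tangentFrame x).toContinuousLinearMap‖ := by
    unfold grad gradient
    rw [LinearIsometryEquiv.norm_map, fderiv_comp_sphere_coord hφ, h0]
  rw [h1]
  apply le_antisymm
  · exact (ContinuousLinearMap.opNorm_comp_le _ _).trans (mul_le_of_le_one_right (norm_nonneg _)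
      (tangentFrame x).norm_toContinuousLinearMap_le)
  · refine ContinuousLinearMap.opNorm_le_bound _ (norm_nonneg _) fun z => ?_
    have h2 : fderiv ℝ (radialExt φ) (x : E (n + 1)) z =
        (fderiv ℝ (radialExt φ) (x : E (n + 1))).comp
          (tangentFrame x).toContinuousLinearMap (tangentPart x z) := by
      conv_lhs => rw [← inner_smul_add_tangentFrame x z]
      rw [map_add, map_smul, fderiv_radialExt_self hφ (ne_zero_of_mem_unit_sphere x), smul_zero,
        zero_add]
      rfl
    rw [h2]
    exact (ContinuousLinearMap.le_opNorm _ _).trans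
      (mul_le_mul_of_nonneg_left (norm_tangentPart_le x z) (norm_nonneg _))

theorem continuous_fderiv_radialExt {φ : SpherePt n → ℝ} (hφ : IsCk (sphere n) 2 φ) :
    Continuous fun x : SpherePt n => fderiv ℝ (radialExt φ) (x : E (n + 1)) :=
  continuous_iff_continuousAt.2 fun x => ContinuousAt.comp (g := fderiv ℝ (radialExt φ))
    (hasFDerivAt_fderiv_radialExt hφ (ne_zero_of_mem_unit_sphere x)).continuousAt
    continuous_subtype_val.continuousAt

theorem continuous_fderiv_fderiv_radialExt {φ : SpherePt n → ℝ} (hφ : IsCk (sphere n) 2 φ) :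
    Continuous fun x : SpherePt n => fderiv ℝ (fderiv ℝ (radialExt φ)) (x : E (n + 1)) :=
  continuous_iff_continuousAt.2 fun x => ContinuousAt.comp (g := fderiv ℝ (fderiv ℝ (radialExt φ)))
    (((contDiffAt_radialExt hφ (ne_zero_of_mem_unit_sphere x)).fderiv_right (m := 1)
      (by norm_num)).fderiv_right (m := 0) (by norm_num)).continuousAt
    continuous_subtype_val.continuousAt

theorem sphere_norm_hess_le {φ : SpherePt n → ℝ} (hφ : IsCk (sphere n) 2 φ) :
    ∃ C : ℝ, ∀ x, ‖hess (sphere n) φ x‖ ≤ C := by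
  obtain ⟨C, hC⟩ := (isCompact_range (continuous_fderiv_fderiv_radialExt hφ).norm).bddAbove
  refine ⟨C, fun x => le_trans ?_ (hC (mem_range_self x))⟩
  refine ContinuousLinearMap.opNorm_le_bound₂ _ (norm_nonneg _) fun a b => ?_
  rw [sphere_hess hφ]
  simpa only [LinearIsometry.norm_map] using ContinuousLinearMap.le_opNorm₂
    (fderiv ℝ (fderiv ℝ (radialExt φ)) (x : E (n + 1))) (tangentFrame x a) (tangentFrame x b)

end

section

variable {n : ℕ}

/-! ### The surface measure in a central projection chart -/

/-- The isometry `z ↦ (⟪x, z⟫, P z)`, where `P z` are the coordinates of the tangential part. -/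
def tangentSplit (x : SpherePt n) : E (n + 1) ≃ₗᵢ[ℝ] WithLp 2 (ℝ × E n) :=
  LinearIsometry.toLinearIsometryEquiv
    { toFun := fun z => WithLp.toLp 2 ((inner ℝ (x : E (n + 1)) z : ℝ), tangentPart x z)
      map_add' := fun z w => by
        rw [inner_add_right, map_add, ← Prod.mk_add_mk, WithLp.toLp_add]
      map_smul' := fun r z => by
        rw [inner_smul_right, map_smul, ← smul_eq_mul, ← Prod.smul_mk, WithLp.toLp_smul,
          RingHom.id_apply]
      norm_map' := fun z => by
        change ‖WithLp.toLp 2 ((inner ℝ (x : E (n + 1)) z : ℝ), tangentPart x z)‖ = ‖z‖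
        rw [← sq_eq_sq₀ (norm_nonneg _) (norm_nonneg _), WithLp.prod_norm_sq_eq_of_L2]
        conv_rhs => rw [← inner_smul_add_tangentFrame x z]
        rw [norm_add_sq_real, real_inner_smul_left, inner_tangentFrame, norm_smul,
          LinearIsometry.norm_map, norm_eq_of_mem_sphere]
        simp }
    (by
      rw [finrank_euclideanSpace_fin, (WithLp.linearEquiv 2 ℝ (ℝ × E n)).finrank_eq,
        Module.finrank_prod, finrank_euclideanSpace_fin, Module.finrank_self, add_comm])

theorem measurePreserving_tangentSplit (x : SpherePt n) :
    MeasurePreserving (fun z : E (n + 1) => ((inner ℝ (x : E (n + 1)) z : ℝ), tangentPart x z))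
      volume volume :=
  (WithLp.volume_preserving_ofLp ℝ (E n)).comp (tangentSplit x).measurePreserving

/-- The cone with vertex `0` over the subset `{x + ξ | ξ ∈ S}` of the affine tangent space. -/
def flatCone (x : SpherePt n) (S : Set (E n)) : Set (E (n + 1)) :=
  {z | inner ℝ (x : E (n + 1)) z ∈ Ioo (0 : ℝ) 1 ∧ gnomonic x z ∈ S}

theorem lintegral_Ioo_pow (n : ℕ) :
    ∫⁻ r in Ioo (0 : ℝ) 1, ENNReal.ofReal (r ^ n) = ENNReal.ofReal (1 / (n + 1)) := by
  rw [Measure.restrict_congr_set Ioo_ae_eq_Ioc,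
    ← ofReal_integral_eq_lintegral_ofReal (intervalIntegral.intervalIntegrable_pow _).1,
    ← intervalIntegral.integral_of_le zero_le_one]
  · simp
  · filter_upwards [ae_restrict_mem measurableSet_Ioc] with y hy
    exact pow_nonneg hy.1.le _

/-- The volume of a cone of height `1` in dimension `n + 1` over a base in dimension `n`. -/
theorem natCast_mul_volume_flatCone (x : SpherePt n) {S : Set (E n)} (hS : MeasurableSet S) :
    ((n + 1 : ℕ) : ENNReal) * volume (flatCone x S) = volume S := by
  set D : Set (ℝ × E n) := {q | q.1 ∈ Ioo (0 : ℝ) 1 ∧ q.1⁻¹ • q.2 ∈ S} with hD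
  have hDm : MeasurableSet D := by
    refine (measurable_fst measurableSet_Ioo).inter ?_
    exact (measurable_fst.inv.smul measurable_snd) hS
  have h1 : volume (flatCone x S) = volume D :=
    (measurePreserving_tangentSplit x).measure_preimage hDm.nullMeasurableSet
  have h2 : ∀ r : ℝ, volume (Prod.mk r ⁻¹' D) =
      (Ioo (0 : ℝ) 1).indicator (fun r => ENNReal.ofReal (r ^ n) * volume S) r := by
    intro r
    by_cases hr : r ∈ Ioo (0 : ℝ) 1
    · rw [indicator_of_mem hr]
      have h3 : Prod.mk r ⁻¹' D = (fun w => r⁻¹ • w) ⁻¹' S := by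
        ext w
        exact and_iff_right hr
      rw [h3, Measure.addHaar_preimage_smul _ (inv_ne_zero hr.1.ne'), finrank_euclideanSpace_fin,
        inv_pow, inv_inv, abs_of_nonneg (pow_nonneg hr.1.le _)]
    · rw [indicator_of_notMem hr]
      have h3 : Prod.mk r ⁻¹' D = ∅ := eq_empty_of_forall_notMem fun w hw => hr hw.1
      rw [h3, measure_empty]
  have h4 : volume D = ENNReal.ofReal (1 / (n + 1)) * volume S := by
    rw [Measure.volume_eq_prod, Measure.prod_apply hDm]
    simp only [h2]
    rw [lintegral_indicator measurableSet_Ioo, lintegral_mul_const _ (by fun_prop),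
      lintegral_Ioo_pow]
  have h5 : ((n + 1 : ℕ) : ENNReal) = ENNReal.ofReal (n + 1) := by
    rw [← ENNReal.ofReal_natCast]
    push_cast
    rfl
  rw [h1, h4, ← mul_assoc, h5, ← ENNReal.ofReal_mul (by positivity), mul_one_div_cancel (by positivity),
    ENNReal.ofReal_one, one_mul]

open scoped Pointwise in
/-- The surface measure of `B` is `n + 1` times the volume of the spherical cone over `B`. -/
theorem sphere_vol_apply {B : Set (SpherePt n)} (hB : MeasurableSet B) :
    (sphere n).vol B = ((n + 1 : ℕ) : ENNReal) *
      (volume : Measure (E (n + 1))) {z | ‖z‖ ∈ Ioo (0 : ℝ) 1 ∧ radialProj z ∈ B} := by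
  change (volume : Measure (E (n + 1))).toSphere B = _
  rw [Measure.toSphere_apply' _ hB, finrank_euclideanSpace_fin]
  congr 2
  ext z
  constructor
  · rintro ⟨r, hr, _, ⟨y, hy, rfl⟩, rfl⟩
    dsimp only
    refine ⟨?_, ?_⟩
    · rwa [norm_smul, norm_eq_of_mem_sphere, mul_one, Real.norm_of_nonneg hr.1.le]
    · rwa [radialProj_smul hr.1 (ne_zero_of_mem_unit_sphere y), radialProj_coe]
  · rintro ⟨hz, hB⟩
    refine ⟨‖z‖, hz, _, ⟨_, hB, rfl⟩, ?_⟩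
    dsimp only
    rw [coe_radialProj (norm_pos_iff.1 hz.1), smul_smul, mul_inv_cancel₀ hz.1.ne', one_smul]

theorem gnomonic_radialProj (x : SpherePt n) {z : E (n + 1)} (hz : z ≠ 0) :
    gnomonic x (radialProj z : E (n + 1)) = gnomonic x z := by
  rw [coe_radialProj hz, gnomonic_smul _ (inv_ne_zero (norm_ne_zero_iff.2 hz))]

theorem measurable_gnomonic (x : SpherePt n) : Measurable (gnomonic x) :=
  Measurable.smul (f := fun z => (inner ℝ (x : E (n + 1)) z : ℝ)⁻¹)
    (continuous_const.inner continuous_id).measurable.inv (tangentPart x).continuous.measurable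

theorem sphere_coord_image (x : SpherePt n) (S : Set (E n)) :
    (sphere n).coord x '' S =
      {y : SpherePt n | 0 < inner ℝ (x : E (n + 1)) (y : E (n + 1)) ∧ gnomonic x (y : E (n + 1)) ∈ S} := by
  ext y
  constructor
  · rintro ⟨ξ, hξ, rfl⟩
    refine ⟨inner_sphere_coord_pos x ξ, ?_⟩
    rwa [gnomonic_sphere_coord]
  · rintro ⟨hy, hS⟩
    exact ⟨_, hS, (sphere_coord_gnomonic x hy).trans (radialProj_coe y)⟩

/-- The spherical cone over the image of `S` is contained in the flat cone over `S`. -/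
theorem sphere_vol_image_le (x : SpherePt n) (S : Set (E n)) :
    (sphere n).vol ((sphere n).coord x '' S) ≤ volume S := by
  set S' := toMeasurable volume S
  have hS' : MeasurableSet S' := measurableSet_toMeasurable _ _
  have himg : MeasurableSet ((sphere n).coord x '' S') := by
    rw [sphere_coord_image]
    have h1 : Continuous fun y : SpherePt n => (inner ℝ (x : E (n + 1)) (y : E (n + 1)) : ℝ) :=
      continuous_const.inner continuous_subtype_val
    exact (measurableSet_lt measurable_const h1.measurable).inter
      ((measurable_gnomonic x).comp measurable_subtype_coe hS')
  calc (sphere n).vol ((sphere n).coord x '' S)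
      ≤ (sphere n).vol ((sphere n).coord x '' S') :=
        measure_mono (image_mono (subset_toMeasurable _ _))
    _ ≤ ((n + 1 : ℕ) : ENNReal) * volume (flatCone x S') := by
        rw [sphere_vol_apply himg]
        refine mul_le_mul' le_rfl (measure_mono ?_)
        rintro z ⟨hz, hzS⟩
        have hz0 := norm_pos_iff.1 hz.1
        rw [sphere_coord_image] at hzS
        obtain ⟨h1, h2⟩ := hzS
        rw [gnomonic_radialProj x hz0] at h2
        rw [coe_radialProj hz0, inner_smul_right] at h1
        refine ⟨⟨pos_of_mul_pos_right h1 (inv_nonneg.2 hz.1.le), ?_⟩, h2⟩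
        refine (real_inner_le_norm _ _).trans_lt ?_
        rw [norm_eq_of_mem_sphere, one_mul]
        exact hz.2
    _ = volume S' := natCast_mul_volume_flatCone x hS'
    _ = volume S := measure_toMeasurable _

theorem norm_lt_of_mem_flatCone {x : SpherePt n} {δ : ℝ} {S : Set (E n)}
    (hS : S ⊆ Metric.ball 0 δ) {z : E (n + 1)} (hz : z ∈ flatCone x S) :
    ‖z‖ < √(1 + δ ^ 2) := by
  obtain ⟨⟨h0, h1⟩, h2⟩ := hz
  have h3 := mem_ball_zero_iff.1 (hS h2)
  have h4 : ‖(x : E (n + 1)) + tangentFrame x (gnomonic x z)‖ ^ 2 = 1 + ‖gnomonic x z‖ ^ 2 := by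
    rw [norm_add_sq_real, inner_tangentFrame, norm_eq_of_mem_sphere, LinearIsometry.norm_map]
    ring
  have h5 : z = (inner ℝ (x : E (n + 1)) z : ℝ) •
      ((x : E (n + 1)) + tangentFrame x (gnomonic x z)) := by
    rw [add_tangentFrame_gnomonic x h0.ne', smul_smul, mul_inv_cancel₀ h0.ne', one_smul]
  apply Real.lt_sqrt_of_sq_lt
  rw [h5, norm_smul, mul_pow, h4, Real.norm_of_nonneg h0.le]
  have h6 : ‖gnomonic x z‖ ^ 2 < δ ^ 2 := pow_lt_pow_left₀ h3 (norm_nonneg _) two_ne_zero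
  have h7 : (inner ℝ (x : E (n + 1)) z : ℝ) ^ 2 ≤ 1 := pow_le_one₀ h0.le h1.le
  nlinarith [sq_nonneg ‖gnomonic x z‖]

/-- Over a small base, the flat cone is contained in a slight dilation of the spherical cone. -/
theorem sphere_vol_preimage_le {ε : ℝ} (hε : 0 < ε) : ∃ δ > (0 : ℝ), ∀ (x : SpherePt n)
    (B : Set (SpherePt n)), MeasurableSet B →
    volume ((sphere n).coord x ⁻¹' B ∩ Metric.ball 0 δ) ≤
      ENNReal.ofReal (1 + ε) * (sphere n).vol B := by
  obtain ⟨δ, hδ, hδε⟩ : ∃ δ > (0 : ℝ), √(1 + δ ^ 2) ^ (n + 1) < 1 + ε := by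
    have h1 : ContinuousAt (fun δ : ℝ => √(1 + δ ^ 2) ^ (n + 1)) 0 := by fun_prop
    have h2 : ∀ᶠ δ in 𝓝 (0 : ℝ), √(1 + δ ^ 2) ^ (n + 1) < 1 + ε :=
      h1.eventually (gt_mem_nhds (by simpa using hε))
    obtain ⟨δ, h3, h4⟩ := ((h2.filter_mono nhdsWithin_le_nhds).and
      (self_mem_nhdsWithin : Ioi (0 : ℝ) ∈ 𝓝[>] 0)).exists
    exact ⟨δ, h4, h3⟩
  refine ⟨δ, hδ, fun x B hB => ?_⟩
  set S := (sphere n).coord x ⁻¹' B ∩ Metric.ball 0 δ with hS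
  have hSm : MeasurableSet S :=
    ((sphere_continuous_coord x).measurable hB).inter measurableSet_ball
  set s := √(1 + δ ^ 2) with hs
  have hs0 : 0 < s := by positivity
  set C : Set (E (n + 1)) := {z | ‖z‖ ∈ Ioo (0 : ℝ) 1 ∧ radialProj z ∈ B} with hC
  have hsub : flatCone x S ⊆ (fun z => s⁻¹ • z) ⁻¹' C := by
    intro z hz
    have h1 := norm_lt_of_mem_flatCone (inter_subset_right : S ⊆ Metric.ball 0 δ) hz
    have h2 : (sphere n).coord x (gnomonic x z) ∈ B := hz.2.1
    rw [sphere_coord_gnomonic x hz.1.1] at h2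
    have hz0 := ne_zero_of_inner_pos hz.1.1
    refine ⟨⟨norm_pos_iff.2 (smul_ne_zero (inv_ne_zero hs0.ne') hz0), ?_⟩, ?_⟩
    · rw [norm_smul, norm_inv, Real.norm_of_nonneg hs0.le, inv_mul_lt_iff₀ hs0, mul_one]
      exact h1
    · rwa [radialProj_smul (inv_pos.2 hs0) hz0]
  calc volume S = ((n + 1 : ℕ) : ENNReal) * volume (flatCone x S) :=
        (natCast_mul_volume_flatCone x hSm).symm
    _ ≤ ((n + 1 : ℕ) : ENNReal) * (ENNReal.ofReal (s ^ (n + 1)) * volume C) := by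
        refine mul_le_mul' le_rfl ((measure_mono hsub).trans_eq ?_)
        rw [Measure.addHaar_preimage_smul _ (inv_ne_zero hs0.ne'), finrank_euclideanSpace_fin,
          inv_pow, inv_inv, abs_of_nonneg (pow_nonneg hs0.le _)]
    _ = ENNReal.ofReal (s ^ (n + 1)) * (sphere n).vol B := by
        rw [sphere_vol_apply hB]
        ring
    _ ≤ ENNReal.ofReal (1 + ε) * (sphere n).vol B :=
        mul_le_mul' (ENNReal.ofReal_le_ofReal hδε.le) le_rfl

theorem measurable_radialProj : Measurable (radialProj (n := n)) := by
  have h1 : (Subtype.val ∘ radialProj (n := n)) = fun z => if z = 0 then e 0 else ‖z‖⁻¹ • z := by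
    funext z
    by_cases hz : z = 0
    · simp [radialProj, hz]
    · simp [radialProj, hz]
  have h2 : MeasurableEmbedding (Subtype.val : SpherePt n → E (n + 1)) :=
    MeasurableEmbedding.subtype_coe Metric.isClosed_sphere.measurableSet
  rw [← h2.measurable_comp_iff, h1]
  exact Measurable.ite (measurableSet_singleton 0) measurable_const
    (continuous_norm.measurable.inv.smul measurable_id)

/-- Linear isometries preserve the surface measure. -/
theorem measurePreserving_sphere_of_isometry (U : E (n + 1) →ₗᵢ[ℝ] E (n + 1))
    {θ : SpherePt n → SpherePt n} (hθ : ∀ x, (θ x : E (n + 1)) = U (x : E (n + 1))) :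
    MeasurePreserving θ (sphere n).vol (sphere n).vol := by
  have hmeas : Measurable θ := by
    refine (Continuous.measurable ?_)
    rw [continuous_induced_rng]
    have h1 : (Subtype.val ∘ θ) = fun x : SpherePt n => U (x : E (n + 1)) := funext hθ
    rw [h1]
    exact U.continuous.comp continuous_subtype_val
  refine ⟨hmeas, Measure.ext fun B hB => ?_⟩
  have hUm : MeasurePreserving U volume volume := (U.toLinearIsometryEquiv rfl).measurePreserving
  have hcm : ∀ {B : Set (SpherePt n)}, MeasurableSet B →
      MeasurableSet {z : E (n + 1) | ‖z‖ ∈ Ioo (0 : ℝ) 1 ∧ radialProj z ∈ B} := by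
    intro B hB
    exact (continuous_norm.measurable measurableSet_Ioo).inter (measurable_radialProj hB)
  rw [Measure.map_apply hmeas hB, sphere_vol_apply (hmeas hB), sphere_vol_apply hB,
    ← hUm.measure_preimage (hcm hB).nullMeasurableSet]
  congr 2
  ext z
  have key : z ≠ 0 → θ (radialProj z) = radialProj (U z) := by
    intro hz
    have hUz : U z ≠ 0 := fun h => hz (by
      rw [← norm_eq_zero, ← U.norm_map, h, norm_zero])
    apply Subtype.ext
    rw [hθ, coe_radialProj hz, coe_radialProj hUz, U.norm_map, map_smul]
  simp only [mem_preimage, Set.mem_ofPred_eq, U.norm_map]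
  refine and_congr_right fun h => ?_
  rw [key (norm_pos_iff.1 h.1)]

end

section

variable {n : ℕ}

/-! ### Rotations and the Laplacian on the sphere -/

section Rotation

variable {F : Type*} [NormedAddCommGroup F] [InnerProductSpace ℝ F] {A : F →L[ℝ] F}

/-- Rodrigues' formula: for a skew operator `A` with `A³ = -A`, the operator `exp (t A)` equals
`1 + sin t A + (1 - cos t) A²` and is an isometry. -/
def rotation (A : F →L[ℝ] F) (hskew : ∀ z, inner ℝ (A z) z = 0) (hcube : ∀ z, A (A (A z)) = -A z)
    (t : ℝ) : F →ₗᵢ[ℝ] F where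
  toLinearMap := (ContinuousLinearMap.id ℝ F + Real.sin t • A + (1 - Real.cos t) • A.comp A :
    F →L[ℝ] F)
  norm_map' z := by
    have hpol : ∀ v w, inner ℝ (A v) w = -inner ℝ v (A w) := by
      intro v w
      have h1 := hskew (v + w)
      rw [map_add, inner_add_left, inner_add_right, inner_add_right, hskew, hskew] at h1
      linarith [real_inner_comm v (A w)]
    change ‖z + Real.sin t • A z + (1 - Real.cos t) • A (A z)‖ = ‖z‖
    have h1 : inner ℝ z (A z) = 0 := by rw [real_inner_comm, hskew]
    have h2 : inner ℝ (A z) (A (A z)) = 0 := by rw [real_inner_comm, hskew]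
    have h3 : inner ℝ z (A (A z)) = -‖A z‖ ^ 2 := by
      rw [← real_inner_self_eq_norm_sq, hpol, neg_neg]
    have h4 : ‖A (A z)‖ ^ 2 = ‖A z‖ ^ 2 := by
      rw [← real_inner_self_eq_norm_sq, hpol, hcube, inner_neg_right, neg_neg,
        real_inner_self_eq_norm_sq]
    rw [← sq_eq_sq₀ (norm_nonneg _) (norm_nonneg _), norm_add_sq_real, norm_add_sq_real,
      inner_add_left, inner_smul_right, inner_smul_right, inner_smul_right, real_inner_smul_left,
      h1, h2, h3, norm_smul, norm_smul, mul_pow, mul_pow, h4, Real.norm_eq_abs, Real.norm_eq_abs,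
      sq_abs, sq_abs]
    linear_combination ‖A z‖ ^ 2 * Real.sin_sq_add_cos_sq t

theorem hasDerivAt_rotation (hskew : ∀ z, inner ℝ (A z) z = 0) (hcube : ∀ z, A (A (A z)) = -A z)
    (z : F) (t : ℝ) :
    HasDerivAt (fun t => rotation A hskew hcube t z) (A (rotation A hskew hcube t z)) t := by
  change HasDerivAt (fun t => z + Real.sin t • A z + (1 - Real.cos t) • A (A z))
    (A (z + Real.sin t • A z + (1 - Real.cos t) • A (A z))) t
  have h1 := (((Real.hasDerivAt_sin t).smul_const (A z)).const_add z).add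
    (((Real.hasDerivAt_cos t).const_sub 1).smul_const (A (A z)))
  refine h1.congr_deriv ?_
  rw [map_add, map_add, map_smul, map_smul, hcube]
  module

theorem hasDerivAt_clm_apply {L : ℝ → F →L[ℝ] ℝ} {L' : F →L[ℝ] ℝ} {v : ℝ → F} {v' : F} {t : ℝ}
    (hL : HasDerivAt L L' t) (hv : HasDerivAt v v' t) :
    HasDerivAt (fun t => L t (v t)) (L' (v t) + L t v') t := hL.clm_apply hv

end Rotation

/-- The mean of the second derivative along the orbits of a one-parameter group of rotations
vanishes. -/
theorem sphere_integral_rotation {φ : SpherePt n → ℝ} (hφ : IsCk (sphere n) 2 φ)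
    {A : E (n + 1) →L[ℝ] E (n + 1)} (hskew : ∀ z, inner ℝ (A z) z = 0)
    (hcube : ∀ z, A (A (A z)) = -A z) :
    ∫ x : SpherePt n, (fderiv ℝ (fderiv ℝ (radialExt φ)) (x : E (n + 1)) (A x) (A x) +
      fderiv ℝ (radialExt φ) (x : E (n + 1)) (A (A x))) ∂(sphere n).vol = 0 := by
  set R := rotation A hskew hcube with hR
  have hAx : Continuous fun x : SpherePt n => A (x : E (n + 1)) :=
    A.continuous.comp continuous_subtype_val
  refine integral_eq_zero_of_flow (X := SpherePt n) (μ := (sphere n).vol)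
    (θ := fun t x => ⟨R t x, by
      rw [mem_sphere_zero_iff_norm, LinearIsometry.norm_map, norm_eq_of_mem_sphere]⟩)
    (ψ := fun x : SpherePt n => fderiv ℝ (radialExt φ) (x : E (n + 1)) (A x)) ?_ (fun t => ?_)
    ((continuous_fderiv_radialExt hφ).clm_apply hAx)
    ((((continuous_fderiv_fderiv_radialExt hφ).clm_apply hAx).clm_apply hAx).add
      ((continuous_fderiv_radialExt hφ).clm_apply (A.continuous.comp hAx))) fun x t => ?_
  · refine Continuous.subtype_mk ?_ _
    change Continuous fun q : ℝ × SpherePt n => (q.2 : E (n + 1)) + Real.sin q.1 • A q.2 +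
      (1 - Real.cos q.1) • A (A q.2)
    fun_prop
  · exact measurePreserving_sphere_of_isometry (R t) fun x => rfl
  · have hne : R t (x : E (n + 1)) ≠ 0 := by
      rw [← norm_ne_zero_iff, LinearIsometry.norm_map, norm_eq_of_mem_sphere]
      exact one_ne_zero
    have d1 := hasDerivAt_rotation hskew hcube (x : E (n + 1)) t
    have d2 : HasDerivAt (fun t => fderiv ℝ (radialExt φ) (R t (x : E (n + 1))))
        (fderiv ℝ (fderiv ℝ (radialExt φ)) (R t (x : E (n + 1))) (A (R t (x : E (n + 1))))) t :=
      HasFDerivAt.comp_hasDerivAt (l := fderiv ℝ (radialExt φ)) t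
        (hasFDerivAt_fderiv_radialExt hφ hne) d1
    have d3 : HasDerivAt (fun t => A (R t (x : E (n + 1)))) (A (A (R t (x : E (n + 1))))) t :=
      HasFDerivAt.comp_hasDerivAt (l := A) t A.hasFDerivAt d1
    exact hasDerivAt_clm_apply d2 d3

/-- The generator of the rotations of the plane of the coordinates `j` and `k`. -/
def planeRotation (j k : Fin (n + 1)) : E (n + 1) →L[ℝ] E (n + 1) :=
  (EuclideanSpace.proj j : E (n + 1) →L[ℝ] ℝ).smulRight (e k) -
    (EuclideanSpace.proj k : E (n + 1) →L[ℝ] ℝ).smulRight (e j)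

theorem planeRotation_apply (j k : Fin (n + 1)) (z : E (n + 1)) :
    planeRotation j k z = z j • e k - z k • e j := rfl

theorem inner_planeRotation (j k : Fin (n + 1)) (z : E (n + 1)) :
    inner ℝ (planeRotation j k z) z = 0 := by
  rw [planeRotation_apply, inner_sub_left, real_inner_smul_left, real_inner_smul_left,
    EuclideanSpace.inner_single_left, EuclideanSpace.inner_single_left]
  simp [mul_comm]

theorem planeRotation_planeRotation (j k : Fin (n + 1)) (z : E (n + 1)) :
    planeRotation j k (planeRotation j k z) =
      ((if j = k then z j else 0) • e k - z j • e j) -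
        (z k • e k - (if j = k then z k else 0) • e j) := by
  rcases eq_or_ne j k with rfl | hjk
  · simp [planeRotation_apply]
  · simp [planeRotation_apply, hjk, hjk.symm]
    abel

theorem planeRotation_cube (j k : Fin (n + 1)) (z : E (n + 1)) :
    planeRotation j k (planeRotation j k (planeRotation j k z)) = -planeRotation j k z := by
  rcases eq_or_ne j k with rfl | hjk
  · simp [planeRotation_apply]
  · simp [planeRotation_apply, hjk, hjk.symm]
    abel

/-- The trace of a bilinear form does not depend on the orthonormal basis. -/
theorem sum_apply_orthonormalBasis {F ι κ : Type*} [NormedAddCommGroup F] [InnerProductSpace ℝ F]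
    [FiniteDimensional ℝ F] [Fintype ι] [Fintype κ] (B : F →L[ℝ] F →L[ℝ] ℝ)
    (b : OrthonormalBasis ι ℝ F) (b' : OrthonormalBasis κ ℝ F) :
    ∑ i, B (b i) (b i) = ∑ j, B (b' j) (b' j) := by
  have h1 := congrArg (TensorProduct.lift ((ContinuousLinearMap.coeLM ℝ).comp B.toLinearMap))
    ((InnerProductSpace.canonicalCovariantTensor_eq_sum F b).symm.trans
      (InnerProductSpace.canonicalCovariantTensor_eq_sum F b'))
  simpa using h1

/-- The Laplacian of `φ` is the Euclidean Laplacian of its radial extension. -/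
theorem sphere_lap {φ : SpherePt n → ℝ} (hφ : IsCk (sphere n) 2 φ) (x : SpherePt n) :
    lap (sphere n) φ x =
      ∑ k, fderiv ℝ (fderiv ℝ (radialExt φ)) (x : E (n + 1)) (e k) (e k) := by
  set B := fderiv ℝ (fderiv ℝ (radialExt φ)) (x : E (n + 1)) with hB
  set v : Option (Fin n) → E (n + 1) := fun o => o.elim (x : E (n + 1)) fun i => tangentFrame x (e i)
    with hv
  have hon : Orthonormal ℝ v := by
    rw [orthonormal_iff_ite]
    rintro (_ | i) (_ | j)
    · simp [hv]
    · simp [hv, inner_tangentFrame]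
    · simp [hv, real_inner_comm, inner_tangentFrame]
    · simp [hv, LinearIsometry.inner_map_map, EuclideanSpace.inner_single_left]
  have hcard : Fintype.card (Option (Fin n)) = Module.finrank ℝ (E (n + 1)) := by
    simp
  have hspan : ⊤ ≤ Submodule.span ℝ (Set.range v) := by
    rw [hon.linearIndependent.span_eq_top_of_card_eq_finrank hcard]
  have h1 := sum_apply_orthonormalBasis B (EuclideanSpace.basisFun (Fin (n + 1)) ℝ)
    (OrthonormalBasis.mk hon hspan)
  simp only [EuclideanSpace.basisFun_apply, OrthonormalBasis.coe_mk, Fintype.sum_option] at h1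
  rw [h1]
  simp only [hv, Option.elim]
  rw [hB, fderiv_fderiv_radialExt_self hφ (ne_zero_of_mem_unit_sphere x), zero_add]
  exact Finset.sum_congr rfl fun i _ => sphere_hess hφ x _ _

/-- `2 Δ` is the sum of the squares of the infinitesimal rotations. -/
theorem sum_planeRotation {φ : SpherePt n → ℝ} (hφ : IsCk (sphere n) 2 φ) (x : SpherePt n) :
    ∑ j, ∑ k, (fderiv ℝ (fderiv ℝ (radialExt φ)) (x : E (n + 1)) (planeRotation j k x)
        (planeRotation j k x) +
      fderiv ℝ (radialExt φ) (x : E (n + 1)) (planeRotation j k (planeRotation j k x))) =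
      2 * lap (sphere n) φ x := by
  rw [sphere_lap hφ]
  have hx := ne_zero_of_mem_unit_sphere x
  obtain ⟨z, hz⟩ : ∃ z : E (n + 1), z = x := ⟨_, rfl⟩
  have hB0 := fderiv_fderiv_radialExt_self hφ hx
  have hD0 := fderiv_radialExt_self hφ hx
  have hnorm : ∑ j, z j ^ 2 = 1 := by
    rw [← EuclideanSpace.real_norm_sq_eq, hz, norm_eq_of_mem_sphere, one_pow]
  rw [← hz] at hB0 hD0 ⊢
  generalize fderiv ℝ (fderiv ℝ (radialExt φ)) z = B at *
  generalize fderiv ℝ (radialExt φ) z = D at *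
  have hB1 : ∑ j, ∑ k, z j * z k * B (e j) (e k) = 0 := by
    have h1 : z = ∑ j, z j • e j := (sum_smul_e z).symm
    rw [← hB0]
    conv_rhs => rw [h1]
    simp only [map_sum, map_smul, _root_.sum_apply, _root_.smul_apply, smul_eq_mul, Finset.mul_sum]
    rw [Finset.sum_comm]
    refine Finset.sum_congr rfl fun j _ => Finset.sum_congr rfl fun k _ => ?_
    ring
  have hB2 : ∑ j, ∑ k, z j * z k * B (e k) (e j) = 0 := by
    rw [Finset.sum_comm, ← hB1]
    refine Finset.sum_congr rfl fun j _ => Finset.sum_congr rfl fun k _ => ?_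
    ring
  have hD1 : ∑ j, z j * D (e j) = 0 := by
    rw [← hD0]
    conv_rhs => rw [← sum_smul_e z]
    simp only [map_sum, map_smul, smul_eq_mul]
  have hterm : ∀ j k, B (planeRotation j k z) (planeRotation j k z) +
      D (planeRotation j k (planeRotation j k z)) =
      (z j ^ 2 * B (e k) (e k) + z k ^ 2 * B (e j) (e j)) - z j * z k * B (e k) (e j) -
        z j * z k * B (e j) (e k) - z j * D (e j) - z k * D (e k) +
        (if j = k then 2 * (z j * D (e j)) else 0) := by
    intro j k
    rw [planeRotation_planeRotation, planeRotation_apply]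
    rcases eq_or_ne j k with rfl | hjk
    · simp only [sub_self, map_zero, if_true]
      simp
      ring
    · simp [hjk]
      ring
  have e2 : ∑ j, ∑ k, z k ^ 2 * B (e j) (e j) = ∑ k, B (e k) (e k) := by
    rw [Finset.sum_comm]
    simp only [← Finset.mul_sum]
    rw [← Finset.sum_mul, hnorm, one_mul]
  simp only [hterm, Finset.sum_add_distrib, Finset.sum_sub_distrib, e2, hB1, hB2, hD1,
    Finset.sum_const_zero, Finset.sum_const, ← Finset.smul_sum, Finset.sum_ite_eq, Finset.mem_univ,
    if_true, ← Finset.mul_sum]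
  rw [← Finset.sum_mul, hnorm]
  simp
  ring

theorem sphere_integral_lap {φ : SpherePt n → ℝ} (hφ : IsCk (sphere n) 2 φ) :
    ∫ x, lap (sphere n) φ x ∂(sphere n).vol = 0 := by
  have hA : ∀ j k : Fin (n + 1), Continuous fun x : SpherePt n => planeRotation j k (x : E (n + 1)) :=
    fun j k => (planeRotation j k).continuous.comp continuous_subtype_val
  have hint : ∀ j k : Fin (n + 1), Integrable (fun x : SpherePt n =>
      fderiv ℝ (fderiv ℝ (radialExt φ)) (x : E (n + 1)) (planeRotation j k x)
        (planeRotation j k x) +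
      fderiv ℝ (radialExt φ) (x : E (n + 1)) (planeRotation j k (planeRotation j k x)))
      (sphere n).vol := fun j k => integrable_of_continuous (M := sphere n)
    ((((continuous_fderiv_fderiv_radialExt hφ).clm_apply (hA j k)).clm_apply (hA j k)).add
      ((continuous_fderiv_radialExt hφ).clm_apply ((planeRotation j k).continuous.comp (hA j k))))
  have h1 : ∫ x, 2 * lap (sphere n) φ x ∂(sphere n).vol = 0 := by
    rw [← integral_congr_ae (Eventually.of_forall fun x => sum_planeRotation hφ x),
      integral_finsetSum _ fun j _ => integrable_finsetSum _ fun k _ => hint j k]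
    refine Finset.sum_eq_zero fun j _ => ?_
    rw [integral_finsetSum _ fun k _ => hint j k]
    exact Finset.sum_eq_zero fun k _ => sphere_integral_rotation hφ (inner_planeRotation j k)
      (planeRotation_cube j k)
  rw [integral_const_mul] at h1
  exact (mul_eq_zero.1 h1).resolve_left two_ne_zero

theorem hasRegularCharts_sphere (n : ℕ) : HasRegularCharts (sphere n) where
  coord_zero := sphere_coord_zero
  continuous_coord := sphere_continuous_coord
  nhds_le_map := sphere_nhds_le
  transition := sphere_transition
  vol_image_le := sphere_vol_image_le
  vol_preimage_le _ hε := sphere_vol_preimage_le hε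
  continuous_norm_grad φ hφ := by
    rw [show (fun x => ‖grad (sphere n) φ x‖) = _ from funext (norm_sphere_grad hφ)]
    exact (continuous_fderiv_radialExt hφ).norm
  norm_hess_le _ hφ := sphere_norm_hess_le hφ
  integral_lap _ hφ := sphere_integral_lap hφ

theorem connectedSpace_sphere {n : ℕ} (hn : 1 ≤ n) : ConnectedSpace (sphere n).Pt := by
  refine isConnected_iff_connectedSpace.1 (isConnected_sphere ?_ (0 : E (n + 1)) zero_le_one)
  rw [← Module.finrank_eq_rank, finrank_euclideanSpace_fin]
  exact_mod_cast Nat.lt_succ_of_le hn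

end

end SobolevDescent

end

open SobolevDescent in
theorem proposition4p1 (n : ℕ) (hn : 1 ≤ n) (M : Manifold n)
    (hM : M = sphere n ∨ M = torus n)
    (c : M.Pt → M.Pt → EReal) (K : Set (M.Pt × M.Pt)) (hc : IsAdmissibleCost M c K)
    (g : M.Pt → ℝ) (hg : IsDensity M g) (lam : ℝ) (hlam : 0 < lam) :
    ∃ τmax : ℝ, 0 < τmax ∧
      ∀ f : M.Pt → ℝ, IsDensity M f →
      -- the solution of the Monge–Ampère equation, and the bounds that define `lam`
      ∀ (α : ℝ≥0) (u : M.Pt → ℝ), 0 < α → α < 1 → IsCkHolder M 3 α u →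
        ∫ x, u x ∂M.vol = 0 → IsCConvex M c u → SolvesMongeAmpere M c f g u →
        EigenvaluesBetween M c K (2 / lam) (lam / 2) u →
      -- the radius of the neighbourhood
      ∀ r : ℝ, 0 < r → (∀ v ∈ nbhd M u r, EigenvaluesBetween M c K (1 / lam) lam v) →
      -- the step size and the iterates
      ∀ τ : ℝ, 0 < τ → τ < τmax → ∀ w : ℕ → M.Pt → ℝ, (∀ k, w k ∈ nbhd M u r) →
        IsSobolevDescent M (dualJ M c f g) τ w →
        ∀ k, (w k ≠ u → dualJ M c f g (w (k + 1)) < dualJ M c f g (w k)) ∧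
          dualJ M c f g (w k) - dualJ M c f g (w (k + 1)) ≥
            1 / (2 * τmax) * ∫ x, ‖grad M (w k) x - grad M (w (k + 1)) x‖ ^ 2 ∂M.vol := by
  rcases hM with rfl | rfl
  · have := connectedSpace_sphere hn
    obtain ⟨τmax, hτ, h⟩ :=
      exists_step_bound_of_hasRegularCharts (hasRegularCharts_sphere n) hc hg hlam
    exact ⟨τmax, hτ, fun f hf α u _ _ huα hu0 _ hMA _ => h f hf α u huα hu0 hMA⟩
  · obtain ⟨τmax, hτ, h⟩ :=
      exists_step_bound_of_hasRegularCharts (hasRegularCharts_torus n) hc hg hlam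
    exact ⟨τmax, hτ, fun f hf α u _ _ huα hu0 _ hMA _ => h f hf α u huα hu0 hMA⟩
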